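/- Let $n \ge 2$, let $(a,b) \subseteq \mathbb{R}$ be an open interval (the end points may be infinite) and let $f : (a,b) \to \mathbb{R}$. Notation. $\mathbb{R}_{n-1}[x]$ and $\mathbb{C}_{n-1}[x]$ denote the polynomials of degree at most $n-1$. For $q \in \mathbb{C}[x]$, $q^*$ is the polynomial with conjugated coefficients and $N(q) = q q^*$, so that $N(q)(x) = |q(x)|^2$ for real $x$. A matrix is called positive if it is positive semidefinite. $f$ is $n$-monotone if $f(A) \le f(B)$ for all Hermitian $n \times n$ matrices $A \le B$ with spectra in $(a,b)$. The divided difference $[x_0,\dots,x_m]_f$ is the symmetric function of its nodes given for $x_0 \le \dots \le x_m$ by $[x_0]_f = f(x_0)$, by $[x_0,\dots,x_m]_f = \frac{[x_0,\dots,x_{m-1}]_f - [x_1,\dots,x_m]_f}{x_0 - x_m}$ if $x_0 \ne x_m$, and by $f^{(m)}(x_0)/m!$ if $x_0 = \dots = x_m$. Each derivative $f^{(k)}$ is regarded as a function on the set of points where it exists, and $f^{(k+1)}(t)$ is the limit of the difference quotients $\frac{f^{(k)}(s)-f^{(k)}(t)}{s-t}$ as $s \to t$ within that set ($t$ being a point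 and an accumulation point of it). Theorem. The following are equivalent: 1. $f$ is $n$-monotone. 2. For all $a < x_0 < x_1 < \dots < x_{2n-1} < b$ and $q \in \mathbb{R}_{n-1}[x]$, $[x_0, x_1, \dots, x_{2n-1}]_{f q^2} \ge 0$. 3. For all $a < x_0 < x_1 < \dots < x_{2n-1} < b$ and $q \in \mathbb{C}_{n-1}[x]$, $[x_0, x_1, \dots, x_{2n-1}]_{f N(q)} \ge 0$. 4. $f \in C^1(a,b)$ and for all $a < x_1 < \dots < x_n < b$ and $q \in \mathbb{C}_{n-1}[x]$, $[x_1, x_1, x_2, x_2, \dots, x_n, x_n]_{f N(q)} \ge 0$. 5. $f \in C^1(a,b)$ and for all $a < x_1 < \dots < x_n < b$ the Loewner matrix $([x_i, x_j]_f)_{1 \le i,j \le n}$ is positive. 6. $f \in C^1(a,b)$ and for all $a < x_1 < \dots < x_n < b$ the extended Loewner matrix $([x_1, \dots, x_i, x_1, \dots, x_j]_f)_{1 \le i,j \le n}$ is positive. 7. $f \in C^{2n-3}(a,b)$, $f^{(2n-3)}$ is convex, and for every $q \in \mathbb{C}_{n-1}[x]$ the derivative $(f N(q))^{(2n-1)}$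 exists and is non-negative almost everywhere on $(a,b)$. 8. $f \in C^{2n-3}(a,b)$, $f^{(2n-3)}$ is convex, and the matrix $\left(\frac{f^{(i+j-1)}(t)}{(i+j-1)!}\right)_{1 \le i,j \le n}$ exists and is positive for almost every $t \in (a,b)$. -/

import Mathlib

noncomputable section

open scoped ComplexOrder

/-- The open interval `(a, b) ⊆ ℝ`, with possibly infinite end points. -/
def openInterval (a b : EReal) : Set ℝ :=
  {x : ℝ | a < (x : EReal) ∧ (x : EReal) < b}

/-- `f` is `n`-monotone on `F`: for `n × n` Hermitian matrices `A ≤ B` (Loewner order) with spectra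
in `F` one has `f(A) ≤ f(B)`. Here `hA.cfc f` is `f(A) = U diag(f(λ₁), …, f(λₙ)) U*` for a
diagonalization `A = U diag(λ₁, …, λₙ) U*` with `U` unitary. -/
def MatrixMonotoneOn (n : ℕ) (f : ℝ → ℝ) (F : Set ℝ) : Prop :=
  ∀ (A B : Matrix (Fin n) (Fin n) ℂ) (hA : A.IsHermitian) (hB : B.IsHermitian),
    spectrum ℝ A ⊆ F → spectrum ℝ B ⊆ F →
      (B - A).PosSemidef → (hB.cfc f - hA.cfc f).PosSemidef

/-- Divided difference at a nondecreasing list of nodes `x₀ ≤ … ≤ xₘ`: it is `f(x₀)` for one node,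
`f⁽ᵐ⁾(x₀)/m!` if all nodes coincide (that is, if `x₀ = xₘ`), and otherwise
`([x₀,…,xₘ₋₁] - [x₁,…,xₘ]) / (x₀ - xₘ)`. -/
def sortedDividedDiff (f : ℝ → ℝ) : List ℝ → ℝ
  | [] => 0
  | [x] => f x
  | x :: y :: l =>
    if x = (y :: l).getLast (List.cons_ne_nil y l) then
      iteratedDeriv (l.length + 1) f x / ((l.length + 1).factorial : ℝ)
    else
      (sortedDividedDiff f (x :: (y :: l).dropLast) - sortedDividedDiff f (y :: l)) /
        (x - (y :: l).getLast (List.cons_ne_nil y l))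
termination_by l => l.length
decreasing_by all_goals simp

/-- The divided difference `[x₀, …, xₘ]_f`, a symmetric function of its nodes, where repeated nodes
are allowed (a node that occurs `k + 1` times uses the derivatives of `f` there up to order `k`). -/
def dividedDiff (f : ℝ → ℝ) (l : List ℝ) : ℝ :=
  sortedDividedDiff f (l.insertionSort (· ≤ ·))

/-- `N(q) = q q*`, where `q*` has the conjugated coefficients. -/
def normPoly (q : Polynomial ℂ) : Polynomial ℂ :=
  q * q.map (starRingEnd ℂ)

/-- The real function `f N(q)` of a real variable (`N(q)` has real values on `ℝ`). -/
def mulNormPoly (f : ℝ → ℝ) (q : Polynomial ℂ) : ℝ → ℝ :=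
  fun x => f x * ((normPoly q).eval (x : ℂ)).re

/-- Successive derivatives of a function on `F` as partially defined functions (domain, values).
The `(k+1)`-st derivative exists at `t` if the `k`-th derivative exists at `t` and at points
arbitrarily close to `t`, and, as a function on its own domain, is differentiable at `t`. -/
def successiveDeriv (f : ℝ → ℝ) (F : Set ℝ) : ℕ → Set ℝ × (ℝ → ℝ)
  | 0 => (F, f)
  | k + 1 =>
    let D := (successiveDeriv f F k).1
    let g := (successiveDeriv f F k).2
    ({t ∈ D | AccPt t (Filter.principal D) ∧ DifferentiableWithinAt ℝ g D t}, derivWithin g D)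

/-- The set of points at which the `k`-th derivative of `f : F → ℝ` exists. -/
def derivDomain (f : ℝ → ℝ) (F : Set ℝ) (k : ℕ) : Set ℝ :=
  (successiveDeriv f F k).1

/-- The `k`-th derivative of `f : F → ℝ`, meaningful on `derivDomain f F k`. -/
def nthDeriv (f : ℝ → ℝ) (F : Set ℝ) (k : ℕ) : ℝ → ℝ :=
  (successiveDeriv f F k).2

/-- The Loewner matrix `([x_i, x_j]_f)`. -/
def loewnerMatrix {n : ℕ} (f : ℝ → ℝ) (x : Fin n → ℝ) : Matrix (Fin n) (Fin n) ℝ :=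
  Matrix.of fun i j => dividedDiff f [x i, x j]

/-- The extended Loewner matrix `([x_1, …, x_i, x_1, …, x_j]_f)`. -/
def extendedLoewnerMatrix {n : ℕ} (f : ℝ → ℝ) (x : Fin n → ℝ) : Matrix (Fin n) (Fin n) ℝ :=
  Matrix.of fun i j => dividedDiff f
    ((List.ofFn x).take (i.val + 1) ++ (List.ofFn x).take (j.val + 1))

/-- The Dobsch matrix `(f⁽ⁱ⁺ʲ⁻¹⁾(t)/(i+j-1)!)` for `1 ≤ i, j ≤ n`; the indices of `Fin n` start at
`0`, so that `i + j - 1` becomes `i + j + 1`. -/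
def dobschMatrix (n : ℕ) (f : ℝ → ℝ) (F : Set ℝ) (t : ℝ) : Matrix (Fin n) (Fin n) ℝ :=
  Matrix.of fun i j =>
    nthDeriv f F (i.val + j.val + 1) t / ((i.val + j.val + 1).factorial : ℝ)

end

/-! All conditions are compared with one statement: for every real polynomial `q` of degree at most
`n - 1`, the function `f q²` has non-negative divided differences of order `2n - 1` at distinct
points (`Tone (2 * n - 1)`). Complex `q` add nothing, since `|q|²` is a sum of two real squares on
the real line.

Matrices. Let `μ` be the eigenvalues of `B = diag(d) + v v*`, where the `d i` are distinct and no `v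
i` vanishes. Then `w* (f(B) - f(diag(d))) w` equals the divided difference of `f N(q)` at the `2n`
nodes `d, μ`, with `q = w* adj(X - diag(d)) v` of degree at most `n - 1` (`RankOneData.ddSum_eq`).
This settles generic rank one steps. Perturbation, unitary conjugation and a decomposition of `B -
A` into rank one terms give all `A ≤ B` (`matrixMonotoneOn_of_tone`). Conversely, every interlacing
pair of node systems arises as `d, μ`, and every `q` arises from a suitable `w`
(`MatrixMonotoneOn.ddSum_nonneg`); increasing nodes always interlace when split into even and odd
ones.

Double nodes. Letting simple nodes merge in pairs gives one direction. For the other, the roots of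
`(1 - s) ∏ (X - a i) + s ∏ (X - b i)` move from `a` to `b`, and there is a function of `s` whose
slope between `s` and `t` is the divided difference at the two root systems. Its derivative is a
divided difference at double nodes, so it is increasing, and its total increment is the divided
difference at `a, b` (`Interlacing.ddSum_nonneg`). The two Loewner matrices represent the quadratic
form `q ↦ [x₁, x₁, …, xₙ, xₙ]_{f q²}` in a Lagrange and in a Newton basis
(`posSemidef_dividedDiff_iff`).

Derivatives. Non-negative divided differences of order `k + 2` force `C^k` with a convex `k`-th
derivative, and conversely (`Tone.contDiffOn_and_convexOn`, `tone_of_hasDerivAt_of_convexOn`). In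
powers of `X - t` the form `q ↦ (f q²)^(2n-1)(t)` is a multiple of the one of the Dobsch matrix. To
return from almost everywhere to everywhere, a negative singular part must be excluded: the
derivative of order `2n - 2` of `f q²` is `q²` times an increasing function plus a locally Lipschitz
one, so it falls at most linearly and its almost everywhere derivative decides monotonicity
(`JetOn.monotoneOn_jetMul`). -/

section

/-! ### Divided differences at distinct nodes. -/

/-- The divided difference of `f` at the pairwise distinct nodes `v i`, `i ∈ s`. -/
noncomputable def ddSum {ι : Type*} [DecidableEq ι] (f : ℝ → ℝ) (s : Finset ι) (v : ι → ℝ) : ℝ :=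
  ∑ i ∈ s, f (v i) / ∏ j ∈ s.erase i, (v i - v j)

section ddSum

variable {ι κ : Type*} [DecidableEq ι] [DecidableEq κ]

theorem ddSum_congr {f g : ℝ → ℝ} {s : Finset ι} {v : ι → ℝ} (h : ∀ i ∈ s, f (v i) = g (v i)) :
    ddSum f s v = ddSum g s v :=
  Finset.sum_congr rfl fun i hi => by rw [h i hi]

theorem ddSum_add (f g : ℝ → ℝ) (s : Finset ι) (v : ι → ℝ) :
    ddSum (fun t => f t + g t) s v = ddSum f s v + ddSum g s v := by
  simp [ddSum, add_div, Finset.sum_add_distrib]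

theorem ddSum_const_mul (c : ℝ) (f : ℝ → ℝ) (s : Finset ι) (v : ι → ℝ) :
    ddSum (fun t => c * f t) s v = c * ddSum f s v := by
  simp [ddSum, mul_div_assoc, Finset.mul_sum]

theorem ddSum_neg (f : ℝ → ℝ) (s : Finset ι) (v : ι → ℝ) :
    ddSum (fun t => -f t) s v = -ddSum f s v := by
  simp [ddSum, neg_div]

theorem ddSum_sub (f g : ℝ → ℝ) (s : Finset ι) (v : ι → ℝ) :
    ddSum (fun t => f t - g t) s v = ddSum f s v - ddSum g s v := by
  simp [ddSum, sub_div, Finset.sum_sub_distrib]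

theorem ddSum_finset_sum {J : Type*} (t : Finset J) (f : J → ℝ → ℝ) (s : Finset ι) (v : ι → ℝ) :
    ddSum (fun x => ∑ k ∈ t, f k x) s v = ∑ k ∈ t, ddSum (f k) s v := by
  simp only [ddSum, Finset.sum_div]
  exact Finset.sum_comm

theorem ddSum_image (f : ℝ → ℝ) (s : Finset κ) (e : κ → ι) (v : ι → ℝ) (he : Set.InjOn e s) :
    ddSum f (s.image e) v = ddSum f s (v ∘ e) := by
  unfold ddSum
  rw [Finset.sum_image he]
  refine Finset.sum_congr rfl fun i hi => ?_
  have h : (s.image e).erase (e i) = (s.erase i).image e := by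
    ext y
    simp only [Finset.mem_erase, Finset.mem_image]
    constructor
    · rintro ⟨hy, j, hj, rfl⟩
      exact ⟨j, ⟨fun h => hy (by rw [h]), hj⟩, rfl⟩
    · rintro ⟨j, ⟨hji, hj⟩, rfl⟩
      exact ⟨fun h => hji (he hj hi h), j, hj, rfl⟩
  rw [h, Finset.prod_image (he.mono (by simp))]
  rfl

theorem ddSum_eq_id (f : ℝ → ℝ) (s : Finset ι) (v : ι → ℝ) (hv : Set.InjOn v s) :
    ddSum f (s.image v) id = ddSum f s v :=
  ddSum_image f s v id hv

theorem ddSum_singleton (f : ℝ → ℝ) (i : ι) (v : ι → ℝ) : ddSum f {i} v = f (v i) := by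
  simp [ddSum]

/-- The factor `t - v i` kills the term of the node `v i` and cancels one factor in each other
denominator. The recursion and the slope formula below both follow from this. -/
theorem ddSum_insert_sub_mul (f : ℝ → ℝ) {s : Finset ι} {v : ι → ℝ} {i : ι}
    (hv : ∀ j ∈ s, v j ≠ v i) :
    ddSum (fun t => (t - v i) * f t) (insert i s) v = ddSum f s v := by
  have hi : i ∉ s := fun h => hv i h rfl
  unfold ddSum
  rw [Finset.sum_insert hi]
  simp only [sub_self, zero_mul, zero_div, zero_add]
  refine Finset.sum_congr rfl fun j hj => ?_
  have hij : i ≠ j := fun h => hi (h ▸ hj)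
  have h0 := sub_ne_zero.2 (hv j hj)
  rw [Finset.erase_insert_of_ne hij, Finset.prod_insert (by simp [hi]), mul_div_mul_left _ _ h0]

/-- Subtract the cancellation of `v j` from that of `v i`: `(t - v i) f - (t - v j) f = (v j - v i)
f`. -/
theorem ddSum_insert_insert (f : ℝ → ℝ) {s : Finset ι} {v : ι → ℝ} {i j : ι} (hij : v i ≠ v j)
    (hi : ∀ k ∈ s, v k ≠ v i) (hj : ∀ k ∈ s, v k ≠ v j) :
    (v j - v i) * ddSum f (insert i (insert j s)) v =
      ddSum f (insert j s) v - ddSum f (insert i s) v := by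
  have h1 := ddSum_insert_sub_mul f (s := insert j s) (v := v) (i := i)
    (by simpa using ⟨hij.symm, hi⟩)
  have h2 := ddSum_insert_sub_mul f (s := insert i s) (v := v) (i := j) (by simpa using ⟨hij, hj⟩)
  rw [Finset.insert_comm] at h2
  rw [← h1, ← h2, ← ddSum_sub, ← ddSum_const_mul]
  congr 1
  ext t
  ring

/-- Two nodes are singled out so that both differences in the recursion still have at least two
nodes, and the induction applies to them. -/
theorem ddSum_const_insert_insert (c : ℝ) (s : Finset ι) (v : ι → ℝ) :
    ∀ i j, v i ≠ v j → Set.InjOn v s → (∀ k ∈ s, v k ≠ v i) → (∀ k ∈ s, v k ≠ v j) →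
      ddSum (fun _ => c) (insert i (insert j s)) v = 0 := by
  induction s using Finset.induction_on with
  | empty =>
    intro i j hij _ hi hj
    have h := ddSum_insert_insert (fun _ => c) hij hi hj
    have h2 : ∀ i : ι, insert i (∅ : Finset ι) = {i} := fun i => rfl
    simp only [h2 j, h2 i, ddSum_singleton, sub_self, mul_eq_zero] at h
    exact h.resolve_left (sub_ne_zero.2 hij.symm)
  | insert k s hk ih =>
    intro i j hij hs hi hj
    have h := ddSum_insert_insert (fun _ => c) hij hi hj
    have hs' : Set.InjOn v s := hs.mono (by simp)
    have hks : ∀ l ∈ s, v l ≠ v k := fun l hl h =>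
      hk (hs (by simp [hl]) (by simp) h ▸ hl)
    rw [ih j k (hj k (by simp)).symm hs' (fun l hl => hj l (by simp [hl])) hks,
      ih i k (hi k (by simp)).symm hs' (fun l hl => hi l (by simp [hl])) hks, sub_self,
      mul_eq_zero] at h
    exact h.resolve_left (sub_ne_zero.2 hij.symm)

/-- Write `f = f(v i) + (t - v i) · slope`: the constant contributes nothing because there are at
least two nodes, and the factor removes the node `v i`. -/
theorem ddSum_insert_eq_ddSum_slope (f : ℝ → ℝ) {s : Finset ι} {v : ι → ℝ} {i : ι}
    (hs : s.Nonempty) (hv : Set.InjOn v s) (hi : ∀ j ∈ s, v j ≠ v i) :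
    ddSum f (insert i s) v = ddSum (slope f (v i)) s v := by
  rw [← ddSum_insert_sub_mul (slope f (v i)) hi]
  obtain ⟨j, hj⟩ := hs
  have h0 : ddSum (fun _ => f (v i)) (insert i s) v = 0 := by
    rw [← Finset.insert_erase hj]
    refine ddSum_const_insert_insert _ _ _ _ _ (hi j hj).symm (hv.mono (by simp))
      (fun k hk => hi k (Finset.mem_of_mem_erase hk)) fun k hk h => ?_
    exact Finset.ne_of_mem_erase hk (hv (Finset.mem_of_mem_erase hk) hj h)
  have h1 : (fun t => (t - v i) * slope f (v i) t) = fun t => f t - f (v i) := by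
    ext t
    simpa using sub_smul_slope f (v i) t
  rw [h1, ddSum_sub, h0, sub_zero]

theorem ddSum_affine (f : ℝ → ℝ) (s : Finset ι) (v : ι → ℝ) (c d : ℝ) (hd : d ≠ 0) :
    ddSum f s (fun i => c + d * v i) * d ^ (s.card - 1) = ddSum (fun t => f (c + d * t)) s v := by
  unfold ddSum
  rw [Finset.sum_mul]
  refine Finset.sum_congr rfl fun i hi => ?_
  have h : ∀ j, c + d * v i - (c + d * v j) = d * (v i - v j) := fun j => by ring
  simp only [h]
  rw [Finset.prod_mul_distrib, Finset.prod_const, Finset.card_erase_of_mem hi, div_mul_eq_mul_div,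
    mul_comm (d ^ _), mul_div_mul_right _ _ (pow_ne_zero _ hd)]

theorem tendsto_ddSum {α : Type*} {F : Filter α} {g : α → ℝ → ℝ} {f : ℝ → ℝ} {s : Finset ι}
    {v : ι → ℝ} (h : ∀ i ∈ s, Filter.Tendsto (fun a => g a (v i)) F (nhds (f (v i)))) :
    Filter.Tendsto (fun a => ddSum (g a) s v) F (nhds (ddSum f s v)) :=
  tendsto_finsetSum _ fun i hi => (h i hi).div_const _

end ddSum

/-- All divided differences of order `m` of `f` at distinct points of `I` are non-negative. -/
def Tone (m : ℕ) (f : ℝ → ℝ) (I : Set ℝ) : Prop :=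
  ∀ s : Finset ℝ, (∀ x ∈ s, x ∈ I) → s.card = m + 1 → 0 ≤ ddSum f s id

theorem Tone.ddSum_nonneg {ι : Type*} [DecidableEq ι] {m : ℕ} {f : ℝ → ℝ} {I : Set ℝ}
    (h : Tone m f I) {s : Finset ι} {v : ι → ℝ} (hv : Set.InjOn v s) (hI : ∀ i ∈ s, v i ∈ I)
    (hs : s.card = m + 1) : 0 ≤ ddSum f s v := by
  rw [← ddSum_eq_id f s v hv]
  refine h _ ?_ (by rw [Finset.card_image_of_injOn hv, hs])
  simpa using hI

theorem Tone.congr {m : ℕ} {f g : ℝ → ℝ} {I : Set ℝ} (h : Tone m f I) (hfg : ∀ x ∈ I, f x = g x) :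
    Tone m g I := fun s hs hc => by
  rw [← ddSum_congr (v := id) (f := f) fun i hi => hfg i (hs i hi)]
  exact h s hs hc

/-- Moving the nodes to the right decreases a divided difference by a controlled amount if the
divided differences of the next order are bounded below. -/
theorem ddSum_image_union_le {κ : Type*} [DecidableEq κ] {m : ℕ} {f : ℝ → ℝ} {A : Set ℝ} {M : ℝ}
    (hM : ∀ s : Finset ℝ, (∀ x ∈ s, x ∈ A) → s.card = m + 1 → -M ≤ ddSum f s id)
    (x y : κ → ℝ) (J : Finset κ) :
    ∀ U : Finset ℝ, Set.InjOn x J → Set.InjOn y J → (∀ i ∈ J, ∀ j ∈ J, x i ≠ y j) →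
      (∀ i ∈ J, x i ∉ U) → (∀ i ∈ J, y i ∉ U) → (∀ i ∈ J, x i ∈ A ∧ y i ∈ A ∧ x i < y i) →
      (∀ u ∈ U, u ∈ A) → J.card + U.card = m →
      ddSum f (J.image x ∪ U) id - M * ∑ i ∈ J, (y i - x i) ≤ ddSum f (J.image y ∪ U) id := by
  induction J using Finset.induction_on with
  | empty => intros; simp
  | insert k J hk ih =>
    intro U hx hy hxy hxU hyU hA hU hc
    have hsub : (J : Set κ) ⊆ (insert k J : Finset κ) := by simp
    have hxk : ∀ j ∈ J, x j ≠ x k := fun j hj h => hk (hx (by simp [hj]) (by simp) h ▸ hj)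
    have hyk : ∀ j ∈ J, y j ≠ y k := fun j hj h => hk (hy (by simp [hj]) (by simp) h ▸ hj)
    have h1 := ih (insert (y k) U) (hx.mono hsub) (hy.mono hsub)
      (fun i hi j hj => hxy i (by simp [hi]) j (by simp [hj]))
      (fun i hi => by simpa using ⟨hxy i (by simp [hi]) k (by simp), hxU i (by simp [hi])⟩)
      (fun i hi => by simpa using ⟨hyk i hi, hyU i (by simp [hi])⟩)
      (fun i hi => hA i (by simp [hi]))
      (by simpa using ⟨(hA k (by simp)).2.1, hU⟩)
      (by rw [Finset.card_insert_of_notMem (hyU k (by simp))]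
          rw [Finset.card_insert_of_notMem hk] at hc
          omega)
    have e1 : (insert k J).image y ∪ U = J.image y ∪ insert (y k) U := by
      ext; simp
    have e2 : (insert k J).image x ∪ U = insert (x k) (J.image x ∪ U) := by
      ext; simp
    have e3 : J.image x ∪ insert (y k) U = insert (y k) (J.image x ∪ U) := by
      ext; simp
    have hkA := hA k (by simp)
    have nx : x k ∉ J.image x ∪ U := by
      simpa using ⟨hxk, hxU k (by simp)⟩
    have ny : y k ∉ J.image x ∪ U := by
      simpa using ⟨fun i hi => hxy i (by simp [hi]) k (by simp), hyU k (by simp)⟩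
    have h2 := ddSum_insert_insert f (v := id) (s := J.image x ∪ U) (i := x k) (j := y k)
      hkA.2.2.ne (fun z hz h => nx ((show z = x k from h) ▸ hz))
      (fun z hz h => ny ((show z = y k from h) ▸ hz))
    have hdisj : Disjoint (J.image x) U := by
      rw [Finset.disjoint_left]
      simp only [Finset.mem_image]
      rintro _ ⟨i, hi, rfl⟩
      exact hxU i (by simp [hi])
    have h3 := hM (insert (x k) (insert (y k) (J.image x ∪ U)))
      (by
        simp only [Finset.mem_insert, Finset.mem_union, Finset.mem_image]
        rintro z (rfl | rfl | ⟨i, hi, rfl⟩ | hz)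
        exacts [hkA.1, hkA.2.1, (hA i (by simp [hi])).1, hU z hz])
      (by
        rw [Finset.card_insert_of_notMem
            (by simp only [Finset.mem_insert, not_or]; exact ⟨hkA.2.2.ne, nx⟩),
          Finset.card_insert_of_notMem ny, Finset.card_union_of_disjoint hdisj,
          Finset.card_image_of_injOn (hx.mono hsub)]
        rw [Finset.card_insert_of_notMem hk] at hc
        omega)
    rw [e3] at h1
    rw [e1, e2, Finset.sum_insert hk]
    simp only [id] at h2
    nlinarith [mul_le_mul_of_nonneg_left h3 (sub_nonneg.2 hkA.2.2.le)]

end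

/-! ### Regularity of functions with non-negative divided differences. -/

section

open Filter Topology Set

theorem ddSum_pair (f : ℝ → ℝ) {x y : ℝ} (h : x ≠ y) :
    ddSum f {x, y} id = (f x - f y) / (x - y) := by
  have h1 : ({x, y} : Finset ℝ).erase x = {y} := by simp [h]
  have h2 : ({x, y} : Finset ℝ).erase y = {x} := by
    rw [Finset.pair_comm]; simp [h.symm]
  unfold ddSum
  rw [Finset.sum_pair h, id, id, h1, h2, Finset.prod_singleton, Finset.prod_singleton, id, id,
    sub_div, ← neg_sub x y, div_neg]
  ring

theorem ddSum_triple (f : ℝ → ℝ) {x y z : ℝ} (hxy : x ≠ y) (hxz : x ≠ z) (hyz : y ≠ z) :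
    ddSum f {x, y, z} id = (slope f x y - slope f x z) / (y - z) := by
  rw [← ddSum_pair _ hyz]
  exact ddSum_insert_eq_ddSum_slope f (v := id) (i := x) (s := {y, z}) (by simp)
    Function.injective_id.injOn (by simp [hxy.symm, hxz.symm])

/-- Pair the two node sets in increasing order; each of the `m` nodes moves to the right by at most
`L`. -/
theorem ddSum_sub_le_of_lt {m : ℕ} {f : ℝ → ℝ} {A : Set ℝ} {M L : ℝ} (hM0 : 0 ≤ M)
    (hM : ∀ s : Finset ℝ, (∀ x ∈ s, x ∈ A) → s.card = m + 1 → -M ≤ ddSum f s id)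
    {s T : Finset ℝ} (hs : s.card = m) (hT : T.card = m) (hsA : ∀ x ∈ s, x ∈ A)
    (hTA : ∀ x ∈ T, x ∈ A) (hsT : ∀ x ∈ s, ∀ y ∈ T, x < y ∧ y - x ≤ L) :
    ddSum f s id - M * (m * L) ≤ ddSum f T id := by
  have hx : ∀ i, s.orderEmbOfFin hs i ∈ s := fun i => Finset.orderEmbOfFin_mem s hs i
  have hy : ∀ i, T.orderEmbOfFin hT i ∈ T := fun i => Finset.orderEmbOfFin_mem T hT i
  have h := ddSum_image_union_le hM (s.orderEmbOfFin hs) (T.orderEmbOfFin hT) Finset.univ ∅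
    (s.orderEmbOfFin hs).injective.injOn (T.orderEmbOfFin hT).injective.injOn
    (fun i _ j _ => (hsT _ (hx i) _ (hy j)).1.ne) (by simp) (by simp)
    (fun i _ => ⟨hsA _ (hx i), hTA _ (hy i), (hsT _ (hx i) _ (hy i)).1⟩) (by simp) (by simp)
  rw [Finset.image_orderEmbOfFin_univ, Finset.image_orderEmbOfFin_univ, Finset.union_empty,
    Finset.union_empty] at h
  have hsum : ∑ i : Fin m, (T.orderEmbOfFin hT i - s.orderEmbOfFin hs i) ≤ m * L := by
    refine (Finset.sum_le_sum fun i _ => (hsT _ (hx i) _ (hy i)).2).trans ?_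
    simp
  nlinarith [mul_le_mul_of_nonneg_left hsum hM0]

theorem exists_finset_Ioo {c d : ℝ} (h : c < d) (m : ℕ) :
    ∃ T : Finset ℝ, (∀ x ∈ T, x ∈ Ioo c d) ∧ T.card = m := by
  obtain ⟨T, hT, hc⟩ := (Ioo_infinite h).exists_subset_card_eq m
  exact ⟨T, fun x hx => hT hx, hc⟩

theorem IsOpen.exists_gt_mem {I : Set ℝ} (hI : IsOpen I) {x : ℝ} (hx : x ∈ I) : ∃ y ∈ I, x < y := by
  have h : ∀ᶠ y in 𝓝[>] x, y ∈ I := nhdsWithin_le_nhds (hI.mem_nhds hx)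
  obtain ⟨y, hy, hxy⟩ := (h.and self_mem_nhdsWithin).exists
  exact ⟨y, hy, hxy⟩

theorem IsOpen.exists_lt_mem {I : Set ℝ} (hI : IsOpen I) {x : ℝ} (hx : x ∈ I) : ∃ y ∈ I, y < x := by
  have h : ∀ᶠ y in 𝓝[<] x, y ∈ I := nhdsWithin_le_nhds (hI.mem_nhds hx)
  obtain ⟨y, hy, hxy⟩ := (h.and self_mem_nhdsWithin).exists
  exact ⟨y, hy, hxy⟩

variable {I : Set ℝ} {f : ℝ → ℝ}

/-- If the divided differences of order `m` are non-negative, those of lower order are locally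
bounded. -/
theorem Tone.exists_bound (hI : IsOpen I) (hc : I.OrdConnected) {m : ℕ} (hf : Tone m f I) (j : ℕ) :
    ∀ k, k + 1 + j = m → ∀ c ∈ I, ∀ d ∈ I,
      ∃ M, ∀ s : Finset ℝ, (∀ x ∈ s, x ∈ Icc c d) → s.card = k + 1 → |ddSum f s id| ≤ M := by
  induction j with
  | zero =>
    rintro k rfl c hcI d hdI
    obtain ⟨d', hd'I, hd'⟩ := hI.exists_gt_mem hdI
    obtain ⟨c', hc'I, hc'⟩ := hI.exists_lt_mem hcI
    -- Top case: the differences of order `k` increase with the nodes, so fixed node sets on either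
    -- side of `[c, d]` bound them from both sides.
    obtain ⟨T, hT, hTc⟩ := exists_finset_Ioo hd' (k + 1)
    obtain ⟨T', hT', hTc'⟩ := exists_finset_Ioo hc' (k + 1)
    have hTI : ∀ x ∈ T, x ∈ I := fun x hx => hc.out hdI hd'I ⟨(hT x hx).1.le, (hT x hx).2.le⟩
    have hTI' : ∀ x ∈ T', x ∈ I := fun x hx => hc.out hc'I hcI ⟨(hT' x hx).1.le, (hT' x hx).2.le⟩
    refine ⟨|ddSum f T id| + |ddSum f T' id|, fun s hs hsc => ?_⟩
    have hsI : ∀ x ∈ s, x ∈ I := fun x hx => hc.out hcI hdI (hs x hx)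
    have h0 : ∀ s : Finset ℝ, (∀ x ∈ s, x ∈ I) → s.card = k + 1 + 1 → -0 ≤ ddSum f s id :=
      fun s h1 h2 => by simpa using hf s h1 h2
    have h1 := ddSum_sub_le_of_lt le_rfl h0 hsc hTc hsI hTI (L := d' - c)
      fun x hx y hy => ⟨(hs x hx).2.trans_lt (hT y hy).1, by
        linarith [(hs x hx).1, (hT y hy).2]⟩
    have h2 := ddSum_sub_le_of_lt le_rfl h0 hTc' hsc hTI' hsI (L := d - c')
      fun x hx y hy => ⟨(hT' x hx).2.trans_le (hs y hy).1, by
        linarith [(hT' x hx).1, (hs y hy).2]⟩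
    simp only [zero_mul, sub_zero] at h1 h2
    rw [abs_le]
    constructor
    · linarith [neg_abs_le (ddSum f T' id), abs_nonneg (ddSum f T id)]
    · linarith [le_abs_self (ddSum f T id), abs_nonneg (ddSum f T' id)]
  | succ j ih =>
    intro k hk c hcI d hdI
    obtain ⟨d', hd'I, hd'⟩ := hI.exists_gt_mem hdI
    obtain ⟨T, hT, hTc⟩ := exists_finset_Ioo hd' (k + 1)
    obtain ⟨M, hM⟩ := ih (k + 1) (by omega) c hcI d' hd'I
    refine ⟨|ddSum f T id| + |M| * (((k + 1 : ℕ) : ℝ) * (d' - c)), fun s hs hsc => ?_⟩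
    have h1 : ∀ s : Finset ℝ, (∀ x ∈ s, x ∈ Icc c d') → s.card = k + 1 + 1 →
        -|M| ≤ ddSum f s id := fun s h1 h2 =>
      (neg_le_neg ((hM s h1 h2).trans (le_abs_self M))).trans (neg_abs_le _)
    -- The bound on the next order is two-sided here, so the estimate applies to `-f` as well and
    -- one comparison set suffices.
    have h2 : ∀ s : Finset ℝ, (∀ x ∈ s, x ∈ Icc c d') → s.card = k + 1 + 1 →
        -|M| ≤ ddSum (fun t => -f t) s id := fun s h1 h2 => by
      rw [ddSum_neg, neg_le_neg_iff]
      exact (le_abs_self _).trans ((hM s h1 h2).trans (le_abs_self M))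
    rcases s.eq_empty_or_nonempty with rfl | ⟨x0, hx0⟩
    · simp at hsc
    have hcd := (hs x0 hx0).1.trans (hs x0 hx0).2
    have hsA : ∀ x ∈ s, x ∈ Icc c d' := fun x hx => ⟨(hs x hx).1, (hs x hx).2.trans hd'.le⟩
    have hTA : ∀ x ∈ T, x ∈ Icc c d' := fun x hx => ⟨hcd.trans (hT x hx).1.le, (hT x hx).2.le⟩
    have hsT : ∀ x ∈ s, ∀ y ∈ T, x < y ∧ y - x ≤ d' - c := fun x hx y hy =>
      ⟨(hs x hx).2.trans_lt (hT y hy).1, by linarith [(hs x hx).1, (hT y hy).2]⟩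
    have h3 := ddSum_sub_le_of_lt (abs_nonneg M) h1 hsc hTc hsA hTA hsT
    have h4 := ddSum_sub_le_of_lt (abs_nonneg M) h2 hsc hTc hsA hTA hsT
    rw [ddSum_neg, ddSum_neg] at h4
    rw [abs_le]
    constructor
    · linarith [neg_abs_le (ddSum f T id)]
    · linarith [le_abs_self (ddSum f T id)]

/-- For `m ≥ 3` the differences of order 2 are locally bounded, so the slope from `x` is Lipschitz
on a punctured neighbourhood and extends continuously to `x`. -/
theorem Tone.differentiableAt (hI : IsOpen I) (hc : I.OrdConnected) {m : ℕ} (hm : 3 ≤ m)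
    (hf : Tone m f I) {x : ℝ} (hx : x ∈ I) : DifferentiableAt ℝ f x := by
  obtain ⟨d, hdI, hd⟩ := hI.exists_gt_mem hx
  obtain ⟨c, hcI, hcx⟩ := hI.exists_lt_mem hx
  obtain ⟨M, hM⟩ := hf.exists_bound hI hc (m - 3) 2 (by omega) c hcI d hdI
  have hlip : LipschitzOnWith (Real.toNNReal M) (slope f x) (Icc c d \ {x}) := by
    refine LipschitzOnWith.of_dist_le_mul fun y hy z hz => ?_
    rcases eq_or_ne y z with rfl | hyz
    · simp
    have hxy : x ≠ y := fun h => hy.2 h.symm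
    have hxz : x ≠ z := fun h => hz.2 h.symm
    have h1 := hM {x, y, z} (by
      simp only [Finset.mem_insert, Finset.mem_singleton]
      rintro _ (rfl | rfl | rfl)
      exacts [⟨hcx.le, hd.le⟩, hy.1, hz.1]) (Finset.card_eq_three.2 ⟨x, y, z, hxy, hxz, hyz, rfl⟩)
    rw [ddSum_triple f hxy hxz hyz, abs_div, div_le_iff₀ (abs_pos.2 (sub_ne_zero.2 hyz))] at h1
    rw [Real.dist_eq, Real.dist_eq]
    exact h1.trans (mul_le_mul_of_nonneg_right (Real.le_coe_toNNReal M) (abs_nonneg _))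
  obtain ⟨g, hg, hfg⟩ := hlip.extend_real
  have hg' : Tendsto g (𝓝[≠] x) (𝓝 (g x)) := hg.continuous.continuousAt.mono_left nhdsWithin_le_nhds
  have : HasDerivAt f (g x) x := by
    rw [hasDerivAt_iff_tendsto_slope]
    refine hg'.congr' ?_
    have h1 : ∀ᶠ y in 𝓝[≠] x, y ∈ Icc c d := nhdsWithin_le_nhds (Icc_mem_nhds hcx hd)
    filter_upwards [h1, self_mem_nhdsWithin] with y h1 h2
    exact (hfg ⟨h1, h2⟩).symm
  exact this.differentiableAt

theorem eventually_add_ne (s : Finset ℝ) :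
    ∀ᶠ h in 𝓝[>] (0 : ℝ), ∀ x ∈ s, ∀ y ∈ s, x ≠ y + h := by
  simp only [Finset.eventually_all]
  intro x _ y _
  rcases eq_or_ne x y with rfl | hxy
  · filter_upwards [self_mem_nhdsWithin] with h hh heq
    have hh : 0 < h := hh
    linarith
  · have : ∀ᶠ h in 𝓝 (0 : ℝ), x ≠ y + h := by
      have : Tendsto (fun h : ℝ => y + h) (𝓝 0) (𝓝 y) := by
        simpa using (continuous_const.add continuous_id).tendsto (0 : ℝ) (f := fun h : ℝ => y + h)
      filter_upwards [this.eventually_ne hxy.symm] with h hh using hh.symm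
    exact nhdsWithin_le_nhds this

/-- Shifting all nodes by `h > 0` increases a difference of order `m` of `f`; divide by `h` and let
`h → 0`. Only those `h` are used for which no shifted node meets an old one. -/
theorem Tone.deriv (hI : IsOpen I) (hc : I.OrdConnected) {m : ℕ} (hm : 2 ≤ m)
    (hf : Tone (m + 1) f I) : Tone m (deriv f) I := by
  intro s hs hsc
  have h0 : ∀ s : Finset ℝ, (∀ x ∈ s, x ∈ I) → s.card = m + 1 + 1 → -0 ≤ ddSum f s id :=
    fun s h1 h2 => by simpa using hf s h1 h2
  have hlim : Tendsto (fun h : ℝ => ddSum (fun t => h⁻¹ * (f (t + h) - f t)) s id) (𝓝[>] 0)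
      (𝓝 (ddSum (_root_.deriv f) s id)) := by
    refine tendsto_ddSum fun x hx => ?_
    have h1 := (hf.differentiableAt hI hc (by omega) (hs x hx)).hasDerivAt
    have h2 := hasDerivAt_iff_tendsto_slope_zero.1 h1
    exact h2.mono_left (nhdsWithin_mono _ fun h hh => ne_of_gt hh)
  refine ge_of_tendsto hlim ?_
  have hmem : ∀ᶠ h in 𝓝[>] (0 : ℝ), ∀ x ∈ s, x + h ∈ I := by
    simp only [Finset.eventually_all]
    intro x hx
    have h1 : Tendsto (fun h : ℝ => x + h) (𝓝 0) (𝓝 x) := by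
      simpa using (continuous_const.add continuous_id).tendsto (0 : ℝ) (f := fun h : ℝ => x + h)
    exact nhdsWithin_le_nhds (h1.eventually (hI.mem_nhds (hs x hx)))
  filter_upwards [hmem, eventually_add_ne s, self_mem_nhdsWithin] with h h1 h2 h3
  have h3 : 0 < h := h3
  have h4 := ddSum_image_union_le h0 id (fun x => x + h) s ∅ Function.injective_id.injOn
    (add_left_injective h).injOn (fun i hi j hj => h2 i hi j hj) (by simp) (by simp)
    (fun i hi => ⟨hs i hi, h1 i hi, by simp [h3]⟩) (by simp) (by simp [hsc])
  rw [zero_mul, sub_zero, Finset.union_empty, Finset.union_empty, Finset.image_id,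
    ddSum_eq_id _ _ _ (add_left_injective h).injOn] at h4
  have h5 := ddSum_affine f s id h 1 one_ne_zero
  simp only [one_mul, one_pow, mul_one, id, add_comm h] at h5
  rw [ddSum_const_mul, ddSum_sub]
  refine mul_nonneg (inv_nonneg.2 h3.le) (sub_nonneg.2 ?_)
  exact h4.trans h5.le

theorem Tone.convexOn (hc : I.OrdConnected) (hf : Tone 2 f I) : ConvexOn ℝ I f := by
  refine convexOn_of_slope_mono_adjacent hc.convex fun {x y z} hx hz hxy hyz => ?_
  have hy : y ∈ I := hc.out hx hz ⟨hxy.le, hyz.le⟩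
  have h := hf {y, z, x} (by
      simp only [Finset.mem_insert, Finset.mem_singleton]
      rintro _ (rfl | rfl | rfl) <;> assumption)
    (Finset.card_eq_three.2 ⟨y, z, x, hyz.ne, hxy.ne', (hxy.trans hyz).ne', rfl⟩)
  rw [ddSum_triple f hyz.ne hxy.ne' (hxy.trans hyz).ne', slope_comm f y x] at h
  replace h := sub_nonneg.1 ((le_div_iff₀ (sub_pos.2 (hxy.trans hyz))).1 h |>.trans_eq' (zero_mul _))
  simpa [slope_def_field] using h

theorem ConvexOn.tone (hf : ConvexOn ℝ I f) : Tone 2 f I := by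
  have key : ∀ x ∈ I, ∀ y ∈ I, ∀ z ∈ I, x ≠ y → x ≠ z → y < z → 0 ≤ ddSum f {x, y, z} id := by
    intro x hx y hy z hz hxy hxz hyz
    rw [ddSum_triple f hxy hxz hyz.ne]
    refine div_nonneg_of_nonpos (sub_nonpos.2 ?_) (sub_nonpos.2 hyz.le)
    exact hf.slope_mono hx ⟨hy, hxy.symm⟩ ⟨hz, hxz.symm⟩ hyz.le
  intro s hs hsc
  obtain ⟨x, y, z, hxy, hxz, hyz, rfl⟩ := Finset.card_eq_three.1 hsc
  have hx := hs x (by simp)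
  have hy := hs y (by simp)
  have hz := hs z (by simp)
  rcases hyz.lt_or_gt with h | h
  · exact key x hx y hy z hz hxy hxz h
  · rw [Finset.pair_comm]
    exact key x hx z hz y hy hxz hxy h

/-- Each differentiation lowers the order by one; at order 2 the condition is convexity, which also
supplies the continuity of the last derivative. -/
theorem Tone.contDiffOn_and_convexOn (hI : IsOpen I) (hc : I.OrdConnected) (k : ℕ) :
    ∀ f : ℝ → ℝ, Tone (k + 2) f I →
      ContDiffOn ℝ (k : WithTop ℕ∞) f I ∧ ConvexOn ℝ I (iteratedDeriv k f) := by
  induction k with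
  | zero =>
    intro f hf
    have h := Tone.convexOn hc hf
    refine ⟨?_, by simpa using h⟩
    simpa using h.continuousOn hI
  | succ k ih =>
    intro f hf
    obtain ⟨h1, h2⟩ := ih _ (Tone.deriv hI hc (by omega) hf)
    refine ⟨?_, by rwa [iteratedDeriv_succ']⟩
    have := (contDiffOn_succ_iff_deriv_of_isOpen (𝕜 := ℝ) (n := (k : WithTop ℕ∞)) (f := f) hI).2
      ⟨fun x hx => (hf.differentiableAt hI hc (by omega) hx).differentiableWithinAt, by simp, h1⟩
    exact_mod_cast this

/-- A primitive of a function with non-negative divided differences of order `m` has non-negative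
divided differences of order `m + 1`. -/
theorem Tone.of_deriv (hc : I.OrdConnected) {m : ℕ} {g g' : ℝ → ℝ}
    (hg : ∀ x ∈ I, HasDerivAt g (g' x) x) (hg' : ContinuousOn g' I) (h : Tone m g' I) :
    Tone (m + 1) g I := by
  intro s hs hsc
  obtain ⟨x0, hx0⟩ : s.Nonempty := Finset.card_pos.1 (by omega)
  have hsc' : (s.erase x0).card = m + 1 := by rw [Finset.card_erase_of_mem hx0, hsc]; rfl
  rw [← Finset.insert_erase hx0, ddSum_insert_eq_ddSum_slope (v := id) (i := x0) (s := s.erase x0) g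
    (Finset.card_pos.1 (by omega)) Function.injective_id.injOn
    (fun j hj => Finset.ne_of_mem_erase hj)]
  have hx0I := hs x0 hx0
  have hmem : ∀ x ∈ s.erase x0, ∀ t ∈ Icc (0 : ℝ) 1, x0 + t * (x - x0) ∈ I := by
    intro x hx t ht
    have := hc.convex hx0I (hs x (Finset.mem_of_mem_erase hx)) (sub_nonneg.2 ht.2) ht.1
      (by ring)
    simp only [smul_eq_mul] at this
    convert this using 1
    ring
  have hcont : ∀ x ∈ s.erase x0,
      ContinuousOn (fun t => g' (x0 + t * (x - x0))) (uIcc (0 : ℝ) 1) := by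
    intro x hx
    rw [uIcc_of_le zero_le_one]
    exact hg'.comp (by fun_prop) fun t ht => hmem x hx t ht
  -- The slope from `x0` averages `g'` over the segment from `x0` to `x`. So the difference of order
  -- `m + 1` of `g` averages differences of order `m` of `g'` at nodes contracted towards `x0`.
  have hint : ∀ x ∈ s.erase x0, slope g x0 x = ∫ t in (0 : ℝ)..1, g' (x0 + t * (x - x0)) := by
    intro x hx
    have hne : x - x0 ≠ 0 := sub_ne_zero.2 (Finset.ne_of_mem_erase hx)
    have h1 : ∀ t ∈ uIcc (0 : ℝ) 1, HasDerivAt (fun t => (x - x0)⁻¹ * g (x0 + t * (x - x0)))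
        (g' (x0 + t * (x - x0))) t := by
      intro t ht
      rw [uIcc_of_le zero_le_one] at ht
      have h2 : HasDerivAt (fun t => x0 + t * (x - x0)) (x - x0) t := by
        simpa using ((hasDerivAt_id t).mul_const (x - x0)).const_add x0
      have h3 := ((hg _ (hmem x hx t ht)).comp t h2).const_mul (x - x0)⁻¹
      rwa [mul_comm (g' _), inv_mul_cancel_left₀ hne] at h3
    rw [intervalIntegral.integral_eq_sub_of_hasDerivAt h1 (hcont x hx).intervalIntegrable,
      slope_def_field]
    simp only [one_mul, zero_mul, add_zero, add_sub_cancel]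
    field_simp
  have hsum : ddSum (slope g x0) (s.erase x0) id =
      ∫ t in (0 : ℝ)..1, ddSum (fun x => g' (x0 + t * (x - x0))) (s.erase x0) id := by
    unfold ddSum
    simp only [id]
    rw [intervalIntegral.integral_finsetSum fun x hx =>
      ((hcont x hx).div_const _).intervalIntegrable]
    refine Finset.sum_congr rfl fun x hx => ?_
    rw [intervalIntegral.integral_div, hint x hx]
  rw [id, hsum]
  refine intervalIntegral.integral_nonneg_of_ae_restrict zero_le_one ?_
  rw [Filter.EventuallyLE, MeasureTheory.ae_restrict_iff' measurableSet_Icc]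
  -- At `t = 0` the contracted nodes collapse to one point.
  have h0 : ∀ᵐ t : ℝ, t ≠ 0 := by simp [MeasureTheory.ae_iff]
  filter_upwards [h0] with t ht0 ht
  have ht' : 0 < t := lt_of_le_of_ne ht.1 ht0.symm
  have e := ddSum_affine g' (s.erase x0) id (x0 - t * x0) t ht0
  have e2 : ∀ x, x0 - t * x0 + t * x = x0 + t * (x - x0) := fun x => by ring
  simp only [id, e2] at e
  rw [Pi.zero_apply]
  refine le_of_le_of_eq ?_ e
  refine mul_nonneg (h.ddSum_nonneg ?_ (fun x hx => hmem x hx t ht) hsc') (by positivity)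
  intro x _ y _ hxy
  have hxy : x0 + t * (x - x0) = x0 + t * (y - x0) := hxy
  exact sub_left_injective (mul_left_cancel₀ ht0 (add_left_cancel hxy))

theorem tone_of_hasDerivAt_of_convexOn (hI : IsOpen I) (hc : I.OrdConnected) (k : ℕ) :
    ∀ u : ℕ → ℝ → ℝ, (∀ j < k, ∀ x ∈ I, HasDerivAt (u j) (u (j + 1) x) x) →
      ConvexOn ℝ I (u k) → Tone (k + 2) (u 0) I := by
  induction k with
  | zero => exact fun u _ h => h.tone
  | succ k ih =>
    intro u hu hconv
    have h1 := ih (fun j => u (j + 1)) (fun j hj x hx => hu (j + 1) (by omega) x hx) hconv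
    refine Tone.of_deriv hc (hu 0 (by omega)) ?_ h1
    rcases k with _ | k
    · exact hconv.continuousOn hI
    · exact fun x hx => (hu 1 (by omega) x hx).continuousAt.continuousWithinAt

end

/-! ### Repeated nodes: divided differences as limits. -/

section

open Filter Topology Set

/-- The divided difference `[x i, …, x (i + k)]_f` by the recursion used for sorted nodes. -/
noncomputable def ddSeq (f : ℝ → ℝ) (x : ℕ → ℝ) : ℕ → ℕ → ℝ
  | 0, i => f (x i)
  | k + 1, i =>
    if x i = x (i + (k + 1)) then iteratedDeriv (k + 1) f (x i) / ((k + 1).factorial : ℝ)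
    else (ddSeq f x k i - ddSeq f x k (i + 1)) / (x i - x (i + (k + 1)))

theorem sortedDividedDiff_cons (f : ℝ → ℝ) (a : ℝ) {l : List ℝ} (h : l ≠ []) :
    sortedDividedDiff f (a :: l) =
      if a = l.getLast h then iteratedDeriv l.length f a / (l.length.factorial : ℝ)
      else (sortedDividedDiff f (a :: l.dropLast) - sortedDividedDiff f l) / (a - l.getLast h) := by
  cases l with
  | nil => exact absurd rfl h
  | cons b l => rw [sortedDividedDiff]; rfl

theorem sortedDividedDiff_map_range' (f : ℝ → ℝ) (x : ℕ → ℝ) (k : ℕ) :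
    ∀ i, sortedDividedDiff f ((List.range' i (k + 1)).map x) = ddSeq f x k i := by
  induction k with
  | zero => intro i; simp [sortedDividedDiff, ddSeq]
  | succ k ih =>
    intro i
    have h1 : (List.range' i (k + 1 + 1)).map x = x i :: (List.range' (i + 1) (k + 1)).map x := by
      rw [List.range'_succ, List.map_cons]
    have h2 : ((List.range' (i + 1) (k + 1)).map x).dropLast = (List.range' (i + 1) k).map x := by
      rw [List.range'_concat]; simp
    have hne : (List.range' (i + 1) (k + 1)).map x ≠ [] := by simp
    have h3 : ((List.range' (i + 1) (k + 1)).map x).getLast hne = x (i + (k + 1)) := by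
      rw [List.getLast_map, List.getLast_range']
      congr 1
      omega
    have h4 : x i :: (List.range' (i + 1) k).map x = (List.range' i (k + 1)).map x := by
      rw [List.range'_succ, List.map_cons]
    rw [h1, sortedDividedDiff_cons f _ hne, h3, h2, h4, ih, ih, ddSeq]
    simp

theorem ddSeq_eq_ddSum (f : ℝ → ℝ) (x : ℕ → ℝ) (k : ℕ) :
    ∀ i, Set.InjOn x (Icc i (i + k)) → ddSeq f x k i = ddSum f (Finset.Icc i (i + k)) x := by
  induction k with
  | zero => intro i _; simp [ddSeq, ddSum_singleton]
  | succ k ih =>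
    intro i h
    have hne : x i ≠ x (i + (k + 1)) := fun he => by
      have := h (by simp) (by simp) he
      omega
    have e1 : insert (i + (k + 1)) (Finset.Icc (i + 1) (i + k)) =
        Finset.Icc (i + 1) (i + 1 + k) := by
      ext; simp; omega
    have e2 : insert i (Finset.Icc (i + 1) (i + k)) = Finset.Icc i (i + k) := by
      ext; simp; omega
    have e3 : insert i (insert (i + (k + 1)) (Finset.Icc (i + 1) (i + k))) =
        Finset.Icc i (i + (k + 1)) := by
      ext; simp; omega
    have h1 := ddSum_insert_insert f (v := x) (s := Finset.Icc (i + 1) (i + k)) hne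
      (fun l hl he => by
        rw [Finset.mem_Icc] at hl
        have := h ⟨by omega, by omega⟩ (by simp) he
        omega)
      (fun l hl he => by
        rw [Finset.mem_Icc] at hl
        have := h ⟨by omega, by omega⟩ (by simp) he
        omega)
    rw [e3, e1, e2] at h1
    rw [ddSeq, if_neg hne, ih i (h.mono (Icc_subset_Icc le_rfl (by omega))),
      ih (i + 1) (h.mono (Icc_subset_Icc (by omega) (by omega))),
      div_eq_iff (sub_ne_zero.2 hne)]
    linarith

/-- Nodes two places apart differ in the limit, so a confluent entry occurs only for adjacent nodes
and involves only `f'`. Both nodes move there, so the limit of the quotient is given by strict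
differentiability, which `C¹` provides. -/
theorem tendsto_ddSeq {α : Type*} {F : Filter α} {f : ℝ → ℝ} {x : ℕ → ℝ} {X : α → ℕ → ℝ} (k : ℕ) :
    ∀ i, (∀ p q, i ≤ p → p + 2 ≤ q → q ≤ i + k → x p < x q) →
      (∀ p, i ≤ p → p ≤ i + k → ContDiffAt ℝ 1 f (x p)) →
      (∀ p, i ≤ p → p ≤ i + k → Tendsto (fun a => X a p) F (𝓝 (x p))) →
      (∀ᶠ a in F, Set.InjOn (X a) (Icc i (i + k))) →
      Tendsto (fun a => ddSeq f (X a) k i) F (𝓝 (ddSeq f x k i)) := by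
  induction k with
  | zero =>
    intro i _ hf hX _
    exact (hf i le_rfl le_rfl).continuousAt.tendsto.comp (hX i le_rfl le_rfl)
  | succ k ih =>
    intro i hx hf hX hinj
    have h1 := ih i (fun p q h1 h2 h3 => hx p q h1 h2 (by omega))
      (fun p h1 h2 => hf p h1 (by omega)) (fun p h1 h2 => hX p h1 (by omega))
      (hinj.mono fun a ha => ha.mono (Icc_subset_Icc le_rfl (by omega)))
    have h2 := ih (i + 1) (fun p q h1 h2 h3 => hx p q (by omega) h2 (by omega))
      (fun p h1 h2 => hf p (by omega) (by omega)) (fun p h1 h2 => hX p (by omega) (by omega))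
      (hinj.mono fun a ha => ha.mono (Icc_subset_Icc (by omega) (by omega)))
    have hX1 := hX i le_rfl (by omega)
    have hX2 := hX (i + (k + 1)) (by omega) le_rfl
    have hXne : ∀ᶠ a in F, X a i ≠ X a (i + (k + 1)) := by
      filter_upwards [hinj] with a ha he
      have := ha (by simp) (by simp) he
      omega
    have hev : (fun a => (ddSeq f (X a) k i - ddSeq f (X a) k (i + 1)) /
        (X a i - X a (i + (k + 1)))) =ᶠ[F] fun a => ddSeq f (X a) (k + 1) i := by
      filter_upwards [hXne] with a ha
      rw [ddSeq, if_neg ha]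
    refine Tendsto.congr' hev ?_
    by_cases hne : x i = x (i + (k + 1))
    · obtain rfl : k = 0 := by
        by_contra hk
        exact (hx i (i + (k + 1)) le_rfl (by omega) le_rfl).ne hne
      rw [ddSeq, if_pos hne]
      have h3 := ((hf i le_rfl (by omega)).hasStrictDerivAt one_ne_zero).isLittleO
      have h4 : Tendsto (fun a => (X a i, X a (i + (0 + 1)))) F (𝓝 (x i, x i)) := by
        nth_rewrite 2 [hne]
        exact hX1.prodMk_nhds hX2
      have h5 := (h3.comp_tendsto h4).tendsto_div_nhds_zero
      have h6 := h5.add_const (deriv f (x i))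
      rw [zero_add (deriv f (x i))] at h6
      simp only [zero_add, iteratedDeriv_one, Nat.factorial_one, Nat.cast_one, div_one]
      refine h6.congr' ?_
      filter_upwards [hXne] with a ha
      have := sub_ne_zero.2 ha
      simp only [Function.comp, ddSeq]
      simp only [zero_add] at this ⊢
      simp
      field_simp
      ring
    · rw [ddSeq, if_neg hne]
      exact (h1.sub h2).div (hX1.sub hX2) (sub_ne_zero.2 hne)

theorem dividedDiff_congr_perm (f : ℝ → ℝ) {l l' : List ℝ} (h : l.Perm l') :
    dividedDiff f l = dividedDiff f l' := by
  unfold dividedDiff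
  congr 1
  exact List.Perm.eq_of_sortedLE List.sortedLE_insertionSort List.sortedLE_insertionSort
    ((List.perm_insertionSort _ l).trans (h.trans (List.perm_insertionSort _ l').symm))

section indexed

variable {ι : Type*} [Fintype ι]

/-- A sorting of the nodes: the divided difference at `l` is computed by `ddSeq`. -/
theorem exists_dividedDiff_eq_ddSeq [Nonempty ι] {l : List ℝ} {v : ι → ℝ}
    (hl : (l : Multiset ℝ) = Finset.univ.val.map v) :
    ∃ (k : ℕ) (σ : Fin (k + 1) ≃ ι), Monotone (v ∘ σ) ∧
      ∀ f, dividedDiff f l = ddSeq f (fun p => v (σ (Fin.ofNat (k + 1) p))) k 0 := by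
  obtain ⟨k, hk⟩ : ∃ k, Fintype.card ι = k + 1 := ⟨Fintype.card ι - 1, by
    have := Fintype.card_pos (α := ι); omega⟩
  let e : Fin (k + 1) ≃ ι := (Fintype.equivFinOfCardEq hk).symm
  let τ := Tuple.sort (v ∘ e)
  refine ⟨k, τ.trans e, Tuple.monotone_sort (v ∘ e), fun f => ?_⟩
  rw [← sortedDividedDiff_map_range']
  have h1 : (List.range' 0 (k + 1)).map (fun p => v ((τ.trans e) (Fin.ofNat (k + 1) p))) =
      List.ofFn (v ∘ τ.trans e) := by
    apply List.ext_getElem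
    · simp
    · intro i h1 h2
      simp only [List.getElem_map, List.getElem_range', List.getElem_ofFn, Function.comp]
      congr 2
      ext
      simp at h2 ⊢
      omega
  rw [h1]
  unfold dividedDiff
  congr 1
  refine List.Perm.eq_of_sortedLE List.sortedLE_insertionSort
    (Tuple.monotone_sort (v ∘ e)).sortedLE_ofFn ((List.perm_insertionSort _ l).trans ?_)
  rw [← Multiset.coe_eq_coe, hl, ← Fin.univ_val_map, ← Multiset.map_map]
  congr 1
  have h2 := Finset.map_univ_equiv (τ.trans e)
  exact (congrArg Finset.val h2).symm

theorem ddSum_comp_ofNat [DecidableEq ι] (f : ℝ → ℝ) {k : ℕ} (σ : Fin (k + 1) ≃ ι) (v : ι → ℝ) :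
    ddSum f (Finset.Icc 0 (0 + k)) (fun p => v (σ (Fin.ofNat (k + 1) p))) =
      ddSum f Finset.univ v := by
  have h1 : Finset.Icc 0 (0 + k) = Finset.univ.image (Fin.val : Fin (k + 1) → ℕ) := by
    ext p
    simp only [zero_add, Finset.mem_Icc, Finset.mem_image, Finset.mem_univ, true_and, zero_le]
    exact ⟨fun h => ⟨⟨p, by omega⟩, rfl⟩, fun ⟨q, hq⟩ => by omega⟩
  have h2 : (Finset.univ : Finset ι) = Finset.univ.image σ := by simp
  rw [h1, ddSum_image _ _ _ _ Fin.val_injective.injOn, h2, ddSum_image _ _ _ _ σ.injective.injOn]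
  congr 1
  ext i
  simp

theorem injOn_comp_ofNat {ι : Type*} {k : ℕ} (σ : Fin (k + 1) ≃ ι) {v : ι → ℝ}
    (hv : Function.Injective v) :
    Set.InjOn (fun p => v (σ (Fin.ofNat (k + 1) p))) (Icc 0 (0 + k)) := by
  intro p hp q hq h
  have h := congrArg Fin.val (σ.injective (hv h))
  have h1 := hp.2
  have h2 := hq.2
  simp only [Fin.ofNat] at h
  rwa [Nat.mod_eq_of_lt (by omega), Nat.mod_eq_of_lt (by omega)] at h

theorem dividedDiff_eq_ddSum [DecidableEq ι] (f : ℝ → ℝ) {l : List ℝ} {v : ι → ℝ}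
    (hl : (l : Multiset ℝ) = Finset.univ.val.map v) (hv : Function.Injective v) :
    dividedDiff f l = ddSum f Finset.univ v := by
  rcases isEmpty_or_nonempty ι with hι | hι
  · have : l = [] := by simpa using hl
    subst this
    simp [ddSum, dividedDiff, sortedDividedDiff]
  obtain ⟨k, σ, _, h⟩ := exists_dividedDiff_eq_ddSeq hl
  rw [h, ddSeq_eq_ddSum _ _ _ _ (injOn_comp_ofNat σ hv), ddSum_comp_ofNat]

/-- Divided differences of a continuously differentiable function depend continuously on the nodes
as long as the limit nodes are at most double. -/
theorem tendsto_ddSum_dividedDiff [DecidableEq ι] {α : Type*} {F : Filter α} {f : ℝ → ℝ}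
    {l : List ℝ} {v : ι → ℝ}
    {V : α → ι → ℝ} (hl : (l : Multiset ℝ) = Finset.univ.val.map v)
    (h2 : ∀ c, l.count c ≤ 2) (hf : ∀ c ∈ l, ContDiffAt ℝ 1 f c)
    (hV : ∀ i, Tendsto (fun a => V a i) F (𝓝 (v i))) (hinj : ∀ᶠ a in F, Function.Injective (V a)) :
    Tendsto (fun a => ddSum f Finset.univ (V a)) F (𝓝 (dividedDiff f l)) := by
  rcases isEmpty_or_nonempty ι with hι | hι
  · have : l = [] := by simpa using hl
    subst this
    simpa [ddSum, dividedDiff, sortedDividedDiff] using tendsto_const_nhds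
  obtain ⟨k, σ, hmono, h⟩ := exists_dividedDiff_eq_ddSeq hl
  rw [h]
  have hev : (fun a => ddSeq f (fun p => V a (σ (Fin.ofNat (k + 1) p))) k 0) =ᶠ[F]
      fun a => ddSum f Finset.univ (V a) := by
    filter_upwards [hinj] with a ha
    rw [ddSeq_eq_ddSum _ _ _ _ (injOn_comp_ofNat σ ha), ddSum_comp_ofNat]
  refine Tendsto.congr' hev (tendsto_ddSeq k 0 ?_ ?_ ?_ ?_)
  · intro p q _ hpq hq
    have hle : ∀ p q, p ≤ q → q ≤ k →
        v (σ (Fin.ofNat (k + 1) p)) ≤ v (σ (Fin.ofNat (k + 1) q)) := by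
      intro p q h1 h2
      apply hmono
      rw [Fin.le_def]
      simp only [Fin.ofNat]
      rwa [Nat.mod_eq_of_lt (by omega), Nat.mod_eq_of_lt (by omega)]
    have hinj : ∀ p q, p < q → q ≤ k →
        σ (Fin.ofNat (k + 1) p) ≠ σ (Fin.ofNat (k + 1) q) := by
      intro p q h1 h2 h3
      have h3 := congrArg Fin.val (σ.injective h3)
      simp only [Fin.ofNat] at h3
      rw [Nat.mod_eq_of_lt (by omega), Nat.mod_eq_of_lt (by omega)] at h3
      omega
    -- If nodes two places apart had the same limit, monotonicity would force the node between them
    -- to it too, giving multiplicity 3.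
    by_contra hlt
    have a1 := hle p (p + 1) (by omega) (by omega)
    have a2 := hle (p + 1) q (by omega) (by omega)
    set c := v (σ (Fin.ofNat (k + 1) p)) with hcdef
    have h3 : l.count c = (Finset.univ.filter fun i => c = v i).card := by
      rw [← Multiset.coe_count, hl, Multiset.count_map]
      rfl
    have h4 : 2 < l.count c := by
      rw [h3, Finset.two_lt_card]
      refine ⟨σ (Fin.ofNat (k + 1) p), by simp [hcdef], σ (Fin.ofNat (k + 1) (p + 1)), ?_,
        σ (Fin.ofNat (k + 1) q), ?_, hinj _ _ (by omega) (by omega), hinj _ _ (by omega) (by omega),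
        hinj _ _ (by omega) (by omega)⟩
      · rw [Finset.mem_filter]
        exact ⟨Finset.mem_univ _, by linarith⟩
      · rw [Finset.mem_filter]
        exact ⟨Finset.mem_univ _, by linarith⟩
    exact absurd (h2 c) (by omega)
  · intro p _ _
    refine hf _ ?_
    rw [← Multiset.mem_coe, hl]
    exact Multiset.mem_map_of_mem _ (Finset.mem_univ _)
  · intro p _ _
    exact hV _
  · exact hinj.mono fun a ha => injOn_comp_ofNat σ ha

/-- A generic perturbation of the nodes. -/
theorem exists_injective_tendsto (v : ι → ℝ) :
    ∃ V : ℝ → ι → ℝ, (∀ i, Tendsto (fun a => V a i) (𝓝[>] 0) (𝓝 (v i))) ∧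
      ∀ᶠ a in 𝓝[>] (0 : ℝ), Function.Injective (V a) := by
  let e := Fintype.equivFin ι
  refine ⟨fun a i => v i + a * ((e i : ℕ) : ℝ), fun i => ?_, ?_⟩
  · have : Tendsto (fun a : ℝ => v i + a * ((e i : ℕ) : ℝ)) (𝓝 0)
        (𝓝 (v i + 0 * ((e i : ℕ) : ℝ))) := by
      exact Continuous.tendsto (by fun_prop) 0
    rw [zero_mul, add_zero] at this
    exact this.mono_left nhdsWithin_le_nhds
  · have : ∀ i j, ∀ᶠ a in 𝓝[>] (0 : ℝ),
        v i + a * ((e i : ℕ) : ℝ) = v j + a * ((e j : ℕ) : ℝ) → i = j := by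
      intro i j
      rcases eq_or_ne (v i) (v j) with h | h
      · filter_upwards [self_mem_nhdsWithin] with a ha he
        have ha : 0 < a := ha
        rw [h, add_right_inj, mul_right_inj' ha.ne'] at he
        exact e.injective (Fin.ext (by exact_mod_cast he))
      · have h1 : Tendsto (fun a : ℝ => v i + a * ((e i : ℕ) : ℝ) - (v j + a * ((e j : ℕ) : ℝ)))
            (𝓝 0) (𝓝 (v i + 0 * ((e i : ℕ) : ℝ) - (v j + 0 * ((e j : ℕ) : ℝ)))) := by
          exact Continuous.tendsto (by fun_prop) 0
        have h2 : ∀ᶠ a in 𝓝 (0 : ℝ),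
            v i + a * ((e i : ℕ) : ℝ) - (v j + a * ((e j : ℕ) : ℝ)) ≠ 0 :=
          h1.eventually_ne (by simpa [sub_eq_zero] using h)
        filter_upwards [nhdsWithin_le_nhds h2] with a ha he
        exact absurd (sub_eq_zero.2 he) ha
    filter_upwards [eventually_all.2 fun i => eventually_all.2 fun j => this i j] with a ha i j h
    exact ha i j h

end indexed

theorem coe_eq_map_get (l : List ℝ) :
    (l : Multiset ℝ) = Finset.univ.val.map fun i : Fin l.length => l.get i := by
  rw [Fin.univ_val_map, List.ofFn_get]

/-- Linearity is evident at distinct nodes and passes to the limit along a generic perturbation. -/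
theorem dividedDiff_finset_sum {J : Type*} (t : Finset J) (c : J → ℝ) (g : J → ℝ → ℝ) {l : List ℝ}
    (h2 : ∀ c, l.count c ≤ 2) (hg : ∀ k ∈ t, ∀ c ∈ l, ContDiffAt ℝ 1 (g k) c) :
    dividedDiff (fun x => ∑ k ∈ t, c k * g k x) l = ∑ k ∈ t, c k * dividedDiff (g k) l := by
  obtain ⟨V, hV, hinj⟩ := exists_injective_tendsto fun i : Fin l.length => l.get i
  have h1 := tendsto_ddSum_dividedDiff (f := fun x => ∑ k ∈ t, c k * g k x) (coe_eq_map_get l) h2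
    (fun x hx => ContDiffAt.sum fun k hk => contDiffAt_const.mul (hg k hk x hx)) hV hinj
  have h3 : Tendsto (fun a => ∑ k ∈ t, c k * ddSum (g k) Finset.univ (V a)) (𝓝[>] 0)
      (𝓝 (∑ k ∈ t, c k * dividedDiff (g k) l)) :=
    tendsto_finsetSum _ fun k hk =>
      (tendsto_ddSum_dividedDiff (coe_eq_map_get l) h2 (hg k hk) hV hinj).const_mul _
  refine tendsto_nhds_unique h1 (h3.congr fun a => ?_)
  rw [ddSum_finset_sum]
  simp only [ddSum_const_mul]

/-- At perturbed nodes, with `c'` the one near `c`, write `t - c = (t - c') + (c' - c)`: the first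
part cancels the node `c'` and the second contributes a term tending to zero. -/
theorem dividedDiff_sub_mul {f : ℝ → ℝ} {c : ℝ} {l : List ℝ} (h2 : ∀ t, (c :: l).count t ≤ 2)
    (hf : ∀ t ∈ c :: l, ContDiffAt ℝ 1 f t) :
    dividedDiff (fun t => (t - c) * f t) (c :: l) = dividedDiff f l := by
  let v : Option (Fin l.length) → ℝ := fun o => o.elim c fun i => l.get i
  have hl : ((c :: l : List ℝ) : Multiset ℝ) = Finset.univ.val.map v := by
    rw [← Multiset.cons_coe, coe_eq_map_get l]
    change _ = (c ::ₘ (Finset.univ.val.map some).map v)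
    rw [Multiset.map_map]
    rfl
  obtain ⟨V, hV, hinj⟩ := exists_injective_tendsto v
  have h1 := tendsto_ddSum_dividedDiff (f := fun t => (t - c) * f t) hl h2
    (fun x hx => (contDiffAt_id.sub contDiffAt_const).mul (hf x hx)) hV hinj
  have h3 := tendsto_ddSum_dividedDiff (f := f) hl h2 hf hV hinj
  have h4 := tendsto_ddSum_dividedDiff (f := f) (V := fun a i => V a (some i)) (coe_eq_map_get l)
    (fun t => (List.count_le_count_cons).trans (h2 t)) (fun t ht => hf t (by simp [ht]))
    (fun i => hV (some i)) (hinj.mono fun a ha => ha.comp (Option.some_injective _))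
  have h5 : Tendsto (fun a => ddSum f Finset.univ (fun i => V a (some i)) +
      (V a none - c) * ddSum f Finset.univ (V a)) (𝓝[>] 0) (𝓝 (dividedDiff f l + (c - c) *
        dividedDiff f (c :: l))) :=
    h4.add (((hV none).sub_const c).mul h3)
  rw [sub_self, zero_mul, add_zero] at h5
  refine tendsto_nhds_unique h1 (h5.congr' ?_)
  filter_upwards [hinj] with a ha
  have e1 : (Finset.univ : Finset (Option (Fin l.length))) =
      insert none (Finset.univ.image some) := by
    ext o; cases o <;> simp
  have e2 := ddSum_insert_sub_mul f (s := Finset.univ.image (some : Fin l.length → _)) (v := V a)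
    (i := none) (by simpa using fun i h => by simpa using ha h)
  rw [← e1, ddSum_image _ _ _ _ (Option.some_injective _).injOn] at e2
  change ddSum f Finset.univ (V a ∘ some) + _ = _
  rw [← e2, ← ddSum_const_mul, ← ddSum_add]
  congr 1
  ext t
  ring

theorem dividedDiff_prod_mul {f : ℝ → ℝ} {l : List ℝ} (m : List ℝ) :
    (∀ t, (m ++ l).count t ≤ 2) → (∀ t ∈ m ++ l, ContDiffAt ℝ 1 f t) →
    dividedDiff (fun t => (m.map fun c => t - c).prod * f t) (m ++ l) = dividedDiff f l := by
  induction m with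
  | nil => intro _ _; simp
  | cons c m ih =>
    intro h2 hf
    have h2' : ∀ t, (m ++ l).count t ≤ 2 := fun t => List.count_le_count_cons.trans (h2 t)
    have hf' : ∀ t ∈ m ++ l, ContDiffAt ℝ 1 f t := fun t ht => hf t (by
      rw [List.cons_append]; exact List.mem_cons_of_mem _ ht)
    rw [← ih h2' hf']
    have hp : ∀ t, ContDiffAt ℝ 1 (fun t => (m.map fun c => t - c).prod) t := fun t => by
      clear ih h2 hf h2' hf'
      induction m with
      | nil => simpa using contDiffAt_const
      | cons c m ih => simpa using (contDiffAt_id.sub contDiffAt_const).mul ih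
    rw [← dividedDiff_sub_mul (c := c) (l := m ++ l) h2 fun t ht => (hp t).mul (hf t ht)]
    simp [mul_assoc]

end

/-! ### Real and complex polynomials; Loewner matrices as quadratic forms. -/

section

open Filter Topology Set Polynomial

theorem isOpen_openInterval (a b : EReal) : IsOpen (openInterval a b) :=
  (isOpen_Ioo (a := a) (b := b)).preimage continuous_coe_real_ereal

theorem ordConnected_openInterval (a b : EReal) : (openInterval a b).OrdConnected :=
  ⟨fun _ hx _ hy _ hz => ⟨hx.1.trans_le (EReal.coe_le_coe_iff.2 hz.1),
    (EReal.coe_le_coe_iff.2 hz.2).trans_lt hy.2⟩⟩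

section complexToReal

theorem normPoly_eval_re (q : ℂ[X]) (x : ℝ) :
    ((normPoly q).eval (x : ℂ)).re = Complex.normSq (q.eval (x : ℂ)) := by
  have h : (q.map (starRingEnd ℂ)).eval (x : ℂ) = starRingEnd ℂ (q.eval (x : ℂ)) := by
    conv_lhs => rw [← Complex.conj_ofReal x]
    rw [eval_map_apply]
  rw [normPoly, eval_mul, h, Complex.mul_conj, Complex.ofReal_re]

/-- At real points `|q|² = (Re q)² + (Im q)²`, and the two parts are the real polynomials formed by
the real and imaginary parts of the coefficients. -/
theorem exists_normPoly_eq_sq_add_sq {d : ℕ} (q : ℂ[X]) (hq : q.natDegree ≤ d) :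
    ∃ q₁ q₂ : ℝ[X], q₁.natDegree ≤ d ∧ q₂.natDegree ≤ d ∧
      ∀ x : ℝ, ((normPoly q).eval (x : ℂ)).re = (q₁ ^ 2).eval x + (q₂ ^ 2).eval x := by
  have hdeg : ∀ c : ℕ → ℝ,
      (∑ k ∈ Finset.range (d + 1), C (c k) * X ^ k : ℝ[X]).natDegree ≤ d := fun c =>
    natDegree_sum_le_of_forall_le _ _ fun k hk =>
      (natDegree_C_mul_X_pow_le _ _).trans (Nat.lt_succ_iff.1 (Finset.mem_range.1 hk))
  refine ⟨∑ k ∈ Finset.range (d + 1), C (q.coeff k).re * X ^ k,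
    ∑ k ∈ Finset.range (d + 1), C (q.coeff k).im * X ^ k, hdeg _, hdeg _, fun x => ?_⟩
  rw [normPoly_eval_re, eval_eq_sum_range' (Nat.lt_succ_of_le hq), Complex.normSq_apply]
  simp only [Complex.re_sum, Complex.im_sum, eval_pow, eval_finsetSum, eval_mul, eval_C, eval_X,
    ← Complex.ofReal_pow, Complex.re_mul_ofReal, Complex.im_mul_ofReal]
  ring

theorem mulNormPoly_map_ofReal (f : ℝ → ℝ) (q : ℝ[X]) :
    mulNormPoly f (q.map Complex.ofRealHom) = fun t => f t * (q ^ 2).eval t := by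
  ext x
  have h : (q.map Complex.ofRealHom).eval (x : ℂ) = ((q.eval x : ℝ) : ℂ) :=
    eval_map_apply Complex.ofRealHom x
  rw [mulNormPoly, normPoly_eval_re, h, Complex.normSq_ofReal, eval_pow, sq]

theorem contDiff_eval (q : ℝ[X]) {k : WithTop ℕ∞} : ContDiff ℝ k fun t => q.eval t := by
  simpa using q.contDiff_aeval (𝕜 := ℝ) k

theorem contDiffAt_mul_eval {f : ℝ → ℝ} {x : ℝ} {k : WithTop ℕ∞} (hf : ContDiffAt ℝ k f x)
    (q : ℝ[X]) : ContDiffAt ℝ k (fun t => f t * q.eval t) x :=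
  hf.mul (contDiff_eval q).contDiffAt

theorem dividedDiff_add {f g : ℝ → ℝ} {l : List ℝ} (h2 : ∀ c, l.count c ≤ 2)
    (hf : ∀ c ∈ l, ContDiffAt ℝ 1 f c) (hg : ∀ c ∈ l, ContDiffAt ℝ 1 g c) :
    dividedDiff (fun t => f t + g t) l = dividedDiff f l + dividedDiff g l := by
  have h := dividedDiff_finset_sum (l := l) Finset.univ (fun _ => 1)
    (fun b : Bool => if b then f else g) h2 (by
      rintro (_ | _) _ c hc
      · simpa using hg c hc
      · simpa using hf c hc)
  simpa using h

/-- Non-negativity for all real polynomials and for all complex polynomials is the same. -/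
theorem forall_dividedDiff_mulNormPoly_nonneg_iff {f : ℝ → ℝ} {l : List ℝ} {d : ℕ}
    (hadd : ∀ p q : ℝ[X], dividedDiff (fun t => f t * p.eval t + f t * q.eval t) l =
      dividedDiff (fun t => f t * p.eval t) l + dividedDiff (fun t => f t * q.eval t) l) :
    (∀ q : ℂ[X], q.natDegree ≤ d → 0 ≤ dividedDiff (mulNormPoly f q) l) ↔
      ∀ q : ℝ[X], q.natDegree ≤ d → 0 ≤ dividedDiff (fun t => f t * (q ^ 2).eval t) l := by
  constructor
  · intro h q hq
    rw [← mulNormPoly_map_ofReal]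
    exact h _ (natDegree_map_le.trans hq)
  · intro h q hq
    obtain ⟨q₁, q₂, h1, h2, h3⟩ := exists_normPoly_eq_sq_add_sq q hq
    have h4 : mulNormPoly f q = fun t => f t * (q₁ ^ 2).eval t + f t * (q₂ ^ 2).eval t := by
      ext t
      rw [mulNormPoly, h3, mul_add]
    rw [h4, hadd]
    exact add_nonneg (h q₁ h1) (h q₂ h2)

end complexToReal

section loewner

theorem flatMap_pair_perm (l : List ℝ) : (l.flatMap fun t => [t, t]).Perm (l ++ l) := by
  induction l with
  | nil => simp
  | cons a l ih =>
    simp only [List.flatMap_cons, List.cons_append, List.nil_append]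
    exact (List.Perm.cons a ((List.Perm.cons a ih).trans List.perm_middle.symm))

theorem multiset_flatMap_pair {n : ℕ} (x : Fin n → ℝ) :
    (((List.ofFn x).flatMap fun t => [t, t] : List ℝ) : Multiset ℝ) =
      Finset.univ.val.map (Sum.elim x x) := by
  rw [Multiset.coe_eq_coe.2 (flatMap_pair_perm _), ← Multiset.coe_add, ← Fin.univ_val_map,
    ← Finset.univ_disjSum_univ, Finset.val_disjSum]
  change _ = Multiset.map _ (Multiset.map _ _ + Multiset.map _ _)
  rw [Multiset.map_add, Multiset.map_map, Multiset.map_map]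
  rfl

theorem count_flatMap_pair_le {l : List ℝ} (hl : l.Nodup) (c : ℝ) :
    (l.flatMap fun t => [t, t]).count c ≤ 2 := by
  rw [(flatMap_pair_perm l).count_eq, List.count_append]
  have := List.nodup_iff_count_le_one.1 hl c
  omega

theorem posSemidef_iff_sum_nonneg {n : ℕ} {M : Matrix (Fin n) (Fin n) ℝ}
    (hM : ∀ i j, M i j = M j i) :
    M.PosSemidef ↔ ∀ c : Fin n → ℝ, 0 ≤ ∑ i, ∑ j, c i * c j * M i j := by
  have h1 : M.IsHermitian := by ext i j; simp [hM i j]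
  have h2 : ∀ c : Fin n → ℝ, star c ⬝ᵥ M.mulVec c = ∑ i, ∑ j, c i * c j * M i j := by
    intro c
    simp only [dotProduct, Matrix.mulVec, Finset.mul_sum, star_trivial]
    exact Finset.sum_congr rfl fun i _ => Finset.sum_congr rfl fun j _ => by ring
  rw [Matrix.posSemidef_iff_dotProduct_mulVec]
  simp only [h1, true_and, h2]

theorem eval_list_prod_X_sub_C (l : List ℝ) (t : ℝ) :
    ((l.map fun c => X - C c).prod).eval t = (l.map fun c => t - c).prod := by
  rw [eval_list_prod, List.map_map]
  simp [Function.comp_def]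

/-- The matrix of the quadratic form `q ↦ [x₁, x₁, …, xₙ, xₙ]_{f q²}` in a basis of products of
linear factors with roots among the nodes. -/
theorem posSemidef_dividedDiff_iff {n : ℕ} {f : ℝ → ℝ} {x : Fin n → ℝ}
    (hx : Function.Injective x) (hf : ∀ i, ContDiffAt ℝ 1 f (x i)) (ms ls : Fin n → List ℝ)
    (hperm : ∀ i, (ms i ++ ls i).Perm (List.ofFn x)) (hls : ∀ i, ls i ≠ [])
    (hspan : ∀ q : ℝ[X], q.natDegree ≤ n - 1 →
      ∃ c : Fin n → ℝ, q = ∑ i, C (c i) * ((ms i).map fun c => X - C c).prod) :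
    (Matrix.of fun i j => dividedDiff f (ls i ++ ls j) : Matrix (Fin n) (Fin n) ℝ).PosSemidef ↔
      ∀ q : ℝ[X], q.natDegree ≤ n - 1 →
        0 ≤ dividedDiff (fun t => f t * (q ^ 2).eval t)
          ((List.ofFn x).flatMap fun t => [t, t]) := by
  set l := (List.ofFn x).flatMap fun t => [t, t] with hl
  have hcount : ∀ c, l.count c ≤ 2 := count_flatMap_pair_le (List.nodup_ofFn.2 hx)
  have hmem : ∀ c ∈ l, ContDiffAt ℝ 1 f c := by
    intro c hc
    simp only [hl, List.mem_flatMap, List.mem_ofFn] at hc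
    obtain ⟨_, ⟨i, rfl⟩, hc⟩ := hc
    simp only [List.mem_cons, List.not_mem_nil, or_false, or_self] at hc
    exact hc ▸ hf i
  -- The double nodes are two copies of all nodes; the linear factors over `ms i` and `ms j` cancel
  -- those nodes and leave `ls i ++ ls j`.
  have hlp : ∀ i j, l.Perm ((ms i ++ ms j) ++ (ls i ++ ls j)) := by
    intro i j
    refine (flatMap_pair_perm _).trans (((hperm i).symm.append (hperm j).symm).trans ?_)
    rw [List.append_assoc, List.append_assoc, ← List.append_assoc (ls i), ← List.append_assoc (ms j)]
    exact List.Perm.append_left _ (List.Perm.append_right _ List.perm_append_comm)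
  have key : ∀ c : Fin n → ℝ, dividedDiff (fun t => f t *
      ((∑ i, C (c i) * ((ms i).map fun c => X - C c).prod) ^ 2).eval t) l =
      ∑ i, ∑ j, c i * c j * dividedDiff f (ls i ++ ls j) := by
    intro c
    have e1 : (fun t => f t * ((∑ i, C (c i) * ((ms i).map fun c => X - C c).prod) ^ 2).eval t) =
        fun t => ∑ k : Fin n × Fin n, c k.1 * c k.2 *
          (((ms k.1 ++ ms k.2).map fun c => t - c).prod * f t) := by
      ext t
      rw [eval_pow, eval_finsetSum, sq, Finset.sum_mul_sum, Fintype.sum_prod_type, Finset.mul_sum]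
      refine Finset.sum_congr rfl fun i _ => ?_
      rw [Finset.mul_sum]
      refine Finset.sum_congr rfl fun j _ => ?_
      simp only [eval_mul, eval_C, eval_list_prod_X_sub_C, List.map_append, List.prod_append]
      ring
    have hp : ∀ (m : List ℝ) (t : ℝ), ContDiffAt ℝ 1 (fun t => (m.map fun c => t - c).prod) t := by
      intro m t
      simp only [← eval_list_prod_X_sub_C]
      exact (contDiff_eval _).contDiffAt
    rw [e1, dividedDiff_finset_sum _ _ _ hcount
      fun k _ t ht => (hp _ t).mul (hmem t ht), Fintype.sum_prod_type]
    refine Finset.sum_congr rfl fun i _ => Finset.sum_congr rfl fun j _ => ?_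
    rw [dividedDiff_congr_perm _ (hlp i j), dividedDiff_prod_mul]
    · exact fun t => by rw [← (hlp i j).count_eq]; exact hcount t
    · exact fun t ht => hmem t ((hlp i j).mem_iff.2 ht)
  rw [posSemidef_iff_sum_nonneg (M := Matrix.of fun i j => dividedDiff f (ls i ++ ls j))
    fun i j => dividedDiff_congr_perm _ List.perm_append_comm]
  simp only [Matrix.of_apply, ← key]
  constructor
  · intro h q hq
    obtain ⟨c, rfl⟩ := hspan q hq
    exact h c
  · intro h c
    refine h _ (natDegree_sum_le_of_forall_le _ _ fun i _ => (natDegree_C_mul_le _ _).trans ?_)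
    -- As `ls i` is non-empty, `ms i` has at most `n - 1` members, which bounds the degree.
    have h1 := natDegree_multiset_prod_X_sub_C_eq_card (ms i : Multiset ℝ)
    rw [Multiset.map_coe, Multiset.prod_coe, Multiset.coe_card] at h1
    have h2 := (hperm i).length_eq
    rw [List.length_append, List.length_ofFn] at h2
    have h3 := List.length_pos_iff.2 (hls i)
    omega

theorem exists_eq_sum_lagrange {n : ℕ} (hn : 0 < n) {x : Fin n → ℝ} (hx : Function.Injective x)
    (q : ℝ[X]) (hq : q.natDegree ≤ n - 1) :
    ∃ c : Fin n → ℝ, q = ∑ i, C (c i) * ∏ j ∈ Finset.univ.erase i, (X - C (x j)) := by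
  refine ⟨_, (Lagrange.eq_interpolate (s := Finset.univ) (v := x) hx.injOn ?_).trans
    (Lagrange.interpolate_eq_sum _)⟩
  rw [Finset.card_univ, Fintype.card_fin]
  exact degree_le_natDegree.trans_lt (by exact_mod_cast (by omega : q.natDegree < n))

/-- Newton basis started from the last node: divide by `X - a` and expand the quotient in the
remaining nodes. The remainder `q(a)` is the coefficient of the empty product. -/
theorem exists_eq_sum_newton (n : ℕ) : ∀ (x : Fin (n + 1) → ℝ) (q : ℝ[X]), q.natDegree ≤ n →
    ∃ c : Fin (n + 1) → ℝ,
      q = ∑ i, C (c i) * (((List.ofFn x).drop (i.val + 1)).map fun c => X - C c).prod := by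
  induction n with
  | zero =>
    intro x q hq
    exact ⟨fun _ => q.coeff 0, by simpa using eq_C_of_natDegree_le_zero hq⟩
  | succ n ih =>
    intro x q hq
    set a := x (Fin.last (n + 1)) with ha
    obtain ⟨c, hc⟩ := ih (fun i => x i.castSucc) (q /ₘ (X - C a)) (by
      rw [natDegree_divByMonic _ (monic_X_sub_C a), natDegree_X_sub_C]; omega)
    refine ⟨Fin.snoc c (q.eval a), ?_⟩
    rw [Fin.sum_univ_castSucc]
    simp only [Fin.snoc_castSucc, Fin.snoc_last, Fin.val_castSucc, Fin.val_last]
    have h1 : ∀ i : Fin (n + 1), (((List.ofFn x).drop (i.val + 1)).map fun c => X - C c).prod =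
        (((List.ofFn fun i => x i.castSucc).drop (i.val + 1)).map fun c => X - C c).prod *
          (X - C a) := by
      intro i
      rw [List.ofFn_succ_last, List.drop_append_of_le_length (by simp; omega)]
      simp [ha]
    have h2 : (List.ofFn x).drop (n + 1 + 1) = [] := by simp
    simp only [h1, h2, ← mul_assoc, ← Finset.sum_mul]
    rw [← hc]
    conv_lhs => rw [← modByMonic_add_div q (X - C a), modByMonic_X_sub_C_eq_C_eval]
    simp only [List.map_nil, List.prod_nil, mul_one]
    ring

/-- The Lagrange basis: the `i`-th product omits exactly the node `x i`, so the nodes `x i, x j`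
remain. -/
theorem loewnerMatrix_posSemidef_iff {n : ℕ} (hn : 0 < n) {f : ℝ → ℝ} {x : Fin n → ℝ}
    (hx : Function.Injective x) (hf : ∀ i, ContDiffAt ℝ 1 f (x i)) :
    (loewnerMatrix f x).PosSemidef ↔ ∀ q : ℝ[X], q.natDegree ≤ n - 1 →
      0 ≤ dividedDiff (fun t => f t * (q ^ 2).eval t)
        ((List.ofFn x).flatMap fun t => [t, t]) := by
  refine posSemidef_dividedDiff_iff hx hf (fun i => (Finset.univ.erase i).toList.map x)
    (fun i => [x i]) (fun i => ?_) (by simp) fun q hq => ?_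
  · refine List.perm_append_comm.trans ?_
    rw [← Multiset.coe_eq_coe, List.singleton_append, ← Multiset.cons_coe, ← Multiset.map_coe,
      Finset.coe_toList, ← Multiset.map_cons, ← Fin.univ_val_map]
    congr 1
    rw [Finset.erase_val]
    exact Multiset.cons_erase (Finset.mem_univ i)
  · obtain ⟨c, hc⟩ := exists_eq_sum_lagrange hn hx q hq
    refine ⟨c, hc.trans (Finset.sum_congr rfl fun i _ => ?_)⟩
    rw [List.map_map, ← Finset.prod_map_toList]
    rfl

/-- The Newton basis: the `i`-th product runs over the nodes after `x i`, so the initial segments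
remain. -/
theorem extendedLoewnerMatrix_posSemidef_iff {n : ℕ} (hn : 0 < n) {f : ℝ → ℝ} {x : Fin n → ℝ}
    (hx : Function.Injective x) (hf : ∀ i, ContDiffAt ℝ 1 f (x i)) :
    (extendedLoewnerMatrix f x).PosSemidef ↔ ∀ q : ℝ[X], q.natDegree ≤ n - 1 →
      0 ≤ dividedDiff (fun t => f t * (q ^ 2).eval t)
        ((List.ofFn x).flatMap fun t => [t, t]) := by
  obtain ⟨n, rfl⟩ := Nat.exists_eq_add_one.2 hn
  refine posSemidef_dividedDiff_iff hx hf (fun i => (List.ofFn x).drop (i.val + 1))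
    (fun i => (List.ofFn x).take (i.val + 1)) (fun i => ?_) (by simp) fun q hq => ?_
  · exact List.perm_append_comm.trans (by rw [List.take_append_drop])
  · exact exists_eq_sum_newton n x q hq

end loewner

theorem dividedDiff_ofFn_eq_ddSum (f : ℝ → ℝ) {m : ℕ} {x : Fin m → ℝ} (hx : Function.Injective x) :
    dividedDiff f (List.ofFn x) = ddSum f Finset.univ x :=
  dividedDiff_eq_ddSum f (Fin.univ_val_map x).symm hx

theorem tone_iff_dividedDiff_nonneg {m : ℕ} {f : ℝ → ℝ} {I : Set ℝ} :
    Tone m f I ↔ ∀ x : Fin (m + 1) → ℝ, StrictMono x → (∀ i, x i ∈ I) →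
      0 ≤ dividedDiff f (List.ofFn x) := by
  constructor
  · intro h x hx hxI
    rw [dividedDiff_ofFn_eq_ddSum f hx.injective]
    exact h.ddSum_nonneg hx.injective.injOn (fun i _ => hxI i) (by simp)
  · intro h s hs hsc
    have h1 := h (s.orderEmbOfFin hsc) (s.orderEmbOfFin hsc).strictMono
      fun i => hs _ (Finset.orderEmbOfFin_mem s hsc i)
    have h2 := (s.orderEmbOfFin hsc).injective
    rwa [dividedDiff_ofFn_eq_ddSum f h2, ← ddSum_eq_id _ _ _ h2.injOn,
      Finset.image_orderEmbOfFin_univ] at h1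

/-- Non-negativity at distinct nodes passes to double nodes. -/
theorem Tone.dividedDiff_pairs_nonneg {n : ℕ} (hn : 0 < n) {g : ℝ → ℝ} {I : Set ℝ} (hI : IsOpen I)
    (hg : Tone (2 * n - 1) g I) (hC : ∀ t ∈ I, ContDiffAt ℝ 1 g t) {x : Fin n → ℝ}
    (hx : Function.Injective x) (hxI : ∀ i, x i ∈ I) :
    0 ≤ dividedDiff g ((List.ofFn x).flatMap fun t => [t, t]) := by
  obtain ⟨V, hV, hinj⟩ := exists_injective_tendsto (Sum.elim x x)
  have hmem : ∀ c ∈ (List.ofFn x).flatMap fun t => [t, t], c ∈ I := by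
    intro c hc
    simp only [List.mem_flatMap, List.mem_ofFn] at hc
    obtain ⟨_, ⟨i, rfl⟩, hc⟩ := hc
    simp only [List.mem_cons, List.not_mem_nil, or_false, or_self] at hc
    exact hc ▸ hxI i
  refine ge_of_tendsto (tendsto_ddSum_dividedDiff (multiset_flatMap_pair x)
    (count_flatMap_pair_le (List.nodup_ofFn.2 hx)) (fun c hc => hC c (hmem c hc)) hV hinj) ?_
  have hVI : ∀ᶠ a in 𝓝[>] (0 : ℝ), ∀ i, V a i ∈ I := by
    rw [eventually_all]
    rintro (i | i)
    · exact (hV (Sum.inl i)).eventually (hI.mem_nhds (hxI i))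
    · exact (hV (Sum.inr i)).eventually (hI.mem_nhds (hxI i))
  filter_upwards [hinj, hVI] with a h1 h2
  exact hg.ddSum_nonneg h1.injOn (fun i _ => h2 i) (by simp; omega)

end

/-! ### From double nodes to distinct nodes by interlacing. -/

section

open Filter Topology Set Polynomial

section interlacing

/-- `a 0 < b 0 < a 1 < b 1 < ⋯`. -/
structure Interlacing {n : ℕ} (a b : Fin n → ℝ) : Prop where
  lt : ∀ i, a i < b i
  lt_of_lt : ∀ i j, i < j → b i < a j

/-- The convex combinations of `∏ (X - a i)` and `∏ (X - b i)`. -/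
noncomputable def pencil {n : ℕ} (a b : Fin n → ℝ) (s : ℝ) : ℝ[X] :=
  C (1 - s) * ∏ i, (X - C (a i)) + C s * ∏ i, (X - C (b i))

variable {n : ℕ} {a b : Fin n → ℝ}

theorem eval_pencil (s c : ℝ) :
    (pencil a b s).eval c = (1 - s) * ∏ i, (c - a i) + s * ∏ i, (c - b i) := by
  simp [pencil, eval_prod]

theorem eval_pencil_sub (s t c : ℝ) : (pencil a b t).eval c - (pencil a b s).eval c =
    (t - s) * (∏ i, (c - b i) - ∏ i, (c - a i)) := by
  rw [eval_pencil, eval_pencil]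
  ring

theorem pencil_sub_prod_degree (s : ℝ) (c : Fin n → ℝ) :
    (pencil a b s - ∏ i, (X - C (c i))).degree < n := by
  have hm : ∀ c : Fin n → ℝ, (∏ i, (X - C (c i))).Monic := fun c =>
    monic_prod_of_monic _ _ fun i _ => monic_X_sub_C _
  have hd : ∀ c : Fin n → ℝ, (∏ i, (X - C (c i)) : ℝ[X]).degree = n := fun c => by
    rw [degree_prod]; simp
  have key : ∀ c d : Fin n → ℝ, (∏ i, (X - C (c i)) - ∏ i, (X - C (d i)) : ℝ[X]).degree < n := by
    intro c d
    rw [← hd c]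
    refine degree_sub_lt_left (by rw [hd, hd]) (hm c).ne_zero ?_
    rw [(hm c).leadingCoeff, (hm d).leadingCoeff]
  have e : pencil a b s - ∏ i, (X - C (c i)) =
      C (1 - s) * (∏ i, (X - C (a i)) - ∏ i, (X - C (c i))) +
        C s * (∏ i, (X - C (b i)) - ∏ i, (X - C (c i))) := by
    rw [pencil, C_sub, C_1]
    ring
  have hC : ∀ (r : ℝ) (p : ℝ[X]), p.degree < n → (C r * p).degree < n := fun r p hp =>
    (by rw [← smul_eq_C_mul]; exact degree_smul_le r p : (C r * p).degree ≤ p.degree).trans_lt hp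
  rw [e]
  exact (degree_add_le _ _).trans_lt (max_lt (hC _ _ (key a c)) (hC _ _ (key b c)))

/-- Pair the factors with equal `j`: interlacing makes `(a i - b j) (b i - a j)` positive for `j ≠
i` and negative for `j = i`. -/
theorem Interlacing.prod_mul_prod_neg (h : Interlacing a b) (i : Fin n) :
    (∏ j, (a i - b j)) * ∏ j, (b i - a j) < 0 := by
  rw [← Finset.prod_mul_distrib, ← Finset.mul_prod_erase _ _ (Finset.mem_univ i)]
  refine mul_neg_of_neg_of_pos (by nlinarith [h.lt i]) (Finset.prod_pos fun j hj => ?_)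
  rcases lt_or_gt_of_ne (Finset.ne_of_mem_erase hj) with hji | hij
  · nlinarith [h.lt_of_lt j i hji, h.lt i, h.lt j]
  · nlinarith [h.lt_of_lt i j hij, h.lt i, h.lt j]

/-- At `a i` only the second product survives and at `b i` only the first, and their signs are
opposite. -/
theorem Interlacing.exists_root (h : Interlacing a b) {s : ℝ} (hs : s ∈ Icc (0 : ℝ) 1) (i : Fin n) :
    ∃ c ∈ Icc (a i) (b i), (pencil a b s).eval c = 0 := by
  have ha : (pencil a b s).eval (a i) = s * ∏ j, (a i - b j) := by
    rw [eval_pencil, Finset.prod_eq_zero (Finset.mem_univ i) (sub_self (a i)), mul_zero, zero_add]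
  have hb : (pencil a b s).eval (b i) = (1 - s) * ∏ j, (b i - a j) := by
    rw [eval_pencil, Finset.prod_eq_zero (f := fun j => b i - b j) (Finset.mem_univ i)
      (sub_self (b i)), mul_zero, add_zero]
  have hab := h.prod_mul_prod_neg i
  have hcont : ContinuousOn (fun c => (pencil a b s).eval c) (Icc (a i) (b i)) :=
    (Polynomial.continuous _).continuousOn
  have hs1 : 0 ≤ 1 - s := sub_nonneg.2 hs.2
  rcases mul_neg_iff.1 hab with ⟨h1, h2⟩ | ⟨h1, h2⟩
  · obtain ⟨c, hc, hc0⟩ := intermediate_value_Icc' (h.lt i).le hcont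
      (show (0 : ℝ) ∈ Icc _ _ from
        ⟨by rw [hb]; exact mul_nonpos_of_nonneg_of_nonpos hs1 h2.le,
          by rw [ha]; exact mul_nonneg hs.1 h1.le⟩)
    exact ⟨c, hc, hc0⟩
  · obtain ⟨c, hc, hc0⟩ := intermediate_value_Icc (h.lt i).le hcont
      (show (0 : ℝ) ∈ Icc _ _ from
        ⟨by rw [ha]; exact mul_nonpos_of_nonneg_of_nonpos hs.1 h1.le,
          by rw [hb]; exact mul_nonneg hs1 h2.le⟩)
    exact ⟨c, hc, hc0⟩

/-- Otherwise both products vanish at `c`, and some `a i` equals some `b j`. The difference is the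
derivative of the pencil in `s`; it appears in denominators below. -/
theorem Interlacing.prod_ne_prod_of_eval_eq_zero (h : Interlacing a b) {s c : ℝ}
    (hc : (pencil a b s).eval c = 0) : ∏ i, (c - b i) - ∏ i, (c - a i) ≠ 0 := by
  intro h0
  rw [eval_pencil] at hc
  have h1 : ∏ i, (c - a i) = 0 := by linear_combination hc - s * h0
  have h2 : ∏ i, (c - b i) = 0 := by linear_combination h0 + h1
  obtain ⟨i, -, hi⟩ := Finset.prod_eq_zero_iff.1 h1
  obtain ⟨j, -, hj⟩ := Finset.prod_eq_zero_iff.1 h2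
  have hij : a i = b j := by linarith
  rcases lt_trichotomy i j with h3 | rfl | h3
  · linarith [h.lt i, h.lt_of_lt i j h3, h.lt j]
  · linarith [h.lt i]
  · linarith [h.lt_of_lt j i h3]

variable {r : ℝ → Fin n → ℝ}

theorem Interlacing.strictMono_root (h : Interlacing a b) {x : Fin n → ℝ}
    (hx : ∀ i, x i ∈ Icc (a i) (b i)) : StrictMono x := fun i j hij =>
  ((hx i).2.trans_lt (h.lt_of_lt i j hij)).trans_le (hx j).1

theorem Interlacing.eval_pencil_eq_prod (h : Interlacing a b) {x : Fin n → ℝ} {s : ℝ}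
    (hx : ∀ i, x i ∈ Icc (a i) (b i)) (hs : ∀ i, (pencil a b s).eval (x i) = 0) (c : ℝ) :
    (pencil a b s).eval c = ∏ i, (c - x i) := by
  have h1 : pencil a b s = ∏ i, (X - C (x i)) := by
    refine eq_of_degree_sub_lt_of_eval_index_eq (s := Finset.univ) (v := x)
      (h.strictMono_root hx).injective.injOn ?_ fun i _ => ?_
    · simpa using pencil_sub_prod_degree s x
    · rw [hs, eval_prod, Finset.prod_eq_zero (Finset.mem_univ i)]
      simp
  rw [h1, eval_prod]
  simp

/-- The pencil at `t`, evaluated at the root `r s i`, is `∏ (r s i - r t j)` and also `(t - s) R`.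
The factors with `j ≠ i` are bounded below by the gaps between the intervals `[a j, b j]`, so the
factor with `j = i` is `O(|t - s|)`. -/
theorem Interlacing.tendsto_root (h : Interlacing a b)
    (hr : ∀ s ∈ Icc (0 : ℝ) 1, ∀ i, r s i ∈ Icc (a i) (b i) ∧ (pencil a b s).eval (r s i) = 0)
    {s : ℝ} (hs : s ∈ Icc (0 : ℝ) 1) (i : Fin n) :
    Tendsto (fun t => r t i) (𝓝[Icc 0 1 \ {s}] s) (𝓝 (r s i)) := by
  let δ : Fin n → ℝ := fun j => if i < j then a j - b i else a i - b j
  have hδ : ∀ j ∈ Finset.univ.erase i, 0 < δ j := by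
    intro j hj
    rcases lt_or_gt_of_ne (Finset.ne_of_mem_erase hj) with hji | hij
    · simp only [δ, if_neg hji.not_gt]
      exact sub_pos.2 (h.lt_of_lt j i hji)
    · simp only [δ, if_pos hij]
      exact sub_pos.2 (h.lt_of_lt i j hij)
  set P := ∏ j ∈ Finset.univ.erase i, δ j with hP
  have hPpos : 0 < P := Finset.prod_pos hδ
  set R := ∏ j, (r s i - b j) - ∏ j, (r s i - a j) with hR
  have hlim : Tendsto (fun t => |t - s| * |R| / P) (𝓝[Icc 0 1 \ {s}] s) (𝓝 0) := by
    have : Tendsto (fun t => |t - s| * |R| / P) (𝓝 s) (𝓝 (|s - s| * |R| / P)) :=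
      Continuous.tendsto (by fun_prop) s
    simp only [sub_self, abs_zero, zero_mul, zero_div] at this
    exact this.mono_left nhdsWithin_le_nhds
  rw [tendsto_iff_dist_tendsto_zero]
  refine squeeze_zero' (Eventually.of_forall fun t => dist_nonneg) ?_ hlim
  filter_upwards [self_mem_nhdsWithin] with t ht
  rw [Real.dist_eq, le_div_iff₀ hPpos, abs_sub_comm]
  have h1 := h.eval_pencil_eq_prod (fun j => (hr t ht.1 j).1) (fun j => (hr t ht.1 j).2) (r s i)
  have h2 := eval_pencil_sub (a := a) (b := b) s t (r s i)
  rw [(hr s hs i).2, sub_zero, h1, ← Finset.mul_prod_erase _ _ (Finset.mem_univ i)] at h2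
  rw [← abs_mul, ← h2, abs_mul, Finset.abs_prod]
  refine mul_le_mul_of_nonneg_left (Finset.prod_le_prod (fun j hj => (hδ j hj).le) fun j hj => ?_)
    (abs_nonneg _)
  have hi := (hr s hs i).1
  have hj' := (hr t ht.1 j).1
  rcases lt_or_gt_of_ne (Finset.ne_of_mem_erase hj) with hji | hij
  · simp only [δ, if_neg hji.not_gt]
    exact (by linarith [hi.1, hj'.2] : _ ≤ r s i - r t j).trans (le_abs_self _)
  · simp only [δ, if_pos hij]
    rw [abs_sub_comm]
    exact (by linarith [hi.2, hj'.1] : _ ≤ r t j - r s i).trans (le_abs_self _)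

theorem ddSum_sumElim (g : ℝ → ℝ) (x y : Fin n → ℝ) :
    ddSum g Finset.univ (Sum.elim x y) =
      ∑ i, g (x i) / ((∏ j ∈ Finset.univ.erase i, (x i - x j)) * ∏ j, (x i - y j)) +
        ∑ i, g (y i) / ((∏ j ∈ Finset.univ.erase i, (y i - y j)) * ∏ j, (y i - x j)) := by
  have e1 : ∀ i : Fin n, (Finset.univ : Finset (Fin n ⊕ Fin n)).erase (Sum.inl i) =
      (Finset.univ.erase i).disjSum Finset.univ := by
    intro i; ext (j | j) <;> simp
  have e2 : ∀ i : Fin n, (Finset.univ : Finset (Fin n ⊕ Fin n)).erase (Sum.inr i) =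
      Finset.univ.disjSum (Finset.univ.erase i) := by
    intro i; ext (j | j) <;> simp
  rw [ddSum, Fintype.sum_sum_type]
  simp only [e1, e2, Finset.prod_disjSum, Sum.elim_inl, Sum.elim_inr]
  congr 1
  refine Finset.sum_congr rfl fun i _ => ?_
  rw [mul_comm]

theorem Interlacing.ddSum_nonneg (h : Interlacing a b) {g : ℝ → ℝ} {I : Set ℝ}
    (hc : I.OrdConnected) (hC : ∀ t ∈ I, ContDiffAt ℝ 1 g t)
    (hpos : ∀ x : Fin n → ℝ, StrictMono x → (∀ i, x i ∈ I) →
      0 ≤ dividedDiff g ((List.ofFn x).flatMap fun t => [t, t]))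
    (ha : ∀ i, a i ∈ I) (hb : ∀ i, b i ∈ I) : 0 ≤ ddSum g Finset.univ (Sum.elim a b) := by
  have hex : ∀ s : ℝ, ∃ x : Fin n → ℝ, s ∈ Icc (0 : ℝ) 1 →
      ∀ i, x i ∈ Icc (a i) (b i) ∧ (pencil a b s).eval (x i) = 0 := by
    intro s
    by_cases hs : s ∈ Icc (0 : ℝ) 1
    · choose x hx using h.exists_root hs
      exact ⟨x, fun _ => hx⟩
    · exact ⟨0, fun h => absurd h hs⟩
  choose r hr using hex
  let R : ℝ → ℝ := fun c => ∏ i, (c - b i) - ∏ i, (c - a i)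
  -- As `∏ (r s i - r t j) = (t - s) R(r s i)`, a factor `t - s` splits off every denominator of the
  -- divided difference at `r s, r t`. What remains depends on `s` alone or on `t` alone, so the
  -- difference is a slope of this function.
  let H : ℝ → ℝ := fun s =>
    -∑ i, g (r s i) / ((∏ j ∈ Finset.univ.erase i, (r s i - r s j)) * R (r s i))
  have hprod : ∀ s ∈ Icc (0 : ℝ) 1, ∀ t ∈ Icc (0 : ℝ) 1, ∀ i,
      ∏ j, (r s i - r t j) = (t - s) * R (r s i) := by
    intro s hs t ht i
    rw [← h.eval_pencil_eq_prod (fun j => (hr t ht j).1) (fun j => (hr t ht j).2),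
      ← eval_pencil_sub, (hr s hs i).2, sub_zero]
  have hslope : ∀ s ∈ Icc (0 : ℝ) 1, ∀ t ∈ Icc (0 : ℝ) 1, s ≠ t →
      slope H s t = ddSum g Finset.univ (Sum.elim (r s) (r t)) := by
    intro s hs t ht hst
    have h1 : t - s ≠ 0 := sub_ne_zero.2 hst.symm
    have h2 : s - t ≠ 0 := sub_ne_zero.2 hst
    rw [ddSum_sumElim, slope_def_field]
    simp only [hprod s hs t ht, hprod t ht s hs, H]
    have e : ∀ x y z w : ℝ, x / (y * (z * w)) = x / (y * w) / z := fun x y z w => by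
      rw [div_div]; ring_nf
    simp only [e, ← Finset.sum_div]
    rw [← neg_sub t s, div_neg]
    ring
  have hR : ∀ s ∈ Icc (0 : ℝ) 1, ∀ i, R (r s i) ≠ 0 := fun s hs i =>
    h.prod_ne_prod_of_eval_eq_zero (hr s hs i).2
  have hmono : ∀ s ∈ Icc (0 : ℝ) 1, StrictMono (r s) := fun s hs =>
    h.strictMono_root fun i => (hr s hs i).1
  have hinj : ∀ s ∈ Icc (0 : ℝ) 1, ∀ t ∈ Icc (0 : ℝ) 1, s ≠ t →
      Function.Injective (Sum.elim (r s) (r t)) := by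
    intro s hs t ht hst
    refine (hmono s hs).injective.sumElim (hmono t ht).injective fun i j hij => ?_
    have h1 := hprod s hs t ht i
    rw [Finset.prod_eq_zero (Finset.mem_univ j) (sub_eq_zero.2 hij)] at h1
    exact mul_ne_zero (sub_ne_zero.2 hst.symm) (hR s hs i) h1.symm
  have hI : ∀ s ∈ Icc (0 : ℝ) 1, ∀ i, r s i ∈ I := fun s hs i =>
    hc.out (ha i) (hb i) (hr s hs i).1
  -- As `t → s` the roots merge in pairs, so the slopes tend to a divided difference at double
  -- nodes.
  have hderiv : ∀ s ∈ Icc (0 : ℝ) 1, HasDerivWithinAt H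
      (dividedDiff g ((List.ofFn (r s)).flatMap fun t => [t, t])) (Icc 0 1) s := by
    intro s hs
    rw [hasDerivWithinAt_iff_tendsto_slope]
    have h1 := tendsto_ddSum_dividedDiff (f := g) (F := 𝓝[Icc 0 1 \ {s}] s)
      (V := fun t => Sum.elim (r s) (r t)) (multiset_flatMap_pair (r s))
      (count_flatMap_pair_le (List.nodup_ofFn.2 (hmono s hs).injective)) (fun c hc' => ?_) ?_ ?_
    · refine h1.congr' ?_
      filter_upwards [self_mem_nhdsWithin] with t ht
      exact (hslope s hs t ht.1 (fun h => ht.2 h.symm)).symm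
    · simp only [List.mem_flatMap, List.mem_ofFn] at hc'
      obtain ⟨_, ⟨i, rfl⟩, hc'⟩ := hc'
      simp only [List.mem_cons, List.not_mem_nil, or_false, or_self] at hc'
      exact hc' ▸ hC _ (hI s hs i)
    · rintro (i | i)
      · exact tendsto_const_nhds
      · exact h.tendsto_root hr hs i
    · filter_upwards [self_mem_nhdsWithin] with t ht
      exact hinj s hs t ht.1 fun h => ht.2 h.symm
  have hmonoH : MonotoneOn H (Icc 0 1) :=
    monotoneOn_of_hasDerivWithinAt_nonneg (convex_Icc 0 1)
      (fun s hs => (hderiv s hs).continuousWithinAt)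
      (fun s hs => (hderiv s (interior_subset hs)).mono interior_subset)
      fun s hs => hpos _ (hmono s (interior_subset hs)) (hI s (interior_subset hs))
  have h01 := hmonoH (left_mem_Icc.2 zero_le_one) (right_mem_Icc.2 zero_le_one) zero_le_one
  -- The pencil at `0` is `∏ (X - a i)`, and the disjoint intervals `[a i, b i]` leave only one way
  -- to match the roots.
  have hr0 : r 0 = a := by
    ext i
    have h1 := h.eval_pencil_eq_prod (fun j => (hr 0 (by simp) j).1)
      (fun j => (hr 0 (by simp) j).2) (a i)
    rw [eval_pencil, sub_zero, one_mul, zero_mul, add_zero,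
      Finset.prod_eq_zero (Finset.mem_univ i) (sub_self (a i))] at h1
    obtain ⟨j, -, hj⟩ := Finset.prod_eq_zero_iff.1 h1.symm
    have hj' := (hr 0 (by simp) j).1
    rw [← sub_eq_zero.1 hj] at hj'
    have hij : i = j := by
      rcases lt_trichotomy i j with h3 | h3 | h3
      · linarith [h.lt i, h.lt_of_lt i j h3, hj'.1]
      · exact h3
      · linarith [h.lt_of_lt j i h3, hj'.2]
    rw [hij] at hj ⊢
    linarith
  have hr1 : r 1 = b := by
    ext i
    have h1 := h.eval_pencil_eq_prod (fun j => (hr 1 (by simp) j).1)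
      (fun j => (hr 1 (by simp) j).2) (b i)
    rw [eval_pencil, sub_self, zero_mul, one_mul, zero_add,
      Finset.prod_eq_zero (Finset.mem_univ i) (sub_self (b i))] at h1
    obtain ⟨j, -, hj⟩ := Finset.prod_eq_zero_iff.1 h1.symm
    have hj' := (hr 1 (by simp) j).1
    rw [← sub_eq_zero.1 hj] at hj'
    have hij : i = j := by
      rcases lt_trichotomy i j with h3 | h3 | h3
      · linarith [h.lt_of_lt i j h3, hj'.1]
      · exact h3
      · linarith [h.lt i, h.lt_of_lt j i h3, hj'.2]
    rw [hij] at hj ⊢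
    linarith
  have h2 := hslope 0 (by simp) 1 (by simp) zero_ne_one
  rw [hr0, hr1, slope_def_field, sub_zero, div_one] at h2
  rw [← h2]
  exact sub_nonneg.2 h01

/-- The even and the odd members of an increasing enumeration interlace. -/
theorem interlacing_of_strictMono {x : Fin (2 * n) → ℝ} (hx : StrictMono x) :
    Interlacing (fun i : Fin n => x ⟨2 * i, by omega⟩) fun i => x ⟨2 * i + 1, by omega⟩ :=
  ⟨fun i => hx (by simp [Fin.lt_def]), fun i j hij => hx (by
    simp only [Fin.lt_def] at hij ⊢; omega)⟩

theorem ddSum_univ_eq_ddSum_even_odd (g : ℝ → ℝ) (x : Fin (2 * n) → ℝ) :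
    ddSum g Finset.univ x = ddSum g Finset.univ
      (Sum.elim (fun i : Fin n => x ⟨2 * i, by omega⟩) fun i : Fin n => x ⟨2 * i + 1, by omega⟩) := by
  let e : Fin n ⊕ Fin n → Fin (2 * n) :=
    Sum.elim (fun i => ⟨2 * i, by omega⟩) fun i => ⟨2 * i + 1, by omega⟩
  have he : Function.Injective e := by
    rintro (i | i) (j | j) hij
    · have := congrArg Fin.val hij
      simp only [e, Sum.elim_inl] at this
      rw [Fin.ext (by omega : i.val = j.val)]
    · have := congrArg Fin.val hij
      simp only [e, Sum.elim_inl, Sum.elim_inr] at this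
      omega
    · have := congrArg Fin.val hij
      simp only [e, Sum.elim_inl, Sum.elim_inr] at this
      omega
    · have := congrArg Fin.val hij
      simp only [e, Sum.elim_inr] at this
      rw [Fin.ext (by omega : i.val = j.val)]
  have hbij : Function.Bijective e :=
    (Fintype.bijective_iff_injective_and_card e).2 ⟨he, by simp; ring⟩
  have h1 : (Finset.univ : Finset (Fin (2 * n))) = Finset.univ.image e :=
    (Finset.image_univ_of_surjective hbij.2).symm
  rw [h1, ddSum_image _ _ _ _ he.injOn]
  congr 1
  ext (i | i) <;> rfl

theorem tone_of_dividedDiff_pairs_nonneg (hn : 0 < n) {g : ℝ → ℝ} {I : Set ℝ}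
    (hc : I.OrdConnected) (hC : ∀ t ∈ I, ContDiffAt ℝ 1 g t)
    (hpos : ∀ x : Fin n → ℝ, StrictMono x → (∀ i, x i ∈ I) →
      0 ≤ dividedDiff g ((List.ofFn x).flatMap fun t => [t, t])) : Tone (2 * n - 1) g I := by
  intro s hs hsc
  have hsc : s.card = 2 * n := by omega
  have h2 := (s.orderEmbOfFin hsc).injective
  have hm : ∀ i, s.orderEmbOfFin hsc i ∈ I := fun i => hs _ (Finset.orderEmbOfFin_mem s hsc i)
  rw [← Finset.image_orderEmbOfFin_univ s hsc, ddSum_eq_id _ _ _ h2.injOn,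
    ddSum_univ_eq_ddSum_even_odd]
  exact (interlacing_of_strictMono (s.orderEmbOfFin hsc).strictMono).ddSum_nonneg hc hC hpos
    (fun i => hm _) fun i => hm _

end interlacing

end

/-! ### Derivatives of `f P` and monotonicity from almost everywhere derivatives. -/

section

open Filter Topology Set Polynomial MeasureTheory

/-- The derivatives of `u 0 * P` by the product rule, where `u (k + 1)` is the derivative of
`u k`. -/
noncomputable def jetMul : (ℕ → ℝ → ℝ) → ℝ[X] → ℕ → ℝ → ℝ
  | u, P, 0 => fun x => u 0 x * P.eval x
  | u, P, j + 1 => fun x => jetMul (fun k => u (k + 1)) P j x + jetMul u (derivative P) j x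

section jetMul

theorem hasDerivWithinAt_jetMul {S : Set ℝ} {x : ℝ} (j : ℕ) : ∀ (u : ℕ → ℝ → ℝ) (P : ℝ[X]),
    (∀ k ≤ j, HasDerivWithinAt (u k) (u (k + 1) x) S x) →
      HasDerivWithinAt (jetMul u P j) (jetMul u P (j + 1) x) S x := by
  induction j with
  | zero =>
    intro u P h
    exact (h 0 le_rfl).mul (P.hasDerivAt x).hasDerivWithinAt
  | succ j ih =>
    intro u P h
    exact (ih (fun k => u (k + 1)) P fun k hk => h (k + 1) (by omega)).add
      (ih u (derivative P) fun k hk => h k (by omega))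

theorem hasDerivAt_jetMul {x : ℝ} (j : ℕ) (u : ℕ → ℝ → ℝ) (P : ℝ[X])
    (h : ∀ k ≤ j, HasDerivAt (u k) (u (k + 1) x) x) :
    HasDerivAt (jetMul u P j) (jetMul u P (j + 1) x) x := by
  simp only [← hasDerivWithinAt_univ] at h ⊢
  exact hasDerivWithinAt_jetMul j u P h

theorem continuousOn_jetMul {S : Set ℝ} (j : ℕ) : ∀ (u : ℕ → ℝ → ℝ) (P : ℝ[X]),
    (∀ k ≤ j, ContinuousOn (u k) S) → ContinuousOn (jetMul u P j) S := by
  induction j with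
  | zero => exact fun u P h => (h 0 le_rfl).mul P.continuous.continuousOn
  | succ j ih =>
    exact fun u P h => (ih _ P fun k hk => h (k + 1) (by omega)).add
      (ih u _ fun k hk => h k (by omega))

theorem jetMul_add (j : ℕ) : ∀ (u : ℕ → ℝ → ℝ) (P Q : ℝ[X]) (x : ℝ),
    jetMul u (P + Q) j x = jetMul u P j x + jetMul u Q j x := by
  induction j with
  | zero => intro u P Q x; simp [jetMul, mul_add]
  | succ j ih => intro u P Q x; simp only [jetMul, derivative_add, ih]; ring

theorem jetMul_C_mul (j : ℕ) : ∀ (u : ℕ → ℝ → ℝ) (c : ℝ) (P : ℝ[X]) (x : ℝ),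
    jetMul u (C c * P) j x = c * jetMul u P j x := by
  induction j with
  | zero => intro u c P x; simp only [jetMul, eval_mul, eval_C]; ring
  | succ j ih => intro u c P x; simp only [jetMul, derivative_C_mul, ih]; ring

theorem jetMul_zero (j : ℕ) (u : ℕ → ℝ → ℝ) (x : ℝ) : jetMul u 0 j x = 0 := by
  simpa using jetMul_C_mul j u 0 0 x

theorem jetMul_finset_sum {J : Type*} (s : Finset J) (j : ℕ) (u : ℕ → ℝ → ℝ) (P : J → ℝ[X])
    (x : ℝ) : jetMul u (∑ k ∈ s, P k) j x = ∑ k ∈ s, jetMul u (P k) j x := by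
  classical
  induction s using Finset.induction_on with
  | empty => simp [jetMul_zero]
  | insert k s hk ih => rw [Finset.sum_insert hk, Finset.sum_insert hk, jetMul_add, ih]

/-- In the Leibniz rule at `t` only the term survives in which the power is differentiated exactly
`r` times. For `r > j` the coefficient is zero, so the truncated `j - r` does no harm. -/
theorem jetMul_X_sub_C_pow (t : ℝ) (j : ℕ) : ∀ (u : ℕ → ℝ → ℝ) (r : ℕ),
    jetMul u ((X - C t) ^ r) j t = (j.descFactorial r : ℝ) * u (j - r) t := by
  induction j with
  | zero =>
    intro u r
    cases r <;> simp [jetMul]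
  | succ j ih =>
    intro u r
    simp only [jetMul, derivative_X_sub_C_pow, jetMul_C_mul, ih]
    rcases r with _ | r
    · simp
    · simp only [Nat.add_sub_cancel, Nat.reduceSubDiff, Nat.succ_descFactorial_succ,
        Nat.descFactorial_succ]
      rcases lt_trichotomy r j with h | rfl | h
      · rw [show j - (r + 1) + 1 = j - r by omega]
        push_cast [Nat.cast_sub h.le]
        ring
      · push_cast
        simp [mul_assoc]
      · rw [Nat.descFactorial_eq_zero_iff_lt.2 h]
        simp

/-- The exponents `n - 1 - i` run downwards so that, out of `2n - 1` derivatives, `i + j + 1` are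
left for `u`. This is the Hankel form of the Dobsch matrix up to the factor `(2n - 1)!`. -/
theorem jetMul_sq_eq_sum {n : ℕ} (u : ℕ → ℝ → ℝ) (t : ℝ) (c : Fin n → ℝ) :
    jetMul u ((∑ i : Fin n, C (c i) * (X - C t) ^ (n - 1 - i.val)) ^ 2) (2 * n - 1) t =
      ((2 * n - 1).factorial : ℝ) * ∑ i : Fin n, ∑ j : Fin n,
        c i * c j * (u (i.val + j.val + 1) t / ((i.val + j.val + 1).factorial : ℝ)) := by
  rw [sq, Finset.sum_mul_sum, jetMul_finset_sum, Finset.mul_sum]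
  refine Finset.sum_congr rfl fun i _ => ?_
  rw [jetMul_finset_sum, Finset.mul_sum]
  refine Finset.sum_congr rfl fun j _ => ?_
  have e : C (c i) * (X - C t) ^ (n - 1 - i.val) * (C (c j) * (X - C t) ^ (n - 1 - j.val)) =
      C (c i) * (C (c j) * (X - C t) ^ (2 * n - 2 - i.val - j.val)) := by
    rw [show 2 * n - 2 - i.val - j.val = (n - 1 - i.val) + (n - 1 - j.val) by omega, pow_add]
    ring
  rw [e, jetMul_C_mul, jetMul_C_mul, jetMul_X_sub_C_pow]
  have h1 : 2 * n - 1 - (2 * n - 2 - i.val - j.val) = i.val + j.val + 1 := by omega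
  have h2 := Nat.factorial_mul_descFactorial
    (show 2 * n - 2 - i.val - j.val ≤ 2 * n - 1 by omega)
  rw [h1] at h2 ⊢
  rw [← h2]
  have h3 : ((i.val + j.val + 1).factorial : ℝ) ≠ 0 := by positivity
  push_cast
  field_simp

end jetMul

section jets

/-- `w 0, …, w N` are successive derivatives on `I` and `w (N + 1)` is the right derivative of
`w N`. -/
structure JetOn (N : ℕ) (w : ℕ → ℝ → ℝ) (I : Set ℝ) : Prop where
  hasDerivAt : ∀ k < N, ∀ x ∈ I, HasDerivAt (w k) (w (k + 1) x) x
  continuousOn : ContinuousOn (w N) I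
  hasDerivWithinAt : ∀ x ∈ I, HasDerivWithinAt (w N) (w (N + 1) x) (Ioi x) x

/-- The next two derivatives after `w N` exist at `t`. -/
structure RegularAt (N : ℕ) (w : ℕ → ℝ → ℝ) (t : ℝ) : Prop where
  fst : HasDerivAt (w N) (w (N + 1) t) t
  snd : HasDerivAt (w (N + 1)) (w (N + 2) t) t

variable {N : ℕ} {u w : ℕ → ℝ → ℝ} {I : Set ℝ} {f g : ℝ → ℝ}

theorem JetOn.continuousOn_of_le (h : JetOn N w I) {k : ℕ} (hk : k ≤ N) : ContinuousOn (w k) I := by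
  rcases hk.lt_or_eq with hk | rfl
  · exact fun x hx => (h.hasDerivAt k hk x hx).continuousAt.continuousWithinAt
  · exact h.continuousOn

theorem JetOn.hasDerivWithinAt_of_le (h : JetOn N w I) {k : ℕ} (hk : k ≤ N) {x : ℝ} (hx : x ∈ I) :
    HasDerivWithinAt (w k) (w (k + 1) x) (Ioi x) x := by
  rcases hk.lt_or_eq with hk | rfl
  · exact (h.hasDerivAt k hk x hx).hasDerivWithinAt
  · exact h.hasDerivWithinAt x hx

theorem JetOn.mul (h : JetOn N u I) (P : ℝ[X]) : JetOn N (jetMul u P) I where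
  hasDerivAt k hk x hx := hasDerivAt_jetMul k u P fun l hl => h.hasDerivAt l (by omega) x hx
  continuousOn := continuousOn_jetMul N u P fun _ hk => h.continuousOn_of_le hk
  hasDerivWithinAt _ hx := hasDerivWithinAt_jetMul N u P fun _ hk => h.hasDerivWithinAt_of_le hk hx

theorem RegularAt.mul (h : JetOn N u I) {t : ℝ} (ht : t ∈ I) (hr : RegularAt N u t) (P : ℝ[X]) :
    RegularAt N (jetMul u P) t := by
  have h1 : ∀ k ≤ N + 1, HasDerivAt (u k) (u (k + 1) t) t := by
    intro k hk
    rcases hk.lt_or_eq with hk | rfl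
    · rcases (Nat.lt_succ_iff.1 hk).lt_or_eq with hk | rfl
      · exact h.hasDerivAt k hk t ht
      · exact hr.fst
    · exact hr.snd
  exact ⟨hasDerivAt_jetMul N u P fun k hk => h1 k (by omega), hasDerivAt_jetMul (N + 1) u P h1⟩

theorem JetOn.iteratedDeriv_eq (hI : IsOpen I) (h : JetOn N w I) (hg : ∀ x ∈ I, g x = w 0 x)
    {k : ℕ} (hk : k ≤ N) : ∀ x ∈ I, iteratedDeriv k g x = w k x := by
  induction k with
  | zero => simpa using hg
  | succ k ih =>
    intro x hx
    have h1 : iteratedDeriv k g =ᶠ[𝓝 x] w k := by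
      filter_upwards [hI.mem_nhds hx] with y hy using ih (by omega) y hy
    rw [iteratedDeriv_succ, h1.deriv_eq, (h.hasDerivAt k (by omega) x hx).deriv]

theorem JetOn.derivDomain_eq (hI : IsOpen I) (h : JetOn N w I) (hg : ∀ x ∈ I, g x = w 0 x)
    {k : ℕ} (hk : k ≤ N) : derivDomain g I k = I ∧ ∀ x ∈ I, nthDeriv g I k x = w k x := by
  induction k with
  | zero => exact ⟨rfl, hg⟩
  | succ k ih =>
    obtain ⟨h1, h2⟩ := ih (by omega)
    have key : ∀ x ∈ I, HasDerivWithinAt (nthDeriv g I k) (w (k + 1) x) I x := fun x hx =>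
      (h.hasDerivAt k (by omega) x hx).hasDerivWithinAt.congr h2 (h2 x hx)
    constructor
    · ext x
      change x ∈ derivDomain g I k ∧ AccPt x (𝓟 (derivDomain g I k)) ∧
        DifferentiableWithinAt ℝ (nthDeriv g I k) (derivDomain g I k) x ↔ x ∈ I
      rw [h1]
      exact ⟨fun hx => hx.1, fun hx => ⟨hx,
        uniqueDiffWithinAt_iff_accPt.1 (hI.uniqueDiffWithinAt hx), (key x hx).differentiableWithinAt⟩⟩
    · intro x hx
      change derivWithin (nthDeriv g I k) (derivDomain g I k) x = _
      rw [h1]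
      exact (key x hx).derivWithin (hI.uniqueDiffWithinAt hx)

/-- Wherever `w N` is differentiable, its derivative must be its right derivative `w (N + 1)`. -/
theorem JetOn.derivDomain_succ (hI : IsOpen I) (h : JetOn N w I) (hg : ∀ x ∈ I, g x = w 0 x) :
    derivDomain g I (N + 1) = {x ∈ I | DifferentiableAt ℝ (w N) x} ∧
      ∀ x ∈ derivDomain g I (N + 1), nthDeriv g I (N + 1) x = w (N + 1) x := by
  obtain ⟨h1, h2⟩ := h.derivDomain_eq hI hg le_rfl
  have hiff : ∀ x ∈ I, DifferentiableWithinAt ℝ (nthDeriv g I N) I x ↔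
      DifferentiableAt ℝ (w N) x := by
    intro x hx
    exact ⟨fun hd => (hd.congr (fun y hy => (h2 y hy).symm) (h2 x hx).symm).differentiableAt
      (hI.mem_nhds hx), fun hd => hd.differentiableWithinAt.congr h2 (h2 x hx)⟩
  have hdom : derivDomain g I (N + 1) = {x ∈ I | DifferentiableAt ℝ (w N) x} := by
    ext x
    change x ∈ derivDomain g I N ∧ AccPt x (𝓟 (derivDomain g I N)) ∧
      DifferentiableWithinAt ℝ (nthDeriv g I N) (derivDomain g I N) x ↔
        x ∈ I ∧ DifferentiableAt ℝ (w N) x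
    rw [h1]
    exact ⟨fun hx => ⟨hx.1, (hiff x hx.1).1 hx.2.2⟩, fun hx => ⟨hx.1,
      uniqueDiffWithinAt_iff_accPt.1 (hI.uniqueDiffWithinAt hx.1), (hiff x hx.1).2 hx.2⟩⟩
  refine ⟨hdom, fun x hx => ?_⟩
  rw [hdom] at hx
  change derivWithin (nthDeriv g I N) (derivDomain g I N) x = _
  rw [h1, derivWithin_congr h2 (h2 x hx.1), derivWithin_of_isOpen hI hx.1]
  have h3 := hx.2.hasDerivAt.hasDerivWithinAt (s := Ioi x)
  exact (uniqueDiffWithinAt_Ioi x).eq_deriv _ h3 (h.hasDerivWithinAt x hx.1)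

/-- The domain of the derivative of order `N + 1` contains almost every point of `I`, so `t` is an
accumulation point of it and the next derivative within that domain is meaningful. -/
theorem JetOn.mem_derivDomain (hI : IsOpen I) (h : JetOn N w I) (hg : ∀ x ∈ I, g x = w 0 x)
    (hae : ∀ᵐ t : ℝ, t ∈ I → RegularAt N w t) {t : ℝ} (ht : t ∈ I) (hr : RegularAt N w t) :
    t ∈ derivDomain g I (N + 2) ∧ nthDeriv g I (N + 2) t = w (N + 2) t := by
  obtain ⟨h1, h2⟩ := h.derivDomain_succ hI hg
  have htD : t ∈ derivDomain g I (N + 1) := by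
    rw [h1]
    exact ⟨ht, hr.fst.differentiableAt⟩
  have hacc : AccPt t (𝓟 (derivDomain g I (N + 1))) := by
    rw [accPt_iff_frequently]
    have h0 : ∀ᵐ x : ℝ, x ≠ t := by simp [ae_iff]
    have hd := (Measure.dense_of_ae (hae.and h0)).closure_eq
    have h3 : t ∈ closure {x | (x ∈ I → RegularAt N w x) ∧ x ≠ t} := by rw [hd]; trivial
    rw [mem_closure_iff_frequently] at h3
    refine (h3.and_eventually (hI.mem_nhds ht)).mono fun y hy => ⟨hy.1.2, ?_⟩
    rw [h1]
    exact ⟨hy.2, (hy.1.1 hy.2).fst.differentiableAt⟩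
  have hder : HasDerivWithinAt (nthDeriv g I (N + 1)) (w (N + 2) t) (derivDomain g I (N + 1)) t :=
    hr.snd.hasDerivWithinAt.congr h2 (h2 t htD)
  exact ⟨⟨htD, hacc, hder.differentiableWithinAt⟩,
    hder.derivWithin (uniqueDiffWithinAt_iff_accPt.2 hacc)⟩

theorem JetOn.nthDeriv_eq (hI : IsOpen I) (h : JetOn N w I) (hg : ∀ x ∈ I, g x = w 0 x)
    (hae : ∀ᵐ t : ℝ, t ∈ I → RegularAt N w t) {t : ℝ} (ht : t ∈ I) (hr : RegularAt N w t) {k : ℕ}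
    (hk : k ≤ N + 2) : nthDeriv g I k t = w k t := by
  obtain hk | rfl | rfl : k ≤ N ∨ k = N + 1 ∨ k = N + 2 := by omega
  · exact (h.derivDomain_eq hI hg hk).2 t ht
  · obtain ⟨h1, h2⟩ := h.derivDomain_succ hI hg
    refine h2 t ?_
    rw [h1]
    exact ⟨ht, hr.fst.differentiableAt⟩
  · exact (h.mem_derivDomain hI hg hae ht hr).2

/-- The derivatives of `f` up to order `N`, the right derivative of the last of them and its
derivative. -/
noncomputable def jet (N : ℕ) (f : ℝ → ℝ) (k : ℕ) : ℝ → ℝ :=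
  if k ≤ N then iteratedDeriv k f
  else if k = N + 1 then fun x => derivWithin (iteratedDeriv N f) (Ioi x) x
  else deriv fun x => derivWithin (iteratedDeriv N f) (Ioi x) x

theorem jet_of_le {k : ℕ} (hk : k ≤ N) : jet N f k = iteratedDeriv k f := if_pos hk

theorem jet_add_one : jet N f (N + 1) = fun x => derivWithin (iteratedDeriv N f) (Ioi x) x := by
  simp [jet]

theorem jet_add_two : jet N f (N + 2) = deriv (jet N f (N + 1)) := by
  simp [jet]

theorem jetOn_jet (hI : IsOpen I) (hf : ContDiffOn ℝ (N : WithTop ℕ∞) f I)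
    (hc : ConvexOn ℝ I (iteratedDeriv N f)) : JetOn N (jet N f) I where
  hasDerivAt k hk x hx := by
    rw [jet_of_le hk.le, jet_of_le hk, iteratedDeriv_succ]
    have h1 := hf.differentiableOn_iteratedDerivWithin (m := k) (by exact_mod_cast hk)
      hI.uniqueDiffOn
    have h2 : DifferentiableOn ℝ (iteratedDeriv k f) I :=
      h1.congr fun y hy => (iteratedDerivWithin_of_isOpen hI hy).symm
    exact ((h2 x hx).differentiableAt (hI.mem_nhds hx)).hasDerivAt
  continuousOn := by
    rw [jet_of_le le_rfl]
    exact hc.continuousOn hI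
  hasDerivWithinAt x hx := by
    rw [jet_of_le le_rfl, jet_add_one]
    exact hc.hasDerivWithinAt_rightDeriv_of_mem_interior (by rwa [hI.interior_eq])

theorem monotoneOn_jet (hI : IsOpen I) (hc : ConvexOn ℝ I (iteratedDeriv N f)) :
    MonotoneOn (jet N f (N + 1)) I := by
  rw [jet_add_one]
  simpa only [hI.interior_eq] using hc.monotoneOn_rightDeriv

/-- For `y < t` the right derivative at `y` is at most the slope from `y` to `t`, hence at most the
left derivative at `t`. Let `y → t`: the one-sided derivatives agree. -/
theorem ConvexOn.hasDerivAt_of_continuousAt_rightDeriv (hI : IsOpen I) (hc : ConvexOn ℝ I f)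
    {t : ℝ} (ht : t ∈ I) (hcont : ContinuousAt (fun x => derivWithin f (Ioi x) x) t) :
    HasDerivAt f (derivWithin f (Ioi t) t) t := by
  have hint : ∀ x ∈ I, x ∈ interior I := fun x hx => by rwa [hI.interior_eq]
  have hle : derivWithin f (Ioi t) t ≤ derivWithin f (Iio t) t := by
    have h1 : Tendsto (fun x => derivWithin f (Ioi x) x) (𝓝[<] t) (𝓝 (derivWithin f (Ioi t) t)) :=
      hcont.mono_left nhdsWithin_le_nhds
    refine le_of_tendsto h1 ?_
    filter_upwards [nhdsWithin_le_nhds (hI.mem_nhds ht), self_mem_nhdsWithin] with y hy hyt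
    exact (hc.rightDeriv_le_slope_of_mem_interior (hint y hy) ht hyt).trans
      (hc.slope_le_leftDeriv_of_mem_interior hy (hint t ht) hyt)
  have heq := hle.antisymm (hc.leftDeriv_le_rightDeriv_of_mem_interior (hint t ht))
  have hr := hc.hasDerivWithinAt_rightDeriv_of_mem_interior (hint t ht)
  have hl := hc.hasDerivWithinAt_leftDeriv_of_mem_interior (hint t ht)
  rw [← heq] at hl
  rw [hasDerivWithinAt_Ioi_iff_Ici] at hr
  rw [hasDerivWithinAt_Iio_iff_Iic] at hl
  have := hl.union hr
  rwa [Iic_union_Ici, hasDerivWithinAt_univ] at this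

/-- The right derivative of a convex function is monotone, hence differentiable almost everywhere.
At such points it is continuous, so the convex function is differentiable too. -/
theorem ae_regularAt_jet (hI : IsOpen I) (hc : ConvexOn ℝ I (iteratedDeriv N f)) :
    ∀ᵐ t : ℝ, t ∈ I → RegularAt N (jet N f) t := by
  filter_upwards [(monotoneOn_jet hI hc).ae_differentiableWithinAt_of_mem] with t h ht
  have h1 := (h ht).differentiableAt (hI.mem_nhds ht)
  refine ⟨?_, by rw [jet_add_two]; exact h1.hasDerivAt⟩
  have h2 := h1.continuousAt
  rw [jet_add_one] at h2 ⊢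
  rw [jet_of_le le_rfl]
  exact hc.hasDerivAt_of_continuousAt_rightDeriv hI ht h2

end jets

section monotone

variable {N : ℕ} {u w : ℕ → ℝ → ℝ} {I : Set ℝ} {f g : ℝ → ℝ} {c d : ℝ}

/-- `f` is Lipschitz on `[c, d]`. -/
def LipIcc (c d : ℝ) (f : ℝ → ℝ) : Prop :=
  ∃ K : ℝ, ∀ x ∈ Icc c d, ∀ y ∈ Icc c d, x ≤ y → |f y - f x| ≤ K * (y - x)

theorem LipIcc.add (hf : LipIcc c d f) (hg : LipIcc c d g) : LipIcc c d fun x => f x + g x := by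
  obtain ⟨K, hK⟩ := hf
  obtain ⟨L, hL⟩ := hg
  refine ⟨K + L, fun x hx y hy hxy => ?_⟩
  have e : f y + g y - (f x + g x) = (f y - f x) + (g y - g x) := by ring
  rw [e, add_mul]
  exact (abs_add_le _ _).trans (add_le_add (hK x hx y hy hxy) (hL x hx y hy hxy))

theorem LipIcc.mul (hf : LipIcc c d f) (hg : LipIcc c d g) {A B : ℝ}
    (hA : ∀ x ∈ Icc c d, |f x| ≤ A) (hB : ∀ x ∈ Icc c d, |g x| ≤ B) :
    LipIcc c d fun x => f x * g x := by
  obtain ⟨K, hK⟩ := hf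
  obtain ⟨L, hL⟩ := hg
  refine ⟨A * L + K * B, fun x hx y hy hxy => ?_⟩
  have e : f y * g y - f x * g x = f y * (g y - g x) + (f y - f x) * g x := by ring
  rw [e, add_mul]
  refine (abs_add_le _ _).trans (add_le_add ?_ ?_)
  · rw [abs_mul, mul_assoc]
    exact mul_le_mul (hA y hy) (hL x hx y hy hxy) (abs_nonneg _) ((abs_nonneg _).trans (hA y hy))
  · rw [abs_mul, mul_right_comm]
    exact mul_le_mul (hK x hx y hy hxy) (hB x hx) (abs_nonneg _)
      ((abs_nonneg _).trans (hK x hx y hy hxy))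

theorem lipIcc_of_hasDerivWithinAt (hf : ContinuousOn f (Icc c d))
    (hf' : ∀ x ∈ Icc c d, HasDerivWithinAt f (g x) (Ioi x) x) {B : ℝ}
    (hB : ∀ x ∈ Icc c d, |g x| ≤ B) : LipIcc c d f := by
  refine ⟨B, fun x hx y hy hxy => ?_⟩
  have hsub : Icc x y ⊆ Icc c d := Icc_subset_Icc hx.1 hy.2
  exact norm_image_sub_le_of_norm_deriv_right_le_segment (hf.mono hsub)
    (fun z hz => (hf' z (hsub (Ico_subset_Icc_self hz))).Ici_of_Ioi)
    (fun z hz => hB z (hsub (Ico_subset_Icc_self hz))) y ⟨hxy, le_rfl⟩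

theorem exists_abs_le_of_continuousOn (hf : ContinuousOn f (Icc c d)) :
    ∃ B, ∀ x ∈ Icc c d, |f x| ≤ B := isCompact_Icc.exists_bound_of_continuousOn hf

theorem lipIcc_eval (P : ℝ[X]) : LipIcc c d fun x => P.eval x := by
  obtain ⟨B, hB⟩ := exists_abs_le_of_continuousOn (c := c) (d := d)
    (derivative P).continuous.continuousOn
  exact lipIcc_of_hasDerivWithinAt P.continuous.continuousOn
    (fun x _ => (P.hasDerivAt x).hasDerivWithinAt) hB

/-- In the Leibniz expansion `u j` occurs only in the term `u j * P`; the other terms are products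
of polynomials with Lipschitz functions `u k`, `k < j`. -/
theorem lipIcc_jetMul_sub (j : ℕ) : ∀ (u : ℕ → ℝ → ℝ) (P : ℝ[X]),
    (∀ k < j, LipIcc c d (u k) ∧ ∃ B, ∀ x ∈ Icc c d, |u k x| ≤ B) →
      LipIcc c d fun x => jetMul u P j x - u j x * P.eval x := by
  induction j with
  | zero => intro u P _; exact ⟨0, by simp [jetMul]⟩
  | succ j ih =>
    intro u P hu
    have h1 := ih (fun k => u (k + 1)) P fun k hk => hu (k + 1) (by omega)
    have h2 := ih u (derivative P) fun k hk => hu k (by omega)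
    obtain ⟨h3, B, hB⟩ := hu j (by omega)
    obtain ⟨B', hB'⟩ := exists_abs_le_of_continuousOn (c := c) (d := d)
      (derivative P).continuous.continuousOn
    have h4 := h3.mul (lipIcc_eval (derivative P)) hB hB'
    convert (h1.add h2).add h4 using 2
    simp only [jetMul]
    ring

theorem JetOn.lipIcc (h : JetOn N u I) (hcd : Icc c d ⊆ I)
    (hB : ∃ B, ∀ x ∈ Icc c d, |u (N + 1) x| ≤ B) {k : ℕ} (hk : k ≤ N) :
    LipIcc c d (u k) ∧ ∃ B, ∀ x ∈ Icc c d, |u k x| ≤ B := by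
  refine ⟨?_, exists_abs_le_of_continuousOn ((h.continuousOn_of_le hk).mono hcd)⟩
  obtain ⟨B, hB'⟩ : ∃ B, ∀ x ∈ Icc c d, |u (k + 1) x| ≤ B := by
    rcases hk.lt_or_eq with hk | rfl
    · exact exists_abs_le_of_continuousOn ((h.continuousOn_of_le hk).mono hcd)
    · exact hB
  exact lipIcc_of_hasDerivWithinAt ((h.continuousOn_of_le hk).mono hcd)
    (fun x hx => h.hasDerivWithinAt_of_le hk (hcd hx)) hB'

/-- A function which becomes increasing when a linear function is added is increasing if its
derivative is non-negative almost everywhere. -/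
theorem le_of_ae_deriv_nonneg {K : ℝ} (hcd : c ≤ d)
    (hK : ∀ x ∈ Icc c d, ∀ y ∈ Icc c d, x ≤ y → -(K * (y - x)) ≤ f y - f x)
    (hf : ∀ᵐ t : ℝ, t ∈ Icc c d → DifferentiableAt ℝ f t ∧ 0 ≤ deriv f t) : f c ≤ f d := by
  -- The integral of the derivative of an increasing function is at most its increment, and here the
  -- derivative is at least `K` almost everywhere.
  have hmono : MonotoneOn (fun x => f x + K * x) (uIcc c d) := by
    rw [uIcc_of_le hcd]
    intro x hx y hy hxy
    have := hK x hx y hy hxy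
    simp only
    linarith
  have h1 := hmono.intervalIntegral_deriv_mem_uIcc
  have h2 := hmono.intervalIntegrable_deriv
  have h3 : ∫ _ in c..d, K ≤ ∫ x in c..d, deriv (fun x => f x + K * x) x := by
    refine intervalIntegral.integral_mono_ae_restrict hcd (by simp) h2 ?_
    rw [EventuallyLE, ae_restrict_iff' measurableSet_Icc]
    filter_upwards [hf] with t ht htI
    obtain ⟨h4, h5⟩ := ht htI
    have h6 : HasDerivAt (fun x => f x + K * x) (deriv f t + K) t := by
      simpa using h4.hasDerivAt.fun_add ((hasDerivAt_id t).const_mul K)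
    rw [h6.deriv]
    linarith
  rw [intervalIntegral.integral_const, smul_eq_mul] at h3
  have h7 : f c + K * c ≤ f d + K * d := hmono left_mem_uIcc right_mem_uIcc hcd
  rw [uIcc_of_le (by linarith)] at h1
  linarith [h1.2]

/-- By the mean value inequality for right derivatives, `g y` separates the slope on the left of `y`
from the slope on the right. -/
theorem convexOn_of_monotoneOn_rightDeriv (hc : I.OrdConnected) (hf : ContinuousOn f I)
    (hf' : ∀ x ∈ I, HasDerivWithinAt f (g x) (Ioi x) x) (hg : MonotoneOn g I) :
    ConvexOn ℝ I f := by
  refine convexOn_of_slope_mono_adjacent hc.convex fun {x y z} hx hz hxy hyz => ?_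
  have hy : y ∈ I := hc.out hx hz ⟨hxy.le, hyz.le⟩
  have hsub : Icc x y ⊆ I := hc.out hx hy
  have hsub' : Icc y z ⊆ I := hc.out hy hz
  have hlin : ∀ a b w : ℝ, HasDerivAt (fun t => b + g y * (t - a)) (g y) w := fun a b w => by
    simpa using (((hasDerivAt_id w).sub_const a).const_mul (g y)).const_add b
  have h1 := image_le_of_deriv_right_le_deriv_boundary (B := fun t => f x + g y * (t - x))
    (B' := fun _ => g y) (hf.mono hsub)
    (fun w hw => (hf' w (hsub (Ico_subset_Icc_self hw))).Ici_of_Ioi) (by simp) (by fun_prop)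
    (fun w _ => (hlin x (f x) w).hasDerivWithinAt)
    (fun w hw => hg (hsub (Ico_subset_Icc_self hw)) hy hw.2.le) (right_mem_Icc.2 hxy.le)
  have h2 := image_le_of_deriv_right_le_deriv_boundary (f := fun t => f y + g y * (t - y))
    (f' := fun _ => g y) (B := f) (B' := g) (by fun_prop)
    (fun w _ => (hlin y (f y) w).hasDerivWithinAt) (by simp) (hf.mono hsub')
    (fun w hw => (hf' w (hsub' (Ico_subset_Icc_self hw))).Ici_of_Ioi)
    (fun w hw => hg hy (hsub' (Ico_subset_Icc_self hw)) hw.1) (right_mem_Icc.2 hyz.le)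
  calc (f y - f x) / (y - x) ≤ g y := by
        rw [div_le_iff₀ (sub_pos.2 hxy)]; linarith
    _ ≤ (f z - f y) / (z - y) := by
        rw [le_div_iff₀ (sub_pos.2 hyz)]; linarith

/-- Up to a Lipschitz term the function is `u (N + 1) * P`. Its first factor is increasing and
bounded on `[c, d]` and `P ≥ 0` is Lipschitz, so the product decreases at most linearly. This rules
out the downward singular behaviour that the almost everywhere derivative would not see. -/
theorem JetOn.monotoneOn_jetMul (hc : I.OrdConnected) (h : JetOn N u I)
    (hu : MonotoneOn (u (N + 1)) I) (hae : ∀ᵐ t : ℝ, t ∈ I → RegularAt N u t) {P : ℝ[X]}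
    (hP : ∀ x, 0 ≤ P.eval x) (hpos : ∀ᵐ t : ℝ, t ∈ I → 0 ≤ jetMul u P (N + 2) t) :
    MonotoneOn (jetMul u P (N + 1)) I := by
  intro c hcI d hdI hcd
  have hsub : Icc c d ⊆ I := hc.out hcI hdI
  have hB : ∀ x ∈ Icc c d, |u (N + 1) x| ≤ max |u (N + 1) c| |u (N + 1) d| := fun x hx =>
    abs_le_max_abs_abs (hu hcI (hsub hx) hx.1) (hu (hsub hx) hdI hx.2)
  set B := max |u (N + 1) c| |u (N + 1) d|
  obtain ⟨K, hK⟩ := lipIcc_jetMul_sub (N + 1) u P fun k hk =>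
    h.lipIcc hsub ⟨B, hB⟩ (Nat.lt_succ_iff.1 hk)
  obtain ⟨L, hL⟩ := lipIcc_eval (c := c) (d := d) P
  refine le_of_ae_deriv_nonneg (K := K + B * L) hcd (fun x hx y hy hxy => ?_) ?_
  · have h1 := (abs_le.1 (hK x hx y hy hxy)).1
    have h2 : 0 ≤ (u (N + 1) y - u (N + 1) x) * P.eval y :=
      mul_nonneg (sub_nonneg.2 (hu (hsub hx) (hsub hy) hxy)) (hP y)
    have h3 : |u (N + 1) x * (P.eval y - P.eval x)| ≤ B * (L * (y - x)) := by
      rw [abs_mul]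
      exact mul_le_mul (hB x hx) (hL x hx y hy hxy) (abs_nonneg _)
        ((abs_nonneg _).trans (hB x hx))
    have h4 := (abs_le.1 h3).1
    nlinarith
  · filter_upwards [hae, hpos] with t h1 h2 ht
    have h3 := (h1 (hsub ht)).mul h (hsub ht) P
    exact ⟨h3.snd.differentiableAt, by rw [h3.snd.deriv]; exact h2 (hsub ht)⟩

end monotone

end

/-! ### The Dobsch matrix and the almost everywhere conditions. -/

section

open Filter Topology Set Polynomial MeasureTheory

section derivatives

variable {n N : ℕ} {f : ℝ → ℝ} {I : Set ℝ}

theorem posSemidef_iff_jetMul_nonneg {u : ℕ → ℝ → ℝ} {t : ℝ} (hn : 0 < n) :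
    (Matrix.of fun i j : Fin n =>
      u (i.val + j.val + 1) t / ((i.val + j.val + 1).factorial : ℝ)).PosSemidef ↔
      ∀ q : ℝ[X], q.natDegree ≤ n - 1 → 0 ≤ jetMul u (q ^ 2) (2 * n - 1) t := by
  rw [posSemidef_iff_sum_nonneg fun i j => by simp [add_comm i.val]]
  simp only [Matrix.of_apply]
  have hpos : (0 : ℝ) < ((2 * n - 1).factorial : ℝ) := by positivity
  constructor
  · intro h q hq
    -- The Taylor expansion of `q` at `t`, with the order of summation reversed.
    have e : q = ∑ i : Fin n, C ((taylor t q).coeff (n - 1 - i.val)) *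
        (X - C t) ^ (n - 1 - i.val) := by
      conv_lhs => rw [← sum_taylor_eq q t]
      rw [sum_over_range' _ (by simp) n (by rw [natDegree_taylor]; omega),
        ← Finset.sum_range_reflect, Finset.sum_range]
    rw [e, jetMul_sq_eq_sum]
    exact mul_nonneg hpos.le (h _)
  · intro h c
    have h1 := h (∑ i : Fin n, C (c i) * (X - C t) ^ (n - 1 - i.val))
      (natDegree_sum_le_of_forall_le _ _ fun i _ => (natDegree_C_mul_le _ _).trans (by
        rw [natDegree_pow, natDegree_X_sub_C]; omega))
    rw [jetMul_sq_eq_sum] at h1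
    exact nonneg_of_mul_nonneg_right h1 hpos

/-- If the divided differences of `f P` are non-negative, so is its last derivative where it
exists. -/
theorem JetOn.jetMul_nonneg_of_tone {u : ℕ → ℝ → ℝ} (hI : IsOpen I) (hc : I.OrdConnected)
    (h : JetOn N u I) {P : ℝ[X]} (hP : Tone (N + 2) (jetMul u P 0) I) {t : ℝ} (ht : t ∈ I)
    (hr : RegularAt N u t) : 0 ≤ jetMul u P (N + 2) t := by
  have h1 := (Tone.contDiffOn_and_convexOn hI hc N _ hP).2
  -- The derivative of order `N` is convex, so the one of order `N + 1`, its right derivative, is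
  -- increasing; the derivative of the latter at `t` is then non-negative.
  have h2 : ConvexOn ℝ I (jetMul u P N) :=
    h1.congr ((h.mul P).iteratedDeriv_eq hI (fun _ _ => rfl) le_rfl)
  have h3 : MonotoneOn (jetMul u P (N + 1)) I := by
    have h4 := h2.monotoneOn_rightDeriv
    rw [hI.interior_eq] at h4
    exact h4.congr fun x hx => ((h.mul P).hasDerivWithinAt x hx).derivWithin
      (uniqueDiffWithinAt_Ioi x)
  exact (hr.mul h ht P).snd.hasDerivWithinAt.nonneg_of_monotoneOn
    (uniqueDiffWithinAt_iff_accPt.1 (hI.uniqueDiffWithinAt ht)) h3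

theorem JetOn.tone_of_ae_nonneg {u : ℕ → ℝ → ℝ} (hI : IsOpen I) (hc : I.OrdConnected)
    (h : JetOn N u I) (hu : MonotoneOn (u (N + 1)) I)
    (hae : ∀ᵐ t : ℝ, t ∈ I → RegularAt N u t) {P : ℝ[X]} (hP : ∀ x, 0 ≤ P.eval x)
    (hpos : ∀ᵐ t : ℝ, t ∈ I → 0 ≤ jetMul u P (N + 2) t) : Tone (N + 2) (jetMul u P 0) I :=
  tone_of_hasDerivAt_of_convexOn hI hc N _ (h.mul P).hasDerivAt
    (convexOn_of_monotoneOn_rightDeriv hc (h.mul P).continuousOn (h.mul P).hasDerivWithinAt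
      (h.monotoneOn_jetMul hc hu hae hP hpos))

theorem jetMul_jet_zero (P : ℝ[X]) : jetMul (jet N f) P 0 = fun t => f t * P.eval t := by
  ext t
  simp [jetMul, jet_of_le (Nat.zero_le N)]

theorem two_mul_sub_one (hn : 2 ≤ n) : 2 * n - 1 = 2 * n - 3 + 2 := by omega

theorem dobschMatrix_posSemidef_iff (hn : 2 ≤ n) (hI : IsOpen I)
    (h2 : ContDiffOn ℝ ((2 * n - 3 : ℕ) : WithTop ℕ∞) f I)
    (h3 : ConvexOn ℝ I (iteratedDeriv (2 * n - 3) f)) {t : ℝ} (ht : t ∈ I)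
    (hr : RegularAt (2 * n - 3) (jet (2 * n - 3) f) t) :
    (dobschMatrix n f I t).PosSemidef ↔ ∀ q : ℝ[X], q.natDegree ≤ n - 1 →
      0 ≤ jetMul (jet (2 * n - 3) f) (q ^ 2) (2 * n - 1) t := by
  rw [← posSemidef_iff_jetMul_nonneg (by omega)]
  have e : dobschMatrix n f I t = Matrix.of fun i j : Fin n =>
      jet (2 * n - 3) f (i.val + j.val + 1) t / ((i.val + j.val + 1).factorial : ℝ) := by
    ext i j
    simp only [dobschMatrix, Matrix.of_apply]
    rw [(jetOn_jet hI h2 h3).nthDeriv_eq hI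
      (fun x _ => by simp [jet_of_le (Nat.zero_le _)]) (ae_regularAt_jet hI h3) ht hr (by omega)]
  rw [e]

/-- Non-negative divided differences make the Hankel matrix of the derivatives positive. -/
theorem dobsch_of_tone (hn : 2 ≤ n) (hI : IsOpen I) (hc : I.OrdConnected)
    (h : ∀ q : ℝ[X], q.natDegree ≤ n - 1 → Tone (2 * n - 1) (fun t => f t * (q ^ 2).eval t) I) :
    ContDiffOn ℝ ((2 * n - 3 : ℕ) : WithTop ℕ∞) f I ∧
      ConvexOn ℝ I (iteratedDeriv (2 * n - 3) f) ∧
      ∀ᵐ t : ℝ, t ∈ I → t ∈ derivDomain f I (2 * n - 1) ∧ (dobschMatrix n f I t).PosSemidef := by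
  rw [two_mul_sub_one hn] at h ⊢
  -- The polynomial `q = 1` gives the smoothness of `f` itself.
  have h1 : Tone (2 * n - 3 + 2) f I := by simpa using h 1 (by simp)
  obtain ⟨h2, h3⟩ := Tone.contDiffOn_and_convexOn hI hc _ _ h1
  refine ⟨h2, h3, ?_⟩
  have hj := jetOn_jet hI h2 h3
  have hae := ae_regularAt_jet hI h3
  have h0 : ∀ x ∈ I, f x = jet (2 * n - 3) f 0 x := fun x _ => by
    simp [jet_of_le (Nat.zero_le _)]
  filter_upwards [hae] with t hr ht
  refine ⟨(hj.mem_derivDomain hI h0 hae ht (hr ht)).1, ?_⟩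
  rw [dobschMatrix_posSemidef_iff hn hI h2 h3 ht (hr ht), two_mul_sub_one hn]
  intro q hq
  exact hj.jetMul_nonneg_of_tone hI hc (by rw [jetMul_jet_zero]; exact h q hq) ht (hr ht)

theorem ae_mulNormPoly_deriv_nonneg_of_dobsch (hn : 2 ≤ n) (hI : IsOpen I)
    (h2 : ContDiffOn ℝ ((2 * n - 3 : ℕ) : WithTop ℕ∞) f I)
    (h3 : ConvexOn ℝ I (iteratedDeriv (2 * n - 3) f))
    (h : ∀ᵐ t : ℝ, t ∈ I → t ∈ derivDomain f I (2 * n - 1) ∧ (dobschMatrix n f I t).PosSemidef)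
    (q : ℂ[X]) (hq : q.natDegree ≤ n - 1) :
    ∀ᵐ t : ℝ, t ∈ I → t ∈ derivDomain (mulNormPoly f q) I (2 * n - 1) ∧
      0 ≤ nthDeriv (mulNormPoly f q) I (2 * n - 1) t := by
  have hj := jetOn_jet hI h2 h3
  have hae := ae_regularAt_jet hI h3
  obtain ⟨q₁, q₂, hq₁, hq₂, hq'⟩ := exists_normPoly_eq_sq_add_sq q hq
  have hg : ∀ x ∈ I, mulNormPoly f q x = jetMul (jet (2 * n - 3) f) (q₁ ^ 2 + q₂ ^ 2) 0 x :=
    fun x _ => by rw [jetMul_jet_zero, mulNormPoly, hq', ← eval_add]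
  have hae' : ∀ᵐ t : ℝ, t ∈ I →
      RegularAt (2 * n - 3) (jetMul (jet (2 * n - 3) f) (q₁ ^ 2 + q₂ ^ 2)) t := by
    filter_upwards [hae] with t hr ht using (hr ht).mul hj ht _
  filter_upwards [hae, hae', h] with t hr hr' hM ht
  have hM := (hM ht).2
  rw [dobschMatrix_posSemidef_iff hn hI h2 h3 ht (hr ht)] at hM
  obtain ⟨m1, m2⟩ := (hj.mul _).mem_derivDomain hI hg hae' ht (hr' ht)
  rw [← two_mul_sub_one hn] at m1 m2
  rw [m2, jetMul_add]
  exact ⟨m1, add_nonneg (hM q₁ hq₁) (hM q₂ hq₂)⟩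

theorem tone_of_ae_mulNormPoly_deriv_nonneg (hn : 2 ≤ n) (hI : IsOpen I) (hc : I.OrdConnected)
    (h2 : ContDiffOn ℝ ((2 * n - 3 : ℕ) : WithTop ℕ∞) f I)
    (h3 : ConvexOn ℝ I (iteratedDeriv (2 * n - 3) f))
    (h : ∀ q : ℂ[X], q.natDegree ≤ n - 1 → ∀ᵐ t : ℝ, t ∈ I →
      t ∈ derivDomain (mulNormPoly f q) I (2 * n - 1) ∧
        0 ≤ nthDeriv (mulNormPoly f q) I (2 * n - 1) t) (q : ℝ[X]) (hq : q.natDegree ≤ n - 1) :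
    Tone (2 * n - 1) (fun t => f t * (q ^ 2).eval t) I := by
  have hj := jetOn_jet hI h2 h3
  have hae := ae_regularAt_jet hI h3
  have hae' : ∀ᵐ t : ℝ, t ∈ I → RegularAt (2 * n - 3) (jetMul (jet (2 * n - 3) f) (q ^ 2)) t := by
    filter_upwards [hae] with t hr ht using (hr ht).mul hj ht _
  have h4 := h (q.map Complex.ofRealHom) (natDegree_map_le.trans hq)
  rw [mulNormPoly_map_ofReal, ← jetMul_jet_zero (N := 2 * n - 3)] at h4
  rw [two_mul_sub_one hn] at h4 ⊢
  rw [← jetMul_jet_zero (N := 2 * n - 3)]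
  refine hj.tone_of_ae_nonneg hI hc (monotoneOn_jet hI h3) hae
    (fun x => by rw [eval_pow]; positivity) ?_
  filter_upwards [hae', h4] with t hr ht4 ht
  rw [← ((hj.mul (q ^ 2)).mem_derivDomain hI (fun _ _ => rfl) hae' ht (hr ht)).2]
  exact (ht4 ht).2

end derivatives

end

/-! ### Rank one perturbations of diagonal matrices. -/

section

open Filter Topology Set Polynomial
open scoped ComplexConjugate ComplexOrder

section rankOne

variable {n : ℕ}

/-- An orthonormal system of eigenvectors `u k` of `diag(d) + v v*` with eigenvalues `μ k`, where the
diagonal entries are distinct and no coordinate of `v` vanishes. -/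
structure RankOneData (d : Fin n → ℝ) (v : Fin n → ℂ) (μ : Fin n → ℝ) (u : Fin n → Fin n → ℂ) :
    Prop where
  inj : Function.Injective d
  ne_zero : ∀ i, v i ≠ 0
  eigen : ∀ k i, (d i : ℂ) * u k i + v i * ∑ j, conj (v j) * u k j = (μ k : ℂ) * u k i
  orthonormal : ∀ k l, ∑ i, conj (u k i) * u l i = if k = l then 1 else 0

namespace RankOneData

variable {d : Fin n → ℝ} {v : Fin n → ℂ} {μ : Fin n → ℝ} {u : Fin n → Fin n → ℂ}

/-- Otherwise `u k` is an eigenvector of `diag(d)`. As the `d i` are distinct it is supported on one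
coordinate, where `v` does not vanish, so its product with `v` is non-zero. -/
theorem coeff_ne_zero (h : RankOneData d v μ u) (k : Fin n) : ∑ j, conj (v j) * u k j ≠ 0 := by
  intro hc
  have h1 : ∀ i, ((d i : ℂ) - (μ k : ℂ)) * u k i = 0 := fun i => by
    have := h.eigen k i
    rw [hc, mul_zero, add_zero] at this
    linear_combination this
  obtain ⟨i, hi⟩ : ∃ i, u k i ≠ 0 := by
    by_contra! h0
    have := h.orthonormal k k
    simp [h0] at this
  have hdi : d i = μ k := by
    have := (mul_eq_zero.1 (h1 i)).resolve_right hi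
    exact_mod_cast sub_eq_zero.1 this
  have h2 : ∀ j, j ≠ i → u k j = 0 := fun j hj => by
    refine (mul_eq_zero.1 (h1 j)).resolve_left fun h0 => hj (h.inj ?_)
    rw [hdi]
    exact_mod_cast sub_eq_zero.1 h0
  rw [Finset.sum_eq_single i (fun j _ hj => by rw [h2 j hj, mul_zero]) (by simp)] at hc
  rcases mul_eq_zero.1 hc with h3 | h3
  · exact h.ne_zero i (by simpa using h3)
  · exact hi h3

theorem ne (h : RankOneData d v μ u) (k i : Fin n) : μ k - d i ≠ 0 := by
  intro h0
  have h1 := h.eigen k i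
  rw [sub_eq_zero.1 h0, add_eq_left] at h1
  exact mul_ne_zero (h.ne_zero i) (h.coeff_ne_zero k) h1

theorem eq_div (h : RankOneData d v μ u) (k i : Fin n) :
    u k i = v i * (∑ j, conj (v j) * u k j) / ((μ k - d i : ℝ) : ℂ) := by
  have h0 : ((μ k - d i : ℝ) : ℂ) ≠ 0 := by exact_mod_cast h.ne k i
  rw [eq_div_iff h0, Complex.ofReal_sub]
  linear_combination -h.eigen k i

/-- The secular equation: insert the formula for `u k` into `v* u k` and cancel that factor. -/
theorem sum_div_eq_one (h : RankOneData d v μ u) (k : Fin n) :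
    ∑ i, Complex.normSq (v i) / (μ k - d i) = 1 := by
  have hc := h.coeff_ne_zero k
  set c := ∑ j, conj (v j) * u k j with hcdef
  have h1 : c = c * ((∑ i, Complex.normSq (v i) / (μ k - d i) : ℝ) : ℂ) := by
    conv_lhs => rw [hcdef]
    rw [Complex.ofReal_sum, Finset.mul_sum]
    refine Finset.sum_congr rfl fun i _ => ?_
    rw [h.eq_div k i, ← hcdef, Complex.ofReal_div, Complex.normSq_eq_conj_mul_self]
    ring
  have h2 : c * ((∑ i, Complex.normSq (v i) / (μ k - d i) : ℝ) : ℂ) = c * 1 := by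
    rw [← h1, mul_one]
  exact_mod_cast mul_left_cancel₀ hc h2

/-- By `eq_div` an eigenvector is determined by its eigenvalue up to a scalar, while distinct
members of the system are orthogonal. -/
theorem injective (h : RankOneData d v μ u) : Function.Injective μ := by
  intro k l hkl
  by_contra hne
  have h1 := h.orthonormal k l
  rw [if_neg hne] at h1
  have hk := h.coeff_ne_zero k
  have hl := h.coeff_ne_zero l
  have h2 : ∀ i, u l i * ∑ j, conj (v j) * u k j = u k i * ∑ j, conj (v j) * u l j := fun i => by
    rw [h.eq_div k i, h.eq_div l i, hkl]
    ring
  have h3 : (∑ i, conj (u k i) * u l i) * (∑ j, conj (v j) * u k j) =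
      (∑ i, conj (u k i) * u k i) * ∑ j, conj (v j) * u l j := by
    rw [Finset.sum_mul, Finset.sum_mul]
    exact Finset.sum_congr rfl fun i _ => by rw [mul_assoc, h2, mul_assoc]
  rw [h1, h.orthonormal, if_pos rfl, zero_mul, one_mul] at h3
  exact hl h3.symm

theorem normSq_mul_sum (h : RankOneData d v μ u) (k : Fin n) :
    Complex.normSq (∑ j, conj (v j) * u k j) *
      ∑ i, Complex.normSq (v i) / (μ k - d i) ^ 2 = 1 := by
  have h1 := h.orthonormal k k
  rw [if_pos rfl] at h1
  have h2 : ∑ i, Complex.normSq (u k i) = 1 := by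
    have : ((∑ i, Complex.normSq (u k i) : ℝ) : ℂ) = 1 := by
      rw [← h1, Complex.ofReal_sum]
      exact Finset.sum_congr rfl fun i _ => Complex.normSq_eq_conj_mul_self
    exact_mod_cast this
  rw [← h2, Finset.mul_sum]
  refine Finset.sum_congr rfl fun i _ => ?_
  rw [h.eq_div k i, Complex.normSq_div, Complex.normSq_mul, Complex.normSq_ofReal]
  ring

end RankOneData

/-- The characteristic polynomial of `diag(d) + v v*`, where `m i = |v i|²`. -/
noncomputable def secularPoly (d m : Fin n → ℝ) : ℝ[X] :=
  Lagrange.nodal Finset.univ d - ∑ i, C (m i) * Lagrange.nodal (Finset.univ.erase i) d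

theorem degree_nodal_sub_secularPoly_lt (d m μ : Fin n → ℝ) :
    (Lagrange.nodal Finset.univ μ - secularPoly d m).degree <
      (Finset.univ : Finset (Fin n)).card := by
  have hcard : ((Finset.univ : Finset (Fin n)).card : WithBot ℕ) = n := by simp
  rw [secularPoly, ← sub_add]
  refine (degree_add_le _ _).trans_lt (max_lt ?_ ?_)
  · have h1 : (Lagrange.nodal Finset.univ μ).degree = (Finset.univ : Finset (Fin n)).card :=
      Lagrange.degree_nodal
    rw [← h1]
    refine degree_sub_lt_left (by rw [h1, Lagrange.degree_nodal]) Lagrange.nodal_ne_zero ?_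
    rw [Lagrange.nodal_monic.leadingCoeff, Lagrange.nodal_monic.leadingCoeff]
  · refine (degree_sum_le _ _).trans_lt ?_
    rw [Finset.sup_lt_iff (by rw [hcard]; exact WithBot.bot_lt_coe n)]
    intro i _
    rw [← smul_eq_C_mul]
    refine (degree_smul_le _ _).trans_lt ?_
    rw [Lagrange.degree_nodal]
    exact_mod_cast Finset.card_erase_lt_of_mem (Finset.mem_univ i)

theorem nodal_eq_secularPoly {d m μ x : Fin n → ℝ} (hx : Function.Injective x)
    (h0 : ∀ k, (Lagrange.nodal Finset.univ μ).eval (x k) = (secularPoly d m).eval (x k)) :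
    Lagrange.nodal Finset.univ μ = secularPoly d m :=
  eq_of_degree_sub_lt_of_eval_index_eq (s := Finset.univ) (v := x) hx.injOn
    (degree_nodal_sub_secularPoly_lt d m μ) fun k _ => h0 k

theorem eval_nodal_erase_of_ne {d : Fin n → ℝ} {x : ℝ} {i : Fin n} (h : x - d i ≠ 0) :
    (Lagrange.nodal (Finset.univ.erase i) d).eval x =
      (Lagrange.nodal Finset.univ d).eval x / (x - d i) := by
  rw [Lagrange.nodal_eq_mul_nodal_erase (Finset.mem_univ i), eval_mul, eval_sub, eval_X, eval_C,
    mul_div_cancel_left₀ _ h]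

theorem eval_secularPoly_of_ne {d m : Fin n → ℝ} {x : ℝ} (h : ∀ i, x - d i ≠ 0) :
    (secularPoly d m).eval x =
      (Lagrange.nodal Finset.univ d).eval x * (1 - ∑ i, m i / (x - d i)) := by
  rw [secularPoly, eval_sub, eval_finsetSum, mul_sub, mul_one, Finset.mul_sum]
  congr 1
  refine Finset.sum_congr rfl fun i _ => ?_
  rw [eval_mul, eval_C, eval_nodal_erase_of_ne (h i)]
  ring

theorem eval_secularPoly_node {d m : Fin n → ℝ} (i : Fin n) :
    (secularPoly d m).eval (d i) = -(m i * ∏ j ∈ Finset.univ.erase i, (d i - d j)) := by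
  rw [secularPoly, eval_sub, Lagrange.eval_nodal_at_node (Finset.mem_univ i), eval_finsetSum,
    Finset.sum_eq_single i, eval_mul, eval_C, Lagrange.eval_nodal, zero_sub]
  · intro j _ hj
    rw [eval_mul, Lagrange.eval_nodal_at_node (Finset.mem_erase.2 ⟨hj.symm, Finset.mem_univ i⟩),
      mul_zero]
  · simp

/-- With `α = ∏ (X - d i)` the polynomial is `α (1 - ∑ m i / (x - d i))`; the second factor vanishes
at `x`, so only its derivative contributes. -/
theorem eval_derivative_secularPoly {d m : Fin n → ℝ} {x : ℝ} (h : ∀ i, x - d i ≠ 0)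
    (h1 : ∑ i, m i / (x - d i) = 1) :
    (derivative (secularPoly d m)).eval x =
      (Lagrange.nodal Finset.univ d).eval x * ∑ i, m i / (x - d i) ^ 2 := by
  set α := Lagrange.nodal Finset.univ d with hα
  have h2 : ∀ i, (derivative (Lagrange.nodal (Finset.univ.erase i) d)).eval x =
      (derivative α).eval x / (x - d i) - α.eval x / (x - d i) ^ 2 := by
    intro i
    have e : derivative α = Lagrange.nodal (Finset.univ.erase i) d +
        (X - C (d i)) * derivative (Lagrange.nodal (Finset.univ.erase i) d) := by
      rw [hα, Lagrange.nodal_eq_mul_nodal_erase (Finset.mem_univ i), derivative_mul]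
      simp
    have e2 := congrArg (eval x) e
    rw [eval_add, eval_mul, eval_sub, eval_X, eval_C, eval_nodal_erase_of_ne (h i), ← hα] at e2
    have := h i
    rw [e2]
    field_simp
    ring
  rw [secularPoly, derivative_sub, derivative_sum, eval_sub, eval_finsetSum, ← hα]
  have h3 : ∀ i, (derivative (C (m i) * Lagrange.nodal (Finset.univ.erase i) d)).eval x =
      (derivative α).eval x * (m i / (x - d i)) - α.eval x * (m i / (x - d i) ^ 2) := by
    intro i
    rw [derivative_C_mul, eval_mul, eval_C, h2]
    ring
  simp only [h3]
  rw [Finset.sum_sub_distrib, ← Finset.mul_sum, ← Finset.mul_sum, h1]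
  ring

/-- The polynomial `w* adj(X - diag(d)) v`. -/
noncomputable def rankOnePoly (d : Fin n → ℝ) (v w : Fin n → ℂ) : ℂ[X] :=
  ∑ i, C (conj (w i) * v i) * (Lagrange.nodal (Finset.univ.erase i) d).map Complex.ofRealHom

theorem natDegree_rankOnePoly_le (d : Fin n → ℝ) (v w : Fin n → ℂ) :
    (rankOnePoly d v w).natDegree ≤ n - 1 := by
  refine natDegree_sum_le_of_forall_le _ _ fun i _ => (natDegree_C_mul_le _ _).trans
    (natDegree_map_le.trans ?_)
  rw [Lagrange.natDegree_nodal, Finset.card_erase_of_mem (Finset.mem_univ i)]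
  simp

theorem eval_rankOnePoly (d : Fin n → ℝ) (v w : Fin n → ℂ) (x : ℝ) :
    (rankOnePoly d v w).eval (x : ℂ) =
      ∑ i, conj (w i) * v i * ((Lagrange.nodal (Finset.univ.erase i) d).eval x : ℝ) := by
  rw [rankOnePoly, eval_finsetSum]
  refine Finset.sum_congr rfl fun i _ => ?_
  rw [eval_mul, eval_C]
  congr 1
  exact eval_map_apply Complex.ofRealHom x

theorem eval_rankOnePoly_node (d : Fin n → ℝ) (v w : Fin n → ℂ) (i : Fin n) :
    (rankOnePoly d v w).eval (d i : ℂ) =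
      conj (w i) * v i * ((∏ j ∈ Finset.univ.erase i, (d i - d j) : ℝ) : ℂ) := by
  rw [eval_rankOnePoly, Finset.sum_eq_single i, Lagrange.eval_nodal]
  · intro j _ hj
    rw [Lagrange.eval_nodal_at_node (Finset.mem_erase.2 ⟨hj.symm, Finset.mem_univ i⟩)]
    simp
  · simp

namespace RankOneData

variable {d : Fin n → ℝ} {v : Fin n → ℂ} {μ : Fin n → ℝ} {u : Fin n → Fin n → ℂ}

theorem nodal_eq (h : RankOneData d v μ u) :
    Lagrange.nodal Finset.univ μ = secularPoly d fun i => Complex.normSq (v i) :=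
  nodal_eq_secularPoly h.injective fun k => by
    rw [eval_secularPoly_of_ne (h.ne k), h.sum_div_eq_one, sub_self, mul_zero,
      Lagrange.eval_nodal_at_node (Finset.mem_univ k)]

theorem injective_sumElim (h : RankOneData d v μ u) : Function.Injective (Sum.elim d μ) :=
  h.inj.sumElim h.injective fun i k hik => h.ne k i (sub_eq_zero.2 hik.symm)

/-- The quadratic form of `f(diag(d) + v v*) - f(diag(d))` is a divided difference. -/
theorem ddSum_eq (h : RankOneData d v μ u) (f : ℝ → ℝ) (w : Fin n → ℂ) :
    ddSum (mulNormPoly f (rankOnePoly d v w)) Finset.univ (Sum.elim d μ) =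
      ∑ k, f (μ k) * Complex.normSq (∑ i, conj (w i) * u k i) -
        ∑ i, f (d i) * Complex.normSq (w i) := by
  rw [ddSum_sumElim, add_comm, sub_eq_add_neg, ← Finset.sum_neg_distrib]
  have hα : ∀ x, ∏ j, (x - d j) = (Lagrange.nodal Finset.univ d).eval x := fun x => by
    rw [Lagrange.eval_nodal]
  have hβ : ∀ x, ∏ j, (x - μ j) = (Lagrange.nodal Finset.univ μ).eval x := fun x => by
    rw [Lagrange.eval_nodal]
  congr 1
  · refine Finset.sum_congr rfl fun k _ => ?_
    have hne := h.ne k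
    have hα0 : (Lagrange.nodal Finset.univ d).eval (μ k) ≠ 0 := by
      rw [← hα]
      exact Finset.prod_ne_zero_iff.2 fun i _ => hne i
    -- The product is the derivative of `∏ (X - μ j)` at `μ k`. With the normalization of `u k` it
    -- turns the weight of `μ k` into `|w* u k|²`.
    have h1 : ∏ j ∈ Finset.univ.erase k, (μ k - μ j) =
        (Lagrange.nodal Finset.univ d).eval (μ k) *
          ∑ i, Complex.normSq (v i) / (μ k - d i) ^ 2 := by
      rw [← eval_derivative_secularPoly hne (h.sum_div_eq_one k), ← h.nodal_eq,
        Lagrange.eval_nodal_derivative_eval_node_eq (Finset.mem_univ k), Lagrange.eval_nodal]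
    have hc := h.coeff_ne_zero k
    have h2 : (rankOnePoly d v w).eval (μ k : ℂ) * ∑ j, conj (v j) * u k j =
        ((Lagrange.nodal Finset.univ d).eval (μ k) : ℝ) * ∑ i, conj (w i) * u k i := by
      rw [eval_rankOnePoly, Finset.sum_mul, Finset.mul_sum]
      refine Finset.sum_congr rfl fun i _ => ?_
      rw [eval_nodal_erase_of_ne (hne i)]
      conv_rhs => rw [h.eq_div k i]
      push_cast
      ring
    have h3 := congrArg Complex.normSq h2
    rw [Complex.normSq_mul, Complex.normSq_mul, Complex.normSq_ofReal] at h3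
    have h4 := h.normSq_mul_sum k
    rw [mulNormPoly, normPoly_eval_re, h1, hα]
    set S := ∑ i, Complex.normSq (v i) / (μ k - d i) ^ 2
    set α := (Lagrange.nodal Finset.univ d).eval (μ k)
    set Q := Complex.normSq ((rankOnePoly d v w).eval (μ k : ℂ))
    set c := Complex.normSq (∑ j, conj (v j) * u k j)
    set T := Complex.normSq (∑ i, conj (w i) * u k i)
    have hS : S ≠ 0 := fun h0 => by rw [h0, mul_zero] at h4; exact zero_ne_one h4
    rw [div_eq_iff (mul_ne_zero (mul_ne_zero hα0 hS) hα0)]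
    have h5 : Q = α * α * T * S := by
      calc Q = Q * (c * S) := by rw [h4, mul_one]
        _ = Q * c * S := by ring
        _ = _ := by rw [h3]
    rw [h5]
    ring
  · refine Finset.sum_congr rfl fun i _ => ?_
    have hp : ∏ j ∈ Finset.univ.erase i, (d i - d j) ≠ 0 :=
      Finset.prod_ne_zero_iff.2 fun j hj =>
        sub_ne_zero.2 (h.inj.ne (Finset.ne_of_mem_erase hj).symm)
    have hv : Complex.normSq (v i) ≠ 0 := fun h0 => h.ne_zero i (Complex.normSq_eq_zero.1 h0)
    -- At `d i` the characteristic polynomial is `-|v i|² ∏ (d i - d j)`, which leaves `-f(d i) |w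
    -- i|²`.
    rw [hβ, h.nodal_eq, eval_secularPoly_node, mulNormPoly, normPoly_eval_re,
      eval_rankOnePoly_node, Complex.normSq_mul, Complex.normSq_mul, Complex.normSq_ofReal,
      Complex.normSq_conj]
    field_simp

end RankOneData

end rankOne

end

/-! ### Spectra and functional calculus of Hermitian matrices. -/

section

open Filter Topology Set Polynomial
open scoped ComplexConjugate ComplexOrder MatrixOrder

section hermitian

variable {n : ℕ}

theorem finite_spectrum_real {A : Matrix (Fin n) (Fin n) ℂ} (hA : A.IsHermitian) :
    (spectrum ℝ A).Finite := by
  rw [hA.spectrum_real_eq_range_eigenvalues]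
  exact Set.finite_range _

/-- `M` lies between the scalars given by the least eigenvalue of `A` and the greatest eigenvalue of
`B`, and `I` contains the interval between them. -/
theorem spectrum_subset_of_le_of_le {A M B : Matrix (Fin n) (Fin n) ℂ}  {I : Set ℝ}
    (hI : I.OrdConnected) (hA : A.IsHermitian) (hM : M.IsHermitian) (hB : B.IsHermitian)
    (hAI : spectrum ℝ A ⊆ I) (hBI : spectrum ℝ B ⊆ I) (hAM : (M - A).PosSemidef)
    (hMB : (B - M).PosSemidef) : spectrum ℝ M ⊆ I := by
  intro x hx
  have hne : ∀ {N : Matrix (Fin n) (Fin n) ℂ}, N.IsHermitian → (spectrum ℝ N).Nonempty := fun h => by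
    rw [hM.spectrum_real_eq_range_eigenvalues] at hx
    obtain ⟨i, -⟩ := hx
    rw [h.spectrum_real_eq_range_eigenvalues]
    exact ⟨_, i, rfl⟩
  obtain ⟨c, hc, hcA⟩ := (finite_spectrum_real hA).exists_minimal (hne hA)
  obtain ⟨e, he, heB⟩ := (finite_spectrum_real hB).exists_maximal (hne hB)
  have hcA' : ∀ y ∈ spectrum ℝ A, c ≤ y := fun y hy => (le_total c y).elim id (hcA hy)
  have heB' : ∀ y ∈ spectrum ℝ B, y ≤ e := fun y hy => (le_total y e).elim id (heB hy)
  have h1 := ((algebraMap_le_iff_le_spectrum (a := A) hA.isSelfAdjoint).2 hcA').trans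
    (Matrix.le_iff.2 hAM)
  have h2 := (Matrix.le_iff.2 hMB).trans
    ((le_algebraMap_iff_spectrum_le (a := B) hB.isSelfAdjoint).2 heB')
  exact hI.out (hAI hc) (hBI he) ⟨(algebraMap_le_iff_le_spectrum hM.isSelfAdjoint).1 h1 x hx,
    (le_algebraMap_iff_spectrum_le hM.isSelfAdjoint).1 h2 x hx⟩

theorem cfc_conj (f : ℝ → ℝ) (U : unitary (Matrix (Fin n) (Fin n) ℂ)) {A : Matrix (Fin n) (Fin n) ℂ}
    (hA : A.IsHermitian) :
    cfc f (Unitary.conjStarAlgAut ℝ _ U A) = Unitary.conjStarAlgAut ℝ _ U (cfc f A) := by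
  refine (StarAlgHomClass.map_cfc (S := ℝ) (Unitary.conjStarAlgAut ℝ _ U) f A
    ((finite_spectrum_real hA).continuousOn f) ?_
    hA.isSelfAdjoint ?_).symm
  · change Continuous fun M : Matrix (Fin n) (Fin n) ℂ =>
      (U : Matrix (Fin n) (Fin n) ℂ) * M * star (U : Matrix (Fin n) (Fin n) ℂ)
    fun_prop
  · exact hA.isSelfAdjoint.map _

theorem spectrum_diagonal_ofReal_subset (d : Fin n → ℝ) :
    spectrum ℝ (Matrix.diagonal fun i => (d i : ℂ)) ⊆ range d := by
  intro x hx
  have := spectrum.algebraMap_mem ℂ hx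
  rw [spectrum_diagonal] at this
  obtain ⟨i, hi⟩ := this
  exact ⟨i, by simpa using hi⟩

theorem isHermitian_diagonal_ofReal (d : Fin n → ℝ) :
    (Matrix.diagonal fun i => (d i : ℂ)).IsHermitian := by
  simp [Matrix.isHermitian_diagonal_iff, isSelfAdjoint_iff]

/-- On the finite spectrum `f` agrees with an interpolation polynomial, and polynomials act
entrywise on diagonal matrices. -/
theorem cfc_diagonal_ofReal (f : ℝ → ℝ) (d : Fin n → ℝ) :
    cfc f (Matrix.diagonal fun i => (d i : ℂ)) = Matrix.diagonal fun i => (f (d i) : ℂ) := by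
  have hd := isHermitian_diagonal_ofReal d
  set s := Finset.univ.image d
  set p := Lagrange.interpolate s id f
  have hp : ∀ i, p.eval (d i) = f (d i) := fun i => 
    Lagrange.eval_interpolate_at_node (s := s) f (Set.injOn_id _)
      (Finset.mem_image_of_mem d (Finset.mem_univ i))
  have h1 : cfc f (Matrix.diagonal fun i => (d i : ℂ)) =
      cfc p.eval (Matrix.diagonal fun i => (d i : ℂ)) :=
    cfc_congr fun x hx => by
      obtain ⟨i, rfl⟩ := spectrum_diagonal_ofReal_subset d hx
      exact (hp i).symm
  rw [h1, cfc_polynomial p _ hd.isSelfAdjoint]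
  have h2 : (Matrix.diagonal fun i => (d i : ℂ)) = Matrix.diagonalAlgHom ℝ (fun i => (d i : ℂ)) := rfl
  rw [h2, Polynomial.aeval_algHom_apply, Matrix.diagonalAlgHom_apply]
  congr 1
  ext i
  rw [Polynomial.aeval_pi_apply₂, ← hp i]
  exact Polynomial.aeval_ofReal p (d i)

open scoped Matrix.Norms.L2Operator in
theorem eventually_spectrum_subset_and_tendsto_cfc {X : Type*} {l : Filter X} {f : ℝ → ℝ}
    {I : Set ℝ} (hI : IsOpen I) (hf : ContinuousOn f I) {M : X → Matrix (Fin n) (Fin n) ℂ}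
    {A : Matrix (Fin n) (Fin n) ℂ} (hM : ∀ x, (M x).IsHermitian) (hA : A.IsHermitian)
    (hAI : spectrum ℝ A ⊆ I) (h : Tendsto M l (𝓝 A)) :
    (∀ᶠ x in l, spectrum ℝ (M x) ⊆ I) ∧ Tendsto (fun x => cfc f (M x)) l (𝓝 (cfc f A)) := by
  -- The spectra of nearby matrices stay in one compact neighbourhood of the spectrum of `A` inside
  -- `I`, as continuity of the functional calculus requires.
  obtain ⟨S, ⟨hS, hSc⟩, hSI⟩ := (finite_spectrum_real hA).isCompact.nhdsSet_basis_isCompact.mem_iff.1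
    (hI.mem_nhdsSet.2 hAI)
  have hev : ∀ᶠ x in l, spectrum ℝ (M x) ⊆ S := h.eventually
    (((upperHemicontinuous_spectrum ℝ (Matrix (Fin n) (Fin n) ℂ)).upperHemicontinuousAt A _ hS).mono
      fun _ => subset_of_mem_nhdsSet)
  exact ⟨hev.mono fun x hx => hx.trans hSI, h.cfc hSc f hev (.of_forall fun x => (hM x).isSelfAdjoint)
    (subset_of_mem_nhdsSet hS) hA.isSelfAdjoint (hf.mono hSI)⟩

theorem dotProduct_cfc_mulVec {B : Matrix (Fin n) (Fin n) ℂ} (hB : B.IsHermitian) (f : ℝ → ℝ)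
    (w : Fin n → ℂ) : star w ⬝ᵥ ((cfc f B).mulVec w) = ((∑ k, f (hB.eigenvalues k) *
      Complex.normSq (∑ i, conj (w i) * (hB.eigenvectorBasis k).ofLp i) : ℝ) : ℂ) := by
  rw [hB.cfc_eq f, Matrix.IsHermitian.cfc, Unitary.conjStarAlgAut_apply, ← Matrix.mulVec_mulVec,
    ← Matrix.mulVec_mulVec, Matrix.dotProduct_mulVec, dotProduct]
  push_cast
  refine Finset.sum_congr rfl fun k _ => ?_
  rw [Matrix.mulVec_diagonal, Complex.normSq_eq_conj_mul_self]
  have h1 : Matrix.vecMul (star w) (hB.eigenvectorUnitary : Matrix (Fin n) (Fin n) ℂ) k =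
      ∑ i, conj (w i) * (hB.eigenvectorBasis k).ofLp i := by
    simp [Matrix.vecMul, dotProduct, Matrix.IsHermitian.eigenvectorUnitary_apply]
  have h2 : Matrix.mulVec (star (hB.eigenvectorUnitary : Matrix (Fin n) (Fin n) ℂ)) w k =
      conj (∑ i, conj (w i) * (hB.eigenvectorBasis k).ofLp i) := by
    simp [Matrix.mulVec, dotProduct, Matrix.star_apply, Matrix.IsHermitian.eigenvectorUnitary_apply,
      mul_comm]
  rw [h1, h2]
  simp only [Function.comp_apply, Complex.coe_algebraMap]
  ring

theorem isHermitian_diagonal_add_vecMulVec (d : Fin n → ℝ) (v : Fin n → ℂ) :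
    (Matrix.diagonal (fun i => (d i : ℂ)) + Matrix.vecMulVec v (star v)).IsHermitian :=
  (isHermitian_diagonal_ofReal d).add (Matrix.posSemidef_vecMulVec_self_star v).isHermitian

theorem rankOneData_eigenvectorBasis {d : Fin n → ℝ} {v : Fin n → ℂ} (hd : Function.Injective d)
    (hv : ∀ i, v i ≠ 0) : RankOneData d v (isHermitian_diagonal_add_vecMulVec d v).eigenvalues
      fun k i => ((isHermitian_diagonal_add_vecMulVec d v).eigenvectorBasis k).ofLp i where
  inj := hd
  ne_zero := hv
  eigen k i := by
    have h := congrFun ((isHermitian_diagonal_add_vecMulVec d v).mulVec_eigenvectorBasis k) i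
    simpa [Matrix.add_mulVec, Matrix.mulVec_diagonal, Matrix.vecMulVec_mulVec, dotProduct, mul_comm]
      using h
  orthonormal k l := by
    have h := orthonormal_iff_ite.1
      (isHermitian_diagonal_add_vecMulVec d v).eigenvectorBasis.orthonormal k l
    rw [← h, EuclideanSpace.inner_eq_star_dotProduct]
    simp [dotProduct, mul_comm]

theorem dotProduct_cfc_sub_cfc_mulVec {d : Fin n → ℝ} {v : Fin n → ℂ} (hd : Function.Injective d)
    (hv : ∀ i, v i ≠ 0) (f : ℝ → ℝ) (w : Fin n → ℂ) :
    star w ⬝ᵥ ((cfc f (Matrix.diagonal (fun i => (d i : ℂ)) + Matrix.vecMulVec v (star v)) -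
      cfc f (Matrix.diagonal fun i => (d i : ℂ))).mulVec w) =
    ((ddSum (mulNormPoly f (rankOnePoly d v w)) Finset.univ
      (Sum.elim d (isHermitian_diagonal_add_vecMulVec d v).eigenvalues) : ℝ) : ℂ) := by
  rw [(rankOneData_eigenvectorBasis hd hv).ddSum_eq, Matrix.sub_mulVec, dotProduct_sub,
    dotProduct_cfc_mulVec (isHermitian_diagonal_add_vecMulVec d v), cfc_diagonal_ofReal,
    Complex.ofReal_sub]
  congr 1
  push_cast
  refine Finset.sum_congr rfl fun i _ => ?_
  rw [Matrix.mulVec_diagonal, Complex.normSq_eq_conj_mul_self]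
  simp only [Pi.star_apply, RCLike.star_def]
  ring

theorem posSemidef_cfc_sub_cfc_iff {A B : Matrix (Fin n) (Fin n) ℂ} (f : ℝ → ℝ) :
    (cfc f B - cfc f A).PosSemidef ↔ ∀ w, 0 ≤ star w ⬝ᵥ ((cfc f B - cfc f A).mulVec w) :=
  ⟨fun h => h.dotProduct_mulVec_nonneg, fun h => .of_dotProduct_mulVec_nonneg
    ((cfc_predicate f B).sub (cfc_predicate f A)) h⟩

end hermitian

end

/-! ### From divided differences to matrix monotonicity. -/

section

open Filter Topology Set Polynomial
open scoped ComplexConjugate ComplexOrder MatrixOrder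

section monotone

variable {n : ℕ} {f : ℝ → ℝ} {I : Set ℝ}

/-- Rank one perturbations in general position: the quadratic form is a divided difference. -/
theorem posSemidef_cfc_sub_cfc_of_generic (hn : 0 < n)
    (h : ∀ q : ℂ[X], q.natDegree ≤ n - 1 → Tone (2 * n - 1) (mulNormPoly f q) I)
    {d : Fin n → ℝ} {v : Fin n → ℂ} (hd : Function.Injective d) (hv : ∀ i, v i ≠ 0)
    (hdI : ∀ i, d i ∈ I)
    (hI : spectrum ℝ (Matrix.diagonal (fun i => (d i : ℂ)) + Matrix.vecMulVec v (star v)) ⊆ I) :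
    (cfc f (Matrix.diagonal (fun i => (d i : ℂ)) + Matrix.vecMulVec v (star v)) -
      cfc f (Matrix.diagonal fun i => (d i : ℂ))).PosSemidef := by
  refine (posSemidef_cfc_sub_cfc_iff f).2 fun w => ?_
  rw [dotProduct_cfc_sub_cfc_mulVec hd hv, Complex.zero_le_real]
  refine (h _ (natDegree_rankOnePoly_le d v w)).ddSum_nonneg
    ((rankOneData_eigenvectorBasis hd hv).injective_sumElim.injOn) ?_ ?_
  · rintro (i | i) -
    · exact hdI i
    · exact hI ((isHermitian_diagonal_add_vecMulVec d v).eigenvalues_mem_spectrum_real i)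
  · simp; omega

theorem eventually_add_mul_ne (c e s : ℝ) (h : s ≠ 0) : ∀ᶠ ε in 𝓝[≠] (0 : ℝ), c + ε * s ≠ e := by
  have : ∀ᶠ ε in 𝓝[≠] (0 : ℝ), ε ≠ (e - c) / s := by
    rcases eq_or_ne 0 ((e - c) / s) with h0 | h0
    · rw [← h0]; exact self_mem_nhdsWithin
    · exact mem_nhdsWithin_of_mem_nhds (isOpen_ne.mem_nhds h0)
  filter_upwards [this] with ε hε h0
  exact hε (by rw [← h0]; field_simp; ring)

theorem posSemidef_cfc_sub_cfc_of_rankOne (hn : 0 < n) (hI : IsOpen I) (hf : ContinuousOn f I)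
    (h : ∀ q : ℂ[X], q.natDegree ≤ n - 1 → Tone (2 * n - 1) (mulNormPoly f q) I)
    {d : Fin n → ℝ} {v : Fin n → ℂ} (hdI : ∀ i, d i ∈ I)
    (hBI : spectrum ℝ (Matrix.diagonal (fun i => (d i : ℂ)) + Matrix.vecMulVec v (star v)) ⊆ I) :
    (cfc f (Matrix.diagonal (fun i => (d i : ℂ)) + Matrix.vecMulVec v (star v)) -
      cfc f (Matrix.diagonal fun i => (d i : ℂ))).PosSemidef := by
  -- Different speeds separate equal diagonal entries, and a common shift makes every coordinate of
  -- `v` non-zero; both hold for all small `ε ≠ 0`.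
  set D : ℝ → Fin n → ℝ := fun ε i => d i + ε * (i : ℝ) with hD
  set V : ℝ → Fin n → ℂ := fun ε i => v i + (ε : ℂ) with hV
  have hDA : Continuous fun ε => Matrix.diagonal fun i => (D ε i : ℂ) := by
    refine Continuous.matrix_diagonal ?_
    simp only [hD]
    fun_prop
  have hDB : Continuous fun ε => Matrix.diagonal (fun i => (D ε i : ℂ)) +
      Matrix.vecMulVec (V ε) (star (V ε)) := by
    refine hDA.add (Continuous.matrix_vecMulVec ?_ ?_) <;> simp only [hV] <;> fun_prop
  have hD0 : D 0 = d := by ext; simp [hD]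
  have hV0 : V 0 = v := by ext; simp [hV]
  have hA0 := (hDA.tendsto 0).mono_left (nhdsWithin_le_nhds (s := {0}ᶜ))
  have hB0 := (hDB.tendsto 0).mono_left (nhdsWithin_le_nhds (s := {0}ᶜ))
  rw [hD0] at hA0
  rw [hD0, hV0] at hB0
  obtain ⟨hA1, hA2⟩ := eventually_spectrum_subset_and_tendsto_cfc hI hf
    (fun ε => isHermitian_diagonal_ofReal (D ε)) (isHermitian_diagonal_ofReal d)
    ((spectrum_diagonal_ofReal_subset d).trans (range_subset_iff.2 hdI)) hA0
  obtain ⟨hB1, hB2⟩ := eventually_spectrum_subset_and_tendsto_cfc hI hf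
    (fun ε => isHermitian_diagonal_add_vecMulVec (D ε) (V ε)) (isHermitian_diagonal_add_vecMulVec d v)
    hBI hB0
  have hDI : ∀ᶠ ε in 𝓝[≠] (0 : ℝ), ∀ i, D ε i ∈ I := eventually_all.2 fun i => by
    have : Tendsto (fun ε => D ε i) (𝓝 0) (𝓝 (d i)) := by
      have : Continuous fun ε => D ε i := by simp only [hD]; fun_prop
      simpa [hD] using this.tendsto 0
    exact (this.mono_left nhdsWithin_le_nhds).eventually (hI.mem_nhds (hdI i))
  have hinj : ∀ᶠ ε in 𝓝[≠] (0 : ℝ), ∀ i j, i ≠ j → D ε i ≠ D ε j :=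
    eventually_all.2 fun i => eventually_all.2 fun j => by
      by_cases hij : i = j
      · exact .of_forall fun _ h0 => absurd hij h0
      · have hs : ((i : ℝ) - (j : ℝ)) ≠ 0 :=
          sub_ne_zero.2 fun h0 => hij (Fin.ext (by exact_mod_cast h0))
        filter_upwards [eventually_add_mul_ne (d i) (d j) _ hs] with ε hε _ h0
        exact hε (by simp only [hD] at h0; linear_combination h0)
  have hV1 : ∀ᶠ ε in 𝓝[≠] (0 : ℝ), ∀ i, V ε i ≠ 0 := eventually_all.2 fun i => by
    filter_upwards [eventually_add_mul_ne (v i).re 0 1 one_ne_zero] with ε hε h0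
    exact hε (by simpa [hV] using congrArg Complex.re h0)
  refine (posSemidef_cfc_sub_cfc_iff f).2 fun w => ?_
  have hcont : Continuous fun M : Matrix (Fin n) (Fin n) ℂ => star w ⬝ᵥ M.mulVec w := by fun_prop
  refine ge_of_tendsto ((hcont.tendsto _).comp (hB2.sub hA2)) ?_
  filter_upwards [hB1, hDI, hinj, hV1] with ε h1 h2 h3 h4
  exact (posSemidef_cfc_sub_cfc_iff f).1 (posSemidef_cfc_sub_cfc_of_generic hn h
    (fun i j hij => by_contra fun h0 => h3 i j h0 hij) h4 h2 h1) w

theorem posSemidef_cfc_add_vecMulVec_sub_cfc (hn : 0 < n) (hI : IsOpen I) (hf : ContinuousOn f I)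
    (h : ∀ q : ℂ[X], q.natDegree ≤ n - 1 → Tone (2 * n - 1) (mulNormPoly f q) I)
    {A : Matrix (Fin n) (Fin n) ℂ} (hA : A.IsHermitian) {v : Fin n → ℂ} (hAI : spectrum ℝ A ⊆ I)
    (hBI : spectrum ℝ (A + Matrix.vecMulVec v (star v)) ⊆ I) :
    (cfc f (A + Matrix.vecMulVec v (star v)) - cfc f A).PosSemidef := by
  set U := hA.eigenvectorUnitary
  set d := hA.eigenvalues
  set φ := Unitary.conjStarAlgAut ℝ (Matrix (Fin n) (Fin n) ℂ) U with hφ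
  have hφa : ∀ M, φ M = (U : Matrix (Fin n) (Fin n) ℂ) * M * star (U : Matrix (Fin n) (Fin n) ℂ) :=
    fun M => Unitary.conjStarAlgAut_apply ..
  set v' := (star (U : Matrix (Fin n) (Fin n) ℂ)).mulVec v with hv'
  have hUv : (U : Matrix (Fin n) (Fin n) ℂ).mulVec v' = v := by
    rw [hv', Matrix.mulVec_mulVec, Unitary.mul_star_self_of_mem U.2, Matrix.one_mulVec]
  have hAd : A = φ (Matrix.diagonal fun i => (d i : ℂ)) := by
    rw [hφa]
    exact hA.spectral_theorem.trans (Unitary.conjStarAlgAut_apply ..)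
  have hvv : Matrix.vecMulVec v (star v) = φ (Matrix.vecMulVec v' (star v')) := by
    rw [hφa, Matrix.mul_vecMulVec, Matrix.vecMulVec_mul, hUv, Matrix.star_eq_conjTranspose,
      ← Matrix.star_mulVec, hUv]
  have hB : A + Matrix.vecMulVec v (star v) =
      φ (Matrix.diagonal (fun i => (d i : ℂ)) + Matrix.vecMulVec v' (star v')) := by
    rw [map_add, ← hAd, ← hvv]
  have hdI : ∀ i, d i ∈ I := fun i => hAI (hA.eigenvalues_mem_spectrum_real i)
  rw [hB] at hBI ⊢
  rw [hφ, AlgEquiv.spectrum_eq] at hBI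
  have key := posSemidef_cfc_sub_cfc_of_rankOne hn hI hf h hdI hBI
  rw [hφ, cfc_conj f U (isHermitian_diagonal_add_vecMulVec d v'), hAd,
    cfc_conj f U (isHermitian_diagonal_ofReal d), ← map_sub, ← hφ, hφa]
  exact key.mul_mul_conjTranspose_same _

/-- Rank one terms are added one at a time; each intermediate matrix lies between the two ends, so
its spectrum stays in `I`. -/
theorem posSemidef_cfc_add_sum_sub_cfc (hn : 0 < n) (hI : IsOpen I) (hc : I.OrdConnected)
    (hf : ContinuousOn f I)
    (h : ∀ q : ℂ[X], q.natDegree ≤ n - 1 → Tone (2 * n - 1) (mulNormPoly f q) I) (m : ℕ) :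
    ∀ (v : Fin m → Fin n → ℂ) (A : Matrix (Fin n) (Fin n) ℂ), A.IsHermitian → spectrum ℝ A ⊆ I →
      spectrum ℝ (A + ∑ k, Matrix.vecMulVec (v k) (star (v k))) ⊆ I →
      (cfc f (A + ∑ k, Matrix.vecMulVec (v k) (star (v k))) - cfc f A).PosSemidef := by
  induction m with
  | zero =>
    intro v A _ _ _
    simpa using Matrix.PosSemidef.zero
  | succ m ih =>
    intro v A hA hAI hBI
    have hv := Matrix.posSemidef_vecMulVec_self_star (v 0)
    have hsum : (∑ k : Fin m, Matrix.vecMulVec (v k.succ) (star (v k.succ))).PosSemidef :=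
      Matrix.posSemidef_sum _ fun k _ => Matrix.posSemidef_vecMulVec_self_star _
    rw [Fin.sum_univ_succ, ← add_assoc] at hBI ⊢
    have hA1 := hA.add hv.isHermitian
    have hA1I : spectrum ℝ (A + Matrix.vecMulVec (v 0) (star (v 0))) ⊆ I :=
      spectrum_subset_of_le_of_le hc hA hA1 (hA1.add hsum.isHermitian) hAI hBI
        (by rwa [add_sub_cancel_left]) (by rwa [add_sub_cancel_left])
    have h1 := posSemidef_cfc_add_vecMulVec_sub_cfc hn hI hf h hA hAI hA1I
    have h2 := ih (fun k => v k.succ) _ hA1 hA1I hBI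
    simpa using h2.add h1

theorem matrixMonotoneOn_of_tone (hn : 0 < n) (hI : IsOpen I) (hc : I.OrdConnected)
    (hf : ContinuousOn f I)
    (h : ∀ q : ℂ[X], q.natDegree ≤ n - 1 → Tone (2 * n - 1) (mulNormPoly f q) I) :
    MatrixMonotoneOn n f I := by
  intro A B hA hB hAI hBI hAB
  rw [← hA.cfc_eq, ← hB.cfc_eq]
  obtain ⟨m, v, hv⟩ := Matrix.posSemidef_iff_eq_sum_vecMulVec.1 hAB
  obtain rfl : B = A + ∑ k, Matrix.vecMulVec (v k) (star (v k)) := by rw [← hv]; abel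
  exact posSemidef_cfc_add_sum_sub_cfc hn hI hc hf h m v A hA hAI hBI

end monotone

end

/-! ### Realizing interlacing nodes as spectra. -/

section

open Filter Topology Set Polynomial
open scoped ComplexConjugate ComplexOrder

section realization

variable {n : ℕ} {d b : Fin n → ℝ}

/-- The squared coordinates of the vector `v` for which `diag(d) + v v*` has the eigenvalues `b`. -/
noncomputable def rankOneWeight (d b : Fin n → ℝ) (i : Fin n) : ℝ :=
  (b i - d i) * ∏ k ∈ Finset.univ.erase i, (d i - b k) / (d i - d k)

theorem Interlacing.strictMono_left (h : Interlacing d b) : StrictMono d := fun i j hij =>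
  (h.lt i).trans (h.lt_of_lt i j hij)

theorem Interlacing.rankOneWeight_pos (h : Interlacing d b) (i : Fin n) :
    0 < rankOneWeight d b i := by
  refine mul_pos (sub_pos.2 (h.lt i)) (Finset.prod_pos fun k hk => ?_)
  rcases lt_or_gt_of_ne (Finset.ne_of_mem_erase hk) with hki | hik
  · exact div_pos (sub_pos.2 (h.lt_of_lt k i hki)) (sub_pos.2 (h.strictMono_left hki))
  · exact div_pos_of_neg_of_neg (sub_neg.2 ((h.strictMono_left hik).trans (h.lt k)))
      (sub_neg.2 (h.strictMono_left hik))

/-- The weights are the solution of `-m i ∏ (d i - d k) = ∏ (d i - b k)`, so the two monic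
polynomials agree at the `n` points `d i`. -/
theorem nodal_eq_secularPoly_rankOneWeight (hd : Function.Injective d) :
    Lagrange.nodal Finset.univ b = secularPoly d (rankOneWeight d b) := by
  refine nodal_eq_secularPoly hd fun i => ?_
  have h0 : ∏ j ∈ Finset.univ.erase i, (d i - d j) ≠ 0 := Finset.prod_ne_zero_iff.2 fun j hj =>
    sub_ne_zero.2 fun h => Finset.ne_of_mem_erase hj (hd h).symm
  rw [eval_secularPoly_node, Lagrange.eval_nodal, rankOneWeight, Finset.prod_div_distrib, mul_assoc,
    div_mul_cancel₀ _ h0, ← Finset.mul_prod_erase _ _ (Finset.mem_univ i)]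
  ring

/-- Both node sets have `2n` elements, so inclusion gives equality; the eigenvalues need not be put
in order. -/
theorem ddSum_sumElim_congr_of_range_subset (g : ℝ → ℝ) {μ : Fin n → ℝ}
    (hμ : Function.Injective (Sum.elim d μ)) (hb : Function.Injective (Sum.elim d b))
    (h : ∀ k, ∃ j, μ k = b j) :
    ddSum g Finset.univ (Sum.elim d μ) = ddSum g Finset.univ (Sum.elim d b) := by
  rw [← ddSum_eq_id _ _ _ hμ.injOn, ← ddSum_eq_id _ _ _ hb.injOn]
  congr 1
  refine Finset.eq_of_subset_of_card_le ?_ ?_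
  · intro y hy
    obtain ⟨i | k, -, rfl⟩ := Finset.mem_image.1 hy
    · exact Finset.mem_image.2 ⟨Sum.inl i, Finset.mem_univ _, rfl⟩
    · obtain ⟨j, hj⟩ := h k
      exact Finset.mem_image.2 ⟨Sum.inr j, Finset.mem_univ _, hj.symm⟩
  · rw [Finset.card_image_of_injective _ hμ, Finset.card_image_of_injective _ hb]

theorem Interlacing.injective_sumElim (h : Interlacing d b) : Function.Injective (Sum.elim d b) := by
  have hb : StrictMono b := fun i j hij => (h.lt_of_lt i j hij).trans (h.lt j)
  refine Function.Injective.sumElim h.strictMono_left.injective hb.injective fun i j => ?_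
  rcases lt_or_ge j i with hji | hij
  · exact (h.lt_of_lt j i hji).ne'
  · exact ((h.lt i).trans_le (hb.monotone hij)).ne

/-- Any interlacing nodes are the spectra of a diagonal matrix and of a rank one perturbation. -/
theorem MatrixMonotoneOn.ddSum_nonneg (hn : 0 < n) {f : ℝ → ℝ} {I : Set ℝ}
    (hf : MatrixMonotoneOn n f I) (h : Interlacing d b) (hd : ∀ i, d i ∈ I) (hb : ∀ i, b i ∈ I)
    (q : ℝ[X]) (hq : q.natDegree ≤ n - 1) :
    0 ≤ ddSum (fun t => f t * (q ^ 2).eval t) Finset.univ (Sum.elim d b) := by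
  have hinj := h.strictMono_left.injective
  set v : Fin n → ℂ := fun i => (√(rankOneWeight d b i) : ℂ) with hv
  have hr : ∀ i, √(rankOneWeight d b i) ≠ 0 := fun i =>
    (Real.sqrt_pos.2 (h.rankOneWeight_pos i)).ne'
  have hv0 : ∀ i, v i ≠ 0 := fun i => Complex.ofReal_ne_zero.2 (hr i)
  have hB := isHermitian_diagonal_add_vecMulVec d v
  have hdata := rankOneData_eigenvectorBasis hinj hv0
  have hnorm : (fun i => Complex.normSq (v i)) = rankOneWeight d b := by
    ext i
    rw [hv, Complex.normSq_ofReal, Real.mul_self_sqrt (h.rankOneWeight_pos i).le]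
  have hnodal := hdata.nodal_eq
  rw [hnorm, ← nodal_eq_secularPoly_rankOneWeight hinj] at hnodal
  have hμ : ∀ k, ∃ j, hB.eigenvalues k = b j := fun k => by
    have h0 := congrArg (eval (hB.eigenvalues k)) hnodal
    rw [Lagrange.eval_nodal_at_node (Finset.mem_univ k), Lagrange.eval_nodal] at h0
    obtain ⟨j, -, hj⟩ := Finset.prod_eq_zero_iff.1 h0.symm
    exact ⟨j, sub_eq_zero.1 hj⟩
  have hBI : spectrum ℝ (Matrix.diagonal (fun i => (d i : ℂ)) + Matrix.vecMulVec v (star v)) ⊆ I := by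
    rw [hB.spectrum_real_eq_range_eigenvalues]
    rintro _ ⟨k, rfl⟩
    obtain ⟨j, hj⟩ := hμ k
    rw [hj]
    exact hb j
  obtain ⟨c, hc⟩ := exists_eq_sum_lagrange hn hinj q hq
  -- Dividing the Lagrange coefficients of `q` by the coordinates of `v` gives the vector `w` whose
  -- associated polynomial is `q`.
  have hpoly : rankOnePoly d v (fun i => ((c i / √(rankOneWeight d b i) : ℝ) : ℂ)) =
      q.map Complex.ofRealHom := by
    rw [hc, rankOnePoly, Polynomial.map_sum]
    refine Finset.sum_congr rfl fun i _ => ?_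
    rw [Polynomial.map_mul, map_C, Complex.conj_ofReal, hv, ← Complex.ofReal_mul,
      div_mul_cancel₀ _ (hr i), Lagrange.nodal]
    rfl
  have hA := isHermitian_diagonal_ofReal d
  have hpsd := hf _ _ hA hB ((spectrum_diagonal_ofReal_subset d).trans (range_subset_iff.2 hd)) hBI
    (by simpa using Matrix.posSemidef_vecMulVec_self_star v)
  rw [← hA.cfc_eq, ← hB.cfc_eq] at hpsd
  have := hpsd.dotProduct_mulVec_nonneg (fun i => ((c i / √(rankOneWeight d b i) : ℝ) : ℂ))
  rwa [dotProduct_cfc_sub_cfc_mulVec hinj hv0, Complex.zero_le_real, hpoly, mulNormPoly_map_ofReal,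
    ddSum_sumElim_congr_of_range_subset _ hdata.injective_sumElim h.injective_sumElim hμ] at this

end realization

section equivalences

variable {n : ℕ} {f : ℝ → ℝ} {I : Set ℝ}

theorem Tone.add {m : ℕ} {f g : ℝ → ℝ} (hf : Tone m f I) (hg : Tone m g I) :
    Tone m (fun t => f t + g t) I := fun s hs hc => by
  have := ddSum_add f g s id
  rw [this]
  exact add_nonneg (hf s hs hc) (hg s hs hc)

theorem tone_mulNormPoly {m k : ℕ}
    (h : ∀ q : ℝ[X], q.natDegree ≤ k → Tone m (fun t => f t * (q ^ 2).eval t) I) (q : ℂ[X])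
    (hq : q.natDegree ≤ k) : Tone m (mulNormPoly f q) I := by
  obtain ⟨q₁, q₂, h₁, h₂, he⟩ := exists_normPoly_eq_sq_add_sq q hq
  refine ((h q₁ h₁).add (h q₂ h₂)).congr fun t _ => ?_
  rw [mulNormPoly, he]
  ring

theorem tone_iff_dividedDiff_nonneg_of_eq_succ {m k : ℕ} (hk : k = m + 1) :
    Tone m f I ↔ ∀ x : Fin k → ℝ, StrictMono x → (∀ i, x i ∈ I) →
      0 ≤ dividedDiff f (List.ofFn x) := by
  subst hk
  exact tone_iff_dividedDiff_nonneg

theorem tone_sq_iff_matrixMonotoneOn (hn : 2 ≤ n) (hI : IsOpen I) (hc : I.OrdConnected) :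
    (∀ q : ℝ[X], q.natDegree ≤ n - 1 → Tone (2 * n - 1) (fun t => f t * (q ^ 2).eval t) I) ↔
      MatrixMonotoneOn n f I := by
  constructor
  · intro h
    have hf : Tone (2 * n - 3 + 2) f I := by
      have := h 1 (by simp)
      rw [show 2 * n - 3 + 2 = 2 * n - 1 by omega]
      simpa using this
    exact matrixMonotoneOn_of_tone (by omega) hI hc
      (hf.contDiffOn_and_convexOn hI hc).1.continuousOn (tone_mulNormPoly h)
  · intro h q hq
    rw [tone_iff_dividedDiff_nonneg_of_eq_succ (k := 2 * n) (by omega)]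
    intro x hx hxI
    rw [dividedDiff_ofFn_eq_ddSum _ hx.injective, ddSum_univ_eq_ddSum_even_odd]
    exact h.ddSum_nonneg (by omega) (interlacing_of_strictMono hx) (fun _ => hxI _)
      (fun _ => hxI _) q hq

theorem forall_dividedDiff_mulNormPoly_pairs_nonneg_iff {k : ℕ} {x : Fin n → ℝ}
    (hx : Function.Injective x) (hf : ∀ i, ContDiffAt ℝ 1 f (x i)) :
    (∀ q : ℂ[X], q.natDegree ≤ k →
      0 ≤ dividedDiff (mulNormPoly f q) ((List.ofFn x).flatMap fun t => [t, t])) ↔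
    ∀ q : ℝ[X], q.natDegree ≤ k → 0 ≤ dividedDiff (fun t => f t * (q ^ 2).eval t)
      ((List.ofFn x).flatMap fun t => [t, t]) := by
  have hmem : ∀ c ∈ (List.ofFn x).flatMap fun t => [t, t], ContDiffAt ℝ 1 f c := by
    intro c hc
    obtain ⟨i, rfl⟩ : ∃ i, x i = c := by simpa [List.mem_ofFn] using hc
    exact hf i
  exact forall_dividedDiff_mulNormPoly_nonneg_iff fun p q =>
    dividedDiff_add (count_flatMap_pair_le (List.nodup_ofFn.2 hx))
      (fun c hc => contDiffAt_mul_eval (hmem c hc) p) fun c hc => contDiffAt_mul_eval (hmem c hc) q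

end equivalences

end

/-! ### The equivalences. -/

theorem mainTheorem4 (n : ℕ) (hn : 2 ≤ n) (a b : EReal) (f : ℝ → ℝ) :
    List.TFAE [
      MatrixMonotoneOn n f (openInterval a b),
      ∀ x : Fin (2 * n) → ℝ, StrictMono x → (∀ i, x i ∈ openInterval a b) →
        ∀ q : Polynomial ℝ, q.natDegree ≤ n - 1 →
          0 ≤ dividedDiff (fun t => f t * (q ^ 2).eval t) (List.ofFn x),
      ∀ x : Fin (2 * n) → ℝ, StrictMono x → (∀ i, x i ∈ openInterval a b) →
        ∀ q : Polynomial ℂ, q.natDegree ≤ n - 1 →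
          0 ≤ dividedDiff (mulNormPoly f q) (List.ofFn x),
      ContDiffOn ℝ 1 f (openInterval a b) ∧
        ∀ x : Fin n → ℝ, StrictMono x → (∀ i, x i ∈ openInterval a b) →
          ∀ q : Polynomial ℂ, q.natDegree ≤ n - 1 →
            0 ≤ dividedDiff (mulNormPoly f q) ((List.ofFn x).flatMap fun t => [t, t]),
      ContDiffOn ℝ 1 f (openInterval a b) ∧
        ∀ x : Fin n → ℝ, StrictMono x → (∀ i, x i ∈ openInterval a b) →
          (loewnerMatrix f x).PosSemidef,
      ContDiffOn ℝ 1 f (openInterval a b) ∧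
        ∀ x : Fin n → ℝ, StrictMono x → (∀ i, x i ∈ openInterval a b) →
          (extendedLoewnerMatrix f x).PosSemidef,
      ContDiffOn ℝ ((2 * n - 3 : ℕ) : WithTop ℕ∞) f (openInterval a b) ∧
        ConvexOn ℝ (openInterval a b) (iteratedDeriv (2 * n - 3) f) ∧
        ∀ q : Polynomial ℂ, q.natDegree ≤ n - 1 →
          ∀ᵐ t : ℝ, t ∈ openInterval a b →
            t ∈ derivDomain (mulNormPoly f q) (openInterval a b) (2 * n - 1) ∧
              0 ≤ nthDeriv (mulNormPoly f q) (openInterval a b) (2 * n - 1) t,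
      ContDiffOn ℝ ((2 * n - 3 : ℕ) : WithTop ℕ∞) f (openInterval a b) ∧
        ConvexOn ℝ (openInterval a b) (iteratedDeriv (2 * n - 3) f) ∧
        ∀ᵐ t : ℝ, t ∈ openInterval a b →
          t ∈ derivDomain f (openInterval a b) (2 * n - 1) ∧
            (dobschMatrix n f (openInterval a b) t).PosSemidef] := by
  have hI := isOpen_openInterval a b
  have hc := ordConnected_openInterval a b
  set I := openInterval a b
  have htone : (∀ q : Polynomial ℝ, q.natDegree ≤ n - 1 →
      Tone (2 * n - 1) (fun t => f t * (q ^ 2).eval t) I) ↔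
      ∀ x : Fin (2 * n) → ℝ, StrictMono x → (∀ i, x i ∈ I) →
        ∀ q : Polynomial ℝ, q.natDegree ≤ n - 1 →
          0 ≤ dividedDiff (fun t => f t * (q ^ 2).eval t) (List.ofFn x) := by
    simp only [tone_iff_dividedDiff_nonneg_of_eq_succ (show 2 * n = 2 * n - 1 + 1 by omega)]
    exact ⟨fun h x hx hxI q hq => h q hq x hx hxI, fun h q hq x hx hxI => h x hx hxI q hq⟩
  have hAt : ContDiffOn ℝ 1 f I → ∀ t ∈ I, ContDiffAt ℝ 1 f t := fun h t ht =>
    h.contDiffAt (hI.mem_nhds ht)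
  tfae_have 1 ↔ 2 := (tone_sq_iff_matrixMonotoneOn hn hI hc).symm.trans htone
  tfae_have 2 ↔ 3 := by
    refine forall₃_congr fun x hx hxI => (forall_dividedDiff_mulNormPoly_nonneg_iff fun p q => ?_).symm
    simp only [dividedDiff_ofFn_eq_ddSum _ hx.injective]
    exact ddSum_add _ _ _ _
  tfae_have 5 ↔ 4 := and_congr_right fun hf => forall₃_congr fun x hx hxI =>
    (loewnerMatrix_posSemidef_iff (by omega) hx.injective fun i => hAt hf _ (hxI i)).trans
      (forall_dividedDiff_mulNormPoly_pairs_nonneg_iff hx.injective fun i => hAt hf _ (hxI i)).symm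
  tfae_have 6 ↔ 4 := and_congr_right fun hf => forall₃_congr fun x hx hxI =>
    (extendedLoewnerMatrix_posSemidef_iff (by omega) hx.injective fun i => hAt hf _ (hxI i)).trans
      (forall_dividedDiff_mulNormPoly_pairs_nonneg_iff hx.injective fun i => hAt hf _ (hxI i)).symm
  tfae_have 2 → 4 := fun h => by
    have hf : ContDiffOn ℝ 1 f I := (dobsch_of_tone hn hI hc (htone.2 h)).1.of_le
      (by exact_mod_cast (by omega : 1 ≤ 2 * n - 3))
    refine ⟨hf, fun x hx hxI => ?_⟩
    rw [forall_dividedDiff_mulNormPoly_pairs_nonneg_iff hx.injective fun i => hAt hf _ (hxI i)]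
    exact fun q hq => (htone.2 h q hq).dividedDiff_pairs_nonneg (by omega) hI
      (fun t ht => contDiffAt_mul_eval (hAt hf t ht) _) hx.injective hxI
  tfae_have 4 → 2 := fun ⟨hf, h⟩ => htone.1 fun q hq => by
    refine tone_of_dividedDiff_pairs_nonneg (by omega) hc
      (fun t ht => contDiffAt_mul_eval (hAt hf t ht) _) fun x hx hxI => ?_
    exact (forall_dividedDiff_mulNormPoly_pairs_nonneg_iff hx.injective
      fun i => hAt hf _ (hxI i)).1 (h x hx hxI) q hq
  tfae_have 2 → 8 := fun h => dobsch_of_tone hn hI hc (htone.2 h)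
  tfae_have 8 → 7 := fun ⟨h2, h3, h⟩ =>
    ⟨h2, h3, ae_mulNormPoly_deriv_nonneg_of_dobsch hn hI h2 h3 h⟩
  tfae_have 7 → 2 := fun ⟨h2, h3, h⟩ =>
    htone.1 (tone_of_ae_mulNormPoly_deriv_nonneg hn hI hc h2 h3 h)
  tfae_finish
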